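/- Let $k$ be a field of characteristic $0$ containing a primitive fifth root of unity $\zeta$, and let $a,b\in k$ with $a\,\Delta(a,b)\neq 0$, where $$\Delta(a,b)=512a^2+27a^3+48a^2b+128ab^2+6a^2b^2+30ab^3+a^2b^3+8b^4+2ab^4+b^5 .$$ (This is the condition that the cubic threefold $xu^2+2yuv+zv^2+2z^2u+2x^2v+ay^3+bxyz=0$ in $\mathbb P^4$ is smooth.) Let $H_{a,b}\subset\mathbb P^2$ be the quintic curve $$x^5-(b+2)x^2yz^2-(a-b)xy^3z+ay^5+z^5=0$$ and let $\mathcal H_{a,b}\to H_{a,b}$ be the double cover with function field $k(\mathcal H_{a,b})=k(H_{a,b})(w)$, $w^2=1-xz/y^2$. Let $\alpha_5$ be the automorphism $(x:y:z)\mapsto(\zeta x:y:\zeta^{-1}z)$ of $H_{a,b}$, and let $\tilde\alpha_5$ be its lift to $\mathcal H_{a,b}$ with $w\mapsto w$. Put $$f_4(t)=t^4-\Big(\tfrac{b^2}{4}+b\Big)t^3-\Big(\tfrac{ab}{2}+a-\tfrac{b^2}{4}\Big)t^2-\Big(\tfrac{a^2}{4}-\tfrac{ab}{2}\Big)t+\tfrac{a^2}{4}.$$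 Curves are given by affine equations and identified with their function fields over $k$ (that is, an equation stands for the smooth projective model of the curve it defines, and the quotient of a curve by an automorphism is the curve whose function field is the fixed field). All the curves below are integral, and the following holds. 1. The quotient $\overline H_{a,b}=H_{a,b}/\alpha_5$ is the curve $s^2=(1-t)f_4(t)$, with quotient map given by $$t=xz/y^2,\qquad s=(x/y)^5-\tfrac12\big((b+2)t^2+(a-b)t-a\big).$$ If $a+b\neq1$, it has genus $2$. 2. The quotient $\overline{\mathcal H}_{a,b}=\mathcal H_{a,b}/\tilde\alpha_5$ is the curve $r^2=f_4(1-w^2)$, with quotient map given by $w=w$, $r=s/w$. If $a+b\neq 1$, it has genus $3$. The map $\mathcal H_{a,b}\to H_{a,b}$ induces the double cover $\overline{\mathcal H}_{a,b}\to\overline H_{a,b}$, $(w,r)\mapsto(t,s)=(1-w^2,wr)$, which is the quotient by the involution $\sigma:(w,r)\mapsto(-w,-r)$. 3. The quotient of $\overline{\mathcal H}_{a,b}$ by the involution $(w,r)\mapsto(-w,r)$ is the genus one curve $E'_{a,b}:\ r^2=f_4(1-w)$, with quotient map $(w,r)\mapsto(w^2,r)$. 4. Let $E''_{a,b}$ be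 the Weierstrass curve $y^2+a_1xy+a_3y=x^3+a_2x^2+a_4x+a_6$ with $$a_1=\tfrac{b^2}{4}+b-4,\quad a_3=\tfrac{(a+b)^2}{2}+4a+6b-8,\quad a_2=2-a-\tfrac{ab}{2}-\tfrac{b^4}{64}-\tfrac{b^3}{8}-\tfrac{b^2}{4}-b,$$ $$a_4=4(a+b-1),\quad a_6=(a+b-1)\big(8-4a-2ab-\tfrac{b^4}{16}-\tfrac{b^3}{2}-b^2-4b\big).$$ Its discriminant is $-2^{-4}a^5\Delta(a,b)$, so it is an elliptic curve, and $$j(E''_{a,b})=-\frac{16\,(64a^2+4a^2b+16ab^2+a^2b^2+2ab^3+b^4)^3}{a^5\Delta(a,b)} .$$ The formulas $$x=2r+2w^2+a_1w,\qquad y=4wr+4w^3+2a_1w^2+2a_2w$$ define a birational isomorphism $E'_{a,b}\to E''_{a,b}$ over $k$. 5. If $a+b\neq1$, then $E''_{a,b}$ is the Prym variety of the double cover $\overline{\mathcal H}_{a,b}\to\overline H_{a,b}$: if $\varphi:\overline{\mathcal H}_{a,b}\to E'_{a,b}\to E''_{a,b}$ is the composition of the maps in 3 and 4, then over every algebraically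 closed field $K\supseteq k$ the map $P\mapsto[\varphi^*(P)-\varphi^*(O)]$ is a group isomorphism from $E''_{a,b}(K)$ onto the group of points $\mathrm{Prym}(\overline{\mathcal H}_{a,b}/\overline H_{a,b})(K)=(1-\sigma^*)\,\mathrm{Pic}^0(\overline{\mathcal H}_{a,b,K})$, the identity component of the kernel of the norm map $\mathrm{Pic}^0(\overline{\mathcal H}_{a,b,K})\to\mathrm{Pic}^0(\overline H_{a,b,K})$. -/

import Mathlib

open Polynomial

noncomputable section

/-! Function fields, places, differentials, divisor classes

A smooth projective curve over a field `K` of characteristic zero is handled through its function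
field `L`, a field with a `K`-algebra structure; a dominant map of curves `C' → C` is a `K`-algebra
homomorphism `K(C) → K(C')` of function fields. -/

namespace FunctionField

variable (K : Type*) [Field K] (L : Type*) [Field L] [Algebra K L]

/-- The places of `L / K`, that is the closed points of the smooth projective curve with function
field `L`: the valuation rings of `L` that contain `K` and are not all of `L`. -/
def Place : Type _ :=
  {O : ValuationSubring L // (∀ c : K, algebraMap K L c ∈ O) ∧ O ≠ ⊤}

variable {K L} in
open Classical in
/-- The normalized order of `f` at a place. The valuation ring `O` of a place of a function
field of one variable is a discrete valuation ring, so for `f ≠ 0` in `O` the order is the length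
of `O / (f)`; the value at `f = 0` is `0`, and never matters. -/
def Place.ord (v : Place K L) (f : L) : ℤ :=
  if h : f ∈ v.1 then ((Ring.ord v.1 ⟨f, h⟩).toNat : ℤ)
  else if h' : f⁻¹ ∈ v.1 then -((Ring.ord v.1 ⟨f⁻¹, h'⟩).toNat : ℤ)
  else 0

/-- The differentials of `L / K` that are regular at every place: at each place `v` they lie in
the `O_v`-module generated by the differentials of elements of `O_v`. -/
def regularDifferentials : Submodule K (Ω[L⁄K]) :=
  ⨅ v : Place K L, Submodule.span K
    {ω | ∃ f ∈ v.1, ∃ g ∈ v.1, ω = f • KaehlerDifferential.D K L g}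

/-- The genus: the dimension of the space of everywhere regular differentials. -/
def genus : ℕ := Module.finrank K (regularDifferentials K L)

/-- Divisors of the curve with function field `L`. -/
abbrev Divisor : Type _ := Place K L →₀ ℤ

/-- The degree of a divisor, over an algebraically closed field of constants (so that every place
has degree one). -/
def degree [IsAlgClosed K] : Divisor K L →+ ℤ :=
  Finsupp.liftAddHom fun _ => AddMonoidHom.id ℤ

/-- The group of principal divisors. -/
def principalDivisors : AddSubgroup (Divisor K L) :=
  AddSubgroup.closure {D | ∃ f : L, f ≠ 0 ∧ ∀ v : Place K L, D v = v.ord f}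

/-- The divisor class group. -/
abbrev Pic : Type _ := Divisor K L ⧸ principalDivisors K L

variable {K L} {M : Type*} [Field M] [Algebra K M]

/-- The ramification index at `w` of the map of curves given by `φ : L → M`: the least positive
order at `w` of an element of `φ(L)`. -/
def ramificationIndex (φ : L →ₐ[K] M) (w : Place K M) : ℕ :=
  sInf {n : ℕ | 0 < n ∧ ∃ f : L, w.ord (φ f) = n}

/-- The pull-back of divisors along the map of curves given by `φ : L → M`:
`φ^*(v) = ∑ e(w) w`, the sum over the (finitely many) places `w` of `M` above `v`. -/
def pullback (φ : L →ₐ[K] M) : Divisor K L →+ Divisor K M :=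
  Finsupp.liftAddHom fun v => zmultiplesHom (Divisor K M)
    (∑ᶠ w : {w : Place K M // w.1.comap (φ : L →+* M) = v.1},
      Finsupp.single w.1 (ramificationIndex φ w.1 : ℤ))

/-- `φ : F → L` exhibits the curve with function field `F` as the quotient, by the group generated
by `α`, of the curve with function field `L`: the image of `φ` is the fixed field of `α`. -/
def IsQuotient {F : Type*} [CommRing F] [Algebra K F] (α : L ≃ₐ[K] L) (φ : F →ₐ[K] L) : Prop :=
  Function.Injective φ ∧ ∀ f : L, f ∈ φ.range ↔ α f = f

/-- The group of points of the Prym variety of a double cover `C' → C` of smooth projective curves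
over an algebraically closed field, where `L` is the function field of `C'` and `σ` is the covering
involution: the subgroup `(1 - σ^*) Pic⁰(C')` of `Pic(C')` (which is the identity component
of the kernel of the norm map `Pic⁰(C') → Pic⁰(C)`). -/
def prym [IsAlgClosed K] (σ : L ≃ₐ[K] L) : AddSubgroup (Pic K L) :=
  ((degree K L).ker.map
      (AddMonoidHom.id (Divisor K L) - pullback (σ : L →ₐ[K] L))).map
    (QuotientAddGroup.mk' (principalDivisors K L))

end FunctionField

/-! The curves -/

section Curves

variable {k : Type*} [Field k]

/-- `Δ(a,b)`. -/
def DeltaAB (a b : k) : k :=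
  512 * a ^ 2 + 27 * a ^ 3 + 48 * a ^ 2 * b + 128 * a * b ^ 2 + 6 * a ^ 2 * b ^ 2
    + 30 * a * b ^ 3 + a ^ 2 * b ^ 3 + 8 * b ^ 4 + 2 * a * b ^ 4 + b ^ 5

/-- The equation, in the chart `y = 1`, of the plane quintic `H_{a,b}`:
`x⁵ - (b+2)x²yz² - (a-b)xy³z + ay⁵ + z⁵ = 0`, as a polynomial in `z` with coefficients in
`k[x]`. -/
def quintic (a b : k) : k[X][X] :=
  X ^ 5 - C (C (b + 2) * X ^ 2) * X ^ 2 - C (C (a - b) * X) * X + C (X ^ 5 + C a)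

/-- The coordinate ring of the affine chart `y ≠ 0` of `H_{a,b}`. -/
abbrev HRing (a b : k) : Type _ := AdjoinRoot (quintic a b)

/-- The function `x/y` on `H_{a,b}`. -/
def HRing.x (a b : k) : HRing a b := AdjoinRoot.of (quintic a b) X

/-- The function `z/y` on `H_{a,b}`. -/
def HRing.z (a b : k) : HRing a b := AdjoinRoot.root (quintic a b)

/-- The function field of `H_{a,b}`. -/
abbrev HField (a b : k) : Type _ := FractionRing (HRing a b)

/-- The coordinate ring of the affine model `w² = 1 - xz/y²` of the double cover `ℋ_{a,b}` of
`H_{a,b}`. -/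
abbrev CalHRing (a b : k) : Type _ :=
  AdjoinRoot (X ^ 2 - C (1 - HRing.x a b * HRing.z a b) : (HRing a b)[X])

/-- The function field of `ℋ_{a,b}`. -/
abbrev CalHField (a b : k) : Type _ := FractionRing (CalHRing a b)

namespace HField

/-- The rational function `x/y` on `H_{a,b}`. -/
def x (a b : k) : HField a b := algebraMap (HRing a b) (HField a b) (HRing.x a b)

/-- The rational function `z/y` on `H_{a,b}`. -/
def z (a b : k) : HField a b := algebraMap (HRing a b) (HField a b) (HRing.z a b)

end HField

namespace CalHField

/-- The rational function `x/y` on `ℋ_{a,b}`. -/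
def x (a b : k) : CalHField a b :=
  algebraMap (CalHRing a b) (CalHField a b) (AdjoinRoot.of _ (HRing.x a b))

/-- The rational function `z/y` on `ℋ_{a,b}`. -/
def z (a b : k) : CalHField a b :=
  algebraMap (CalHRing a b) (CalHField a b) (AdjoinRoot.of _ (HRing.z a b))

/-- The rational function `w` on `ℋ_{a,b}`. -/
def w (a b : k) : CalHField a b :=
  algebraMap (CalHRing a b) (CalHField a b) (AdjoinRoot.root _)

end CalHField

/-- The coordinate ring `k[X,Y]/(Y² - g(X))` of the affine curve `Y² = g(X)`. -/
abbrev QuadRing (g : k[X]) : Type _ := AdjoinRoot (X ^ 2 - C g : k[X][X])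

/-- The function field of the affine curve `Y² = g(X)`. -/
abbrev QuadField (g : k[X]) : Type _ := FractionRing (QuadRing g)

namespace QuadField

/-- The coordinate function `X` of the curve `Y² = g(X)`. -/
def x (g : k[X]) : QuadField g := algebraMap (QuadRing g) (QuadField g) (AdjoinRoot.of _ X)

/-- The coordinate function `Y` of the curve `Y² = g(X)`. -/
def y (g : k[X]) : QuadField g := algebraMap (QuadRing g) (QuadField g) (AdjoinRoot.root _)

end QuadField

/-- The quartic `f₄`. -/
def f4 (a b : k) : k[X] :=
  X ^ 4 - C (b ^ 2 / 4 + b) * X ^ 3 - C (a * b / 2 + a - b ^ 2 / 4) * X ^ 2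
    - C (a ^ 2 / 4 - a * b / 2) * X + C (a ^ 2 / 4)

/-- The right hand side of `s² = (1 - t) f₄(t)`. -/
def gHbar (a b : k) : k[X] := (1 - X) * f4 a b

/-- The right hand side of `r² = f₄(1 - w²)`. -/
def gCalHbar (a b : k) : k[X] := (f4 a b).comp (1 - X ^ 2)

/-- The right hand side of `r² = f₄(1 - w)`. -/
def gE (a b : k) : k[X] := (f4 a b).comp (1 - X)

/-- The Weierstrass curve `E''_{a,b}`. -/
def curveE (a b : k) : WeierstrassCurve k where
  a₁ := b ^ 2 / 4 + b - 4
  a₂ := 2 - a - a * b / 2 - b ^ 4 / 64 - b ^ 3 / 8 - b ^ 2 / 4 - b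
  a₃ := (a + b) ^ 2 / 2 + 4 * a + 6 * b - 8
  a₄ := 4 * (a + b - 1)
  a₆ := (a + b - 1) * (8 - 4 * a - 2 * a * b - b ^ 4 / 16 - b ^ 3 / 2 - b ^ 2 - 4 * b)

end Curves

namespace WeierstrassFunctionField

variable {k : Type*} [Field k] (W : WeierstrassCurve k)

/-- The coordinate function `X` of a Weierstrass curve. -/
def x : W.toAffine.FunctionField :=
  algebraMap W.toAffine.CoordinateRing _ (WeierstrassCurve.Affine.CoordinateRing.mk W.toAffine (C X))

/-- The coordinate function `Y` of a Weierstrass curve. -/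
def y : W.toAffine.FunctionField :=
  algebraMap W.toAffine.CoordinateRing _ (WeierstrassCurve.Affine.CoordinateRing.mk W.toAffine X)

variable {W}

/-- The place `v` of the function field of a Weierstrass curve is the one that belongs to the
point `P`: the point at infinity is the pole of `X`, and the place of an affine point `(x₀, y₀)` is
the common zero of `X - x₀` and `Y - y₀`. -/
def IsPlaceAt (v : FunctionField.Place k W.toAffine.FunctionField) : W.toAffine.Point → Prop
  | .zero => x W ∉ v.1
  | .some x₀ y₀ _ => x W - algebraMap k _ x₀ ∈ v.1.nonunits ∧ y W - algebraMap k _ y₀ ∈ v.1.nonunits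

end WeierstrassFunctionField

end

/-!
All curves are treated through their function fields and places. For a function field `L` that is
finite over `K(x)` the places at which `x` is finite are the localizations of the Dedekind domain
of functions integral over `K[x]` (`Place.discrete_and_exists_div`), so places are discrete; over
an algebraically closed field they are rational. For the quotient `φ : F → L` by an involution
`τ`, the places above a place of `F` are exchanged by `τ`, and the ramification index is `2` or
`1` according as the place is fixed by `τ` or not. Hence `φ^*` of the point below `v` is `v + τ v`
(`IsInvolutionQuotient.pullback_single_below`). All the quadratic equations `y² = g(x)` that occur
are instances of `IsQuadratic`.

*Genera.* If `g` is squarefree, the differentials of `y² = g(x)` that are regular everywhere are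
the `p(x) dx / y` with `deg p < n`, for `deg g = 2n + 1` or `2n + 2`. Squarefreeness of
`f₄(1 - w)` comes from the elliptic curve: as `a₆ = a₂ a₄`, the substitution `x = 2r + 2w² + a₁w`,
`y = 2w(x + a₂)` turns the quartic equation `r² = f₄(1 - w)`, multiplied by `x + a₂`, into the
Weierstrass equation (`curveE_equation`), and a multiple root would give a singular point of a
curve with nonzero discriminant. The same substitution is the birational isomorphism with the
Weierstrass curve.

*Integrality.* The quintic is `x⁵ + z⁵ = P(xz)` with a quadratic polynomial `P` (`sumPoly`). Over
`k(t)`, with `t = xz`, the function `u = x⁵` satisfies `u² - P(t) u + t⁵ = 0`, whose splitting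
field is the function field of `s² = (1 - t) f₄(t)`, and `u = s + P(t) / 2` is not a fifth power
there (`pow_five_ne`): the norm of a fifth root would be a multiple of `t`, and a comparison of
degrees contradicts the squarefreeness of `f₄`. So `x` has degree ten over `k(t)`, which gives the
irreducibility of the quintic (`irreducible_quintic`). A square root of `1 - t` on the quintic
would be fixed by the automorphism of order five, hence lie in `k(t, s)`, which is excluded by
degrees (`HField.sq_ne`). That the maps are quotients by cyclic groups is Kummer theory
(`isQuotient_of_kummer`).

*The Prym variety.* Let `ι` be the hyperelliptic involution `r ↦ -r`, let `τ` be `w ↦ -w`, and let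
`φ` be the quotient by `τ`, so `σ = τ ι`. As `τ v + ι (τ v)` is the hyperelliptic class `κ`,
`v - σ v ≡ v + τ v - κ = φ^*(φ(v)) - κ`, which shows that the image of `P ↦ [φ^*(P) - φ^*(O)]` is
`(1 - σ^*) Pic⁰` (`range_classHom`). The map is a homomorphism because the divisors of lines
relate the group law to linear equivalence
(`WeierstrassFunctionField.add_sub_mem_principalDivisors`). It is injective because a function
with divisor `φ^*(P - O)` is an eigenfunction of `τ`; the eigenvalue `-1` is excluded at the
points with `w = 0`, where `φ` is ramified and the anti-invariant function `w` has order one, and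
with eigenvalue `1` the divisor `P - O` is principal on the elliptic curve, which forces `P = O`
(`IsInvolutionQuotient.mem_principalDivisors_of_pullback`,
`WeierstrassFunctionField.single_sub_single_notMem`).
-/

open Polynomial FunctionField
open scoped IntermediateField.algebraAdjoinAdjoin

noncomputable section

namespace FunctionField

/-! ### Orders at a place -/

section Order

variable {K L : Type*} [Field K] [Field L] [Algebra K L]

/-- All places of `L / K` are discrete. This holds for function fields of one variable, see
`discretePlaces_of_finite`. -/
class DiscretePlaces (K L : Type*) [Field K] [Field L] [Algebra K L] : Prop where
  dvr : ∀ v : Place K L, IsDiscreteValuationRing v.1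

namespace Place

instance [DiscretePlaces K L] (v : Place K L) : IsDiscreteValuationRing v.1 :=
  DiscretePlaces.dvr v

theorem algebraMap_mem (v : Place K L) (c : K) : algebraMap K L c ∈ v.1 := v.2.1 c

/-- Discrete valuation rings are maximal among the proper subrings of their fraction field, so an
inclusion of places is an equality. -/
theorem ext_le {v v' : Place K L} [DiscretePlaces K L] (h : v.1 ≤ v'.1) : v = v' := by
  refine Subtype.ext ?_
  have : Ring.KrullDimLE 1 v.1 := inferInstance
  exact v.1.eq_of_le_of_ne_top h v'.2.2

variable (v : Place K L)

theorem mem_or_inv_mem (f : L) : f ∈ v.1 ∨ f⁻¹ ∈ v.1 := v.1.mem_or_inv_mem f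

theorem inv_mem_nonunits {f : L} (hf : f ∉ v.1) : f⁻¹ ∈ v.1.nonunits :=
  v.1.inv_mem_nonunits_iff.2 (Or.inr hf)

theorem mem_of_nonunit {f : L} (hf : f ∈ v.1.nonunits) : f ∈ v.1 := v.1.nonunits_le hf

theorem mul_mem_nonunits {f g : L} (hf : f ∈ v.1) (hg : g ∈ v.1.nonunits) :
    f * g ∈ v.1.nonunits := by
  rw [ValuationSubring.mem_nonunits_iff] at *
  rw [map_mul]
  exact (mul_le_of_le_one_left' ((v.1.valuation_le_one_iff f).2 hf)).trans_lt hg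

theorem one_notMem_nonunits : (1 : L) ∉ v.1.nonunits := by
  rw [ValuationSubring.mem_nonunits_iff, map_one]
  exact lt_irrefl _

theorem algebraMap_notMem_nonunits {c : K} (hc : c ≠ 0) : algebraMap K L c ∉ v.1.nonunits := by
  intro h
  have := v.mul_mem_nonunits (v.algebraMap_mem c⁻¹) h
  rw [← map_mul, inv_mul_cancel₀ hc, map_one] at this
  exact v.one_notMem_nonunits this

theorem eq_of_sub_mem_nonunits {f : L} {c d : K} (h : f - algebraMap K L c ∈ v.1.nonunits)
    (h' : f - algebraMap K L d ∈ v.1.nonunits) : c = d := by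
  by_contra hcd
  refine v.algebraMap_notMem_nonunits (sub_ne_zero.2 hcd) ?_
  have := sub_mem h' h
  rwa [sub_sub_sub_cancel_left, ← map_sub] at this

theorem mem_of_sub_mem_nonunits {f : L} {c : K} (h : f - algebraMap K L c ∈ v.1.nonunits) :
    f ∈ v.1 := by
  have := add_mem (v.mem_of_nonunit h) (v.algebraMap_mem c)
  rwa [sub_add_cancel] at this

theorem mem_nonunits_of_mul {f g : L}
    (h : f * g ∈ v.1.nonunits) : f ∈ v.1.nonunits ∨ g ∈ v.1.nonunits := by
  simp only [ValuationSubring.mem_nonunits_iff, map_mul] at *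
  by_contra! hh
  exact absurd h (not_lt.2 (one_le_mul hh.1 hh.2))

theorem inv_mem_of_notMem_nonunits {f : L} (hf : f ∉ v.1.nonunits) : f⁻¹ ∈ v.1 := by
  rw [ValuationSubring.mem_nonunits_iff_or] at hf
  push Not at hf
  exact hf.2

theorem notMem_nonunits_of_inv_mem {f : L} (h0 : f ≠ 0) (hf : f⁻¹ ∈ v.1) : f ∉ v.1.nonunits := by
  rw [ValuationSubring.mem_nonunits_iff_or]
  push Not
  exact ⟨h0, hf⟩

theorem mem_of_pow_mem {f : L} {n : ℕ} (hn : n ≠ 0) (h : f ^ n ∈ v.1) : f ∈ v.1 := by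
  by_contra hf
  apply v.one_notMem_nonunits
  have h1 := v.inv_mem_nonunits hf
  have hf0 : f ≠ 0 := by rintro rfl; exact hf v.1.zero_mem
  obtain ⟨n, rfl⟩ := Nat.exists_eq_succ_of_ne_zero hn
  have h2 := v.mul_mem_nonunits (v.1.mul_mem _ _ h (pow_mem (v.mem_of_nonunit h1) n)) h1
  rwa [mul_assoc, ← pow_succ, ← mul_pow, mul_inv_cancel₀ hf0, one_pow] at h2

variable [DiscretePlaces K L]

theorem exists_uniformizer : ∃ p : L, ∃ h : p ∈ v.1, Irreducible (⟨p, h⟩ : v.1) := by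
  obtain ⟨p, hp⟩ := IsDiscreteValuationRing.exists_irreducible v.1
  exact ⟨p.1, p.2, hp⟩

/-- A uniformizer computes the order, which is defined through the length of `O / (f)`. -/
theorem ord_zpow_mul_unit {p : L} (hp : p ∈ v.1) (hi : Irreducible (⟨p, hp⟩ : v.1))
    (u : v.1ˣ) (n : ℤ) : v.ord (p ^ n * (u : v.1)) = n := by
  have hp0 : p ≠ 0 := fun h => hi.ne_zero (Subtype.ext h)
  have key : ∀ (m : ℕ) (u : v.1ˣ) (h : p ^ m * (u : v.1) ∈ v.1),
      (Ring.ord v.1 ⟨p ^ m * (u : v.1), h⟩).toNat = m := by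
    intro m u h
    have : (⟨p ^ m * (u : v.1), h⟩ : v.1) = ⟨p, hp⟩ ^ m * u := by
      ext; simp
    rw [this, Ring.ord_mul_of_isUnit_right u.isUnit,
      Ring.ord_pow (mem_nonZeroDivisors_of_ne_zero hi.ne_zero), Ring.ord_of_irreducible hi]
    simp
  have hmem : ∀ (m : ℕ) (u : v.1ˣ), p ^ m * (u : v.1) ∈ v.1 := fun m u =>
    v.1.mul_mem _ _ (pow_mem hp m) (u : v.1).2
  have hu0 : ((u : v.1) : L) ≠ 0 := fun h => u.ne_zero (Subtype.ext h)
  have huinv : ((u⁻¹ : v.1ˣ) : v.1) = (((u : v.1) : L)⁻¹ : L) := by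
    refine eq_inv_of_mul_eq_one_left ?_
    exact congrArg Subtype.val (Units.inv_mul u)
  rcases n with m | m
  · simp only [Int.ofNat_eq_natCast, zpow_natCast]
    rw [ord, dif_pos (hmem m u), key m u]
  · have hinv : (p ^ (Int.negSucc m) * ((u : v.1) : L))⁻¹ = p ^ (m + 1) * ((u⁻¹ : v.1ˣ) : v.1) := by
      rw [huinv, zpow_negSucc, mul_inv, inv_inv]
    have h1 : p ^ (Int.negSucc m) * ((u : v.1) : L) ∉ v.1 := by
      intro h
      have h2 : (⟨_, h⟩ : v.1) * (⟨p, hp⟩ ^ (m + 1) * ((u⁻¹ : v.1ˣ) : v.1)) = 1 := by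
        ext
        push_cast
        rw [← hinv]
        exact mul_inv_cancel₀ (mul_ne_zero (zpow_ne_zero _ hp0) hu0)
      have h3 : IsUnit ((⟨p, hp⟩ : v.1) ^ (m + 1)) :=
        isUnit_of_dvd_one ⟨⟨_, h⟩ * ((u⁻¹ : v.1ˣ) : v.1), by rw [← h2]; ring⟩
      exact hi.not_isUnit (isUnit_pow_succ_iff.1 h3)
    have h4 := hmem (m + 1) u⁻¹
    have h5 : (p ^ (Int.negSucc m) * ((u : v.1) : L))⁻¹ ∈ v.1 := by rw [hinv]; exact h4
    have h6 : (⟨_, h5⟩ : v.1) = ⟨_, h4⟩ := Subtype.ext hinv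
    rw [ord, dif_neg h1, dif_pos h5, h6, key]
    rfl

theorem exists_eq_zpow_mul_unit {p : L} (hp : p ∈ v.1) (hi : Irreducible (⟨p, hp⟩ : v.1))
    {f : L} (hf : f ≠ 0) : ∃ (n : ℤ) (u : v.1ˣ), f = p ^ n * (u : v.1) := by
  have key : ∀ f : L, f ≠ 0 → f ∈ v.1 → ∃ (n : ℕ) (u : v.1ˣ), f = p ^ n * (u : v.1) := by
    intro f hf h
    obtain ⟨n, u, h1⟩ := IsDiscreteValuationRing.eq_unit_mul_pow_irreducible
      (x := (⟨f, h⟩ : v.1)) (fun h => hf (congrArg Subtype.val h)) hi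
    refine ⟨n, u, ?_⟩
    have := congrArg Subtype.val h1
    simpa [mul_comm] using this
  rcases v.mem_or_inv_mem f with h | h
  · obtain ⟨n, u, h1⟩ := key f hf h
    exact ⟨n, u, by rw [h1, zpow_natCast]⟩
  · obtain ⟨n, u, h1⟩ := key _ (inv_ne_zero hf) h
    refine ⟨-n, u⁻¹, ?_⟩
    have huinv : ((u⁻¹ : v.1ˣ) : v.1) = (((u : v.1) : L)⁻¹ : L) := by
      refine eq_inv_of_mul_eq_one_left ?_
      exact congrArg Subtype.val (Units.inv_mul u)
    rw [huinv, ← inv_inv f, h1, mul_inv, zpow_neg, zpow_natCast]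

theorem ord_mul {f g : L} (hf : f ≠ 0) (hg : g ≠ 0) : v.ord (f * g) = v.ord f + v.ord g := by
  obtain ⟨p, hp, hi⟩ := v.exists_uniformizer
  have hp0 : p ≠ 0 := fun h => hi.ne_zero (Subtype.ext h)
  obtain ⟨n, u, rfl⟩ := v.exists_eq_zpow_mul_unit hp hi hf
  obtain ⟨m, w, rfl⟩ := v.exists_eq_zpow_mul_unit hp hi hg
  have : p ^ n * ((u : v.1) : L) * (p ^ m * ((w : v.1) : L))
      = p ^ (n + m) * (((u * w : v.1ˣ) : v.1) : L) := by
    rw [zpow_add₀ hp0]; push_cast; ring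
  rw [this, ord_zpow_mul_unit v hp hi, ord_zpow_mul_unit v hp hi, ord_zpow_mul_unit v hp hi]

theorem ord_one : v.ord (1 : L) = 0 := by
  have := v.ord_mul (one_ne_zero (α := L)) one_ne_zero
  rw [mul_one] at this
  lia

theorem ord_inv (f : L) : v.ord f⁻¹ = -v.ord f := by
  by_cases hf : f = 0
  · subst hf
    have : v.ord (0 : L) = 0 := by
      rw [ord, dif_pos v.1.zero_mem]
      -- the length of the ring itself is infinite, and the order at `0` is therefore `0`
      have : Ring.ord v.1 (⟨0, v.1.zero_mem⟩ : v.1) = ⊤ := by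
        have h := Ring.ord_zero v.1
        rw [show (⟨0, v.1.zero_mem⟩ : v.1) = 0 from rfl, h]
        by_contra hlen
        have := (Module.length_ne_top_iff.1 hlen)
        have h2 := (isFiniteLength_iff_isNoetherian_isArtinian.1 this).2
        have : IsArtinianRing v.1 := h2
        exact IsDiscreteValuationRing.not_isField v.1 (IsArtinianRing.isField_of_isDomain v.1)
      rw [this]; rfl
    rw [inv_zero, this]; rfl
  · have := v.ord_mul hf (inv_ne_zero hf)
    rw [mul_inv_cancel₀ hf, ord_one] at this
    lia

theorem ord_pow {f : L} (hf : f ≠ 0) (n : ℕ) : v.ord (f ^ n) = n * v.ord f := by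
  induction n with
  | zero => simp [ord_one]
  | succ n ih => rw [pow_succ, v.ord_mul (pow_ne_zero _ hf) hf, ih]; push_cast; ring

theorem ord_zpow {f : L} (hf : f ≠ 0) (n : ℤ) : v.ord (f ^ n) = n * v.ord f := by
  rcases n with n | n
  · simpa using v.ord_pow hf n
  · rw [zpow_negSucc, ord_inv, v.ord_pow hf, Int.negSucc_eq]; push_cast; ring

theorem ord_nonneg_iff {f : L} (hf : f ≠ 0) : 0 ≤ v.ord f ↔ f ∈ v.1 := by
  constructor
  · intro h
    obtain ⟨p, hp, hi⟩ := v.exists_uniformizer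
    obtain ⟨n, u, rfl⟩ := v.exists_eq_zpow_mul_unit hp hi hf
    rw [v.ord_zpow_mul_unit hp hi] at h
    lift n to ℕ using h
    rw [zpow_natCast]
    exact v.1.mul_mem _ _ (pow_mem hp n) (u : v.1).2
  · intro h
    rw [ord, dif_pos h]
    exact Int.natCast_nonneg _

theorem ord_pos_iff {f : L} (hf : f ≠ 0) : 0 < v.ord f ↔ f ∈ v.1.nonunits := by
  rw [ValuationSubring.mem_nonunits_iff_or, ← v.ord_nonneg_iff (inv_ne_zero hf), ord_inv]
  constructor
  · intro h; right; lia
  · rintro (h | h)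
    · exact absurd h hf
    · lia

theorem ord_neg_iff {f : L} (hf : f ≠ 0) : v.ord f < 0 ↔ f ∉ v.1 := by
  rw [← v.ord_nonneg_iff hf, not_le]

theorem ord_eq_zero {f : L} (h : f ∈ v.1) (h' : f ∉ v.1.nonunits) : v.ord f = 0 := by
  have hf : f ≠ 0 := fun h0 => h' (by rw [h0]; exact zero_mem _)
  have h1 := (v.ord_nonneg_iff hf).2 h
  have h2 := mt (v.ord_pos_iff hf).1 h'
  lia

theorem ord_algebraMap {c : K} (hc : c ≠ 0) : v.ord (algebraMap K L c) = 0 :=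
  v.ord_eq_zero (v.algebraMap_mem c) (v.algebraMap_notMem_nonunits hc)

theorem ord_neg (f : L) : v.ord (-f) = v.ord f := by
  by_cases hf : f = 0
  · rw [hf, neg_zero]
  have := v.ord_algebraMap (c := -1) (neg_ne_zero.2 one_ne_zero)
  rw [map_neg, map_one] at this
  rw [← neg_one_mul, v.ord_mul (neg_ne_zero.2 one_ne_zero) hf, this, zero_add]

theorem le_ord_div_iff {f g : L} (hf : f ≠ 0) (hg : g ≠ 0) :
    v.ord g ≤ v.ord f ↔ f / g ∈ v.1 := by
  rw [← v.ord_nonneg_iff (div_ne_zero hf hg), div_eq_mul_inv, v.ord_mul hf (inv_ne_zero hg),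
    ord_inv]
  constructor <;> intro h <;> lia

theorem add_ne_zero_of_ord_lt {f g : L} (hf : f ≠ 0) (h : g = 0 ∨ v.ord f < v.ord g) :
    f + g ≠ 0 := by
  intro h0
  rcases h with h | h
  · rw [h, add_zero] at h0; exact hf h0
  · rw [eq_neg_of_add_eq_zero_left h0, v.ord_neg] at h
    exact lt_irrefl _ h

/-- The strict triangle inequality. -/
theorem ord_add_of_lt {f g : L} (hf : f ≠ 0) (h : g = 0 ∨ v.ord f < v.ord g) :
    v.ord (f + g) = v.ord f := by
  rcases eq_or_ne g 0 with hg | hg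
  · rw [hg, add_zero]
  have h := h.resolve_left hg
  have h1 : g / f ∈ v.1.nonunits := by
    rw [← v.ord_pos_iff (div_ne_zero hg hf), div_eq_mul_inv, v.ord_mul hg (inv_ne_zero hf),
      ord_inv]
    lia
  have h2 : v.ord (1 + g / f) = 0 := by
    refine v.ord_eq_zero (add_mem v.1.one_mem (v.mem_of_nonunit h1)) fun h3 => ?_
    have := sub_mem h3 h1
    rw [add_sub_cancel_right] at this
    exact v.one_notMem_nonunits this
  have h3 : (1 + g / f) ≠ 0 := by
    intro h3
    have : g / f = -1 := by linear_combination h3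
    rw [this] at h1
    exact v.one_notMem_nonunits (by simpa using neg_mem h1)
  have : f + g = f * (1 + g / f) := by field_simp
  rw [this, v.ord_mul hf h3, h2, add_zero]

theorem ord_uniformizer {p : L} (hp : p ∈ v.1) (hi : Irreducible (⟨p, hp⟩ : v.1)) :
    v.ord p = 1 := by
  simpa using v.ord_zpow_mul_unit hp hi 1 1

theorem exists_ord_eq_one : ∃ p : L, p ≠ 0 ∧ v.ord p = 1 := by
  obtain ⟨p, hp, hi⟩ := v.exists_uniformizer
  exact ⟨p, fun h => hi.ne_zero (Subtype.ext h), v.ord_uniformizer hp hi⟩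

/-- The order is determined by any function that behaves like a normalized valuation. -/
theorem ord_eq_of_normalized {w : L → ℤ} {p : L} (hp : p ≠ 0) (hw : w p = 1)
    (hmul : ∀ f g, f ≠ 0 → g ≠ 0 → w (f * g) = w f + w g)
    (hnonneg : ∀ f, f ≠ 0 → (0 ≤ w f ↔ f ∈ v.1)) {f : L} (hf : f ≠ 0) : v.ord f = w f := by
  have hone : w 1 = 0 := by
    have := hmul 1 1 one_ne_zero one_ne_zero
    rw [mul_one] at this
    lia
  have hinv : ∀ f, f ≠ 0 → w f⁻¹ = - w f := fun f hf => by
    have := hmul f f⁻¹ hf (inv_ne_zero hf)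
    rw [mul_inv_cancel₀ hf, hone] at this
    lia
  have hzero : ∀ f, f ≠ 0 → (w f = 0 ↔ v.ord f = 0) := fun f hf => by
    have h1 := (hnonneg f hf).trans (v.ord_nonneg_iff hf).symm
    have h2 := (hnonneg f⁻¹ (inv_ne_zero hf)).trans (v.ord_nonneg_iff (inv_ne_zero hf)).symm
    rw [hinv f hf, ord_inv] at h2
    lia
  have hpow : ∀ (f : L) (n : ℕ), f ≠ 0 → w (f ^ n) = n * w f := fun f n hf => by
    induction n with
    | zero => simp [hone]
    | succ n ih => rw [pow_succ, hmul _ _ (pow_ne_zero _ hf) hf, ih]; push_cast; ring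
  have hzpow : ∀ (f : L) (n : ℤ), f ≠ 0 → w (f ^ n) = n * w f := fun f n hf => by
    rcases n with n | n
    · simpa using hpow f n hf
    · rw [zpow_negSucc, hinv _ (pow_ne_zero _ hf), hpow f _ hf, Int.negSucc_eq]; push_cast; ring
  -- `f / p ^ w f` is a unit for `w`, and `ord p = 1` since some element has order `1`
  have key : ∀ f, f ≠ 0 → v.ord f = w f * v.ord p := fun f hf => by
    have h1 : w (f * p ^ (-w f)) = 0 := by
      rw [hmul _ _ hf (zpow_ne_zero _ hp), hzpow _ _ hp, hw]; ring
    rw [hzero _ (mul_ne_zero hf (zpow_ne_zero _ hp)), v.ord_mul hf (zpow_ne_zero _ hp),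
      v.ord_zpow hp] at h1
    linarith
  obtain ⟨q, hq, hq1⟩ := v.exists_ord_eq_one
  have h1 := key q hq
  rw [hq1] at h1
  have h2 : 0 ≤ v.ord p := (v.ord_nonneg_iff hp).2 ((hnonneg p hp).1 (by lia))
  have h3 : v.ord p = 1 := Int.eq_one_of_dvd_one h2 ⟨w q, by linarith⟩
  rw [key f hf, h3, mul_one]

end Place

end Order

/-! ### Existence and discreteness of places -/

section Existence

variable {K L : Type*} [Field K] [Field L] [Algebra K L]

/-- Existence of places: a non-unit of a subring that contains the constants is a non-unit of a
valuation ring above the subring. -/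
theorem exists_place_of_notMem_range {A : Subring L} (hK : ∀ c : K, algebraMap K L c ∈ A) {p : L}
    (hp : p ∈ A) (hp0 : p ≠ 0) (hinv : p⁻¹ ∉ A) :
    ∃ v : Place K L, (∀ f ∈ A, f ∈ v.1) ∧ p ∈ v.1.nonunits := by
  have hI : Ideal.span {(⟨p, hp⟩ : A)} ≠ ⊤ := by
    intro h
    obtain ⟨a, ha⟩ := Ideal.mem_span_singleton.1 ((Ideal.eq_top_iff_one _).1 h)
    apply hinv
    have := congrArg Subtype.val ha
    rw [inv_eq_of_mul_eq_one_right this.symm]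
    exact a.2
  obtain ⟨B, hB, hB'⟩ := Ideal.image_subset_nonunits_valuationSubring _ hI
  have hpB : p ∈ B.nonunits :=
    hB' ⟨⟨p, hp⟩, Ideal.subset_span rfl, rfl⟩
  refine ⟨⟨B, fun c => hB (hK c), fun h => ?_⟩, fun f hf => hB hf, hpB⟩
  rw [ValuationSubring.mem_nonunits_iff_or] at hpB
  refine hpB.elim hp0 fun h' => h' (by rw [h]; trivial)

/-- A transcendental function has a zero. -/
theorem exists_place_of_transcendental {x : L} (hx : Transcendental K x) :
    ∃ v : Place K L, x ∈ v.1.nonunits := by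
  have hx0 : x ≠ 0 := by rintro rfl; exact hx isAlgebraic_zero
  -- `x` is not invertible in the polynomial ring `K[x]`
  obtain ⟨v, -, hv⟩ := exists_place_of_notMem_range (K := K)
    (A := (Algebra.adjoin K {x}).toSubring) (p := x)
    (fun c => (Algebra.adjoin K {x}).algebraMap_mem c) (Algebra.subset_adjoin rfl) hx0 (by
      intro h
      rw [Subalgebra.mem_toSubring, Algebra.adjoin_singleton_eq_range_aeval] at h
      obtain ⟨p, hp⟩ := h
      have h1 : aeval x (X * p - 1) = 0 := by
        have : aeval x p = x⁻¹ := hp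
        rw [map_sub, map_mul, aeval_X, this, mul_inv_cancel₀ hx0, map_one, sub_self]
      have h2 := (transcendental_iff.1 hx) _ h1
      have h3 := congrArg (Polynomial.eval 0) h2
      simp at h3)
  exact ⟨v, hv⟩

/-- Otherwise the inverse of `f` would have a zero. -/
theorem isAlgebraic_of_forall_mem {f : L} (h : ∀ v : Place K L, f ∈ v.1) : IsAlgebraic K f := by
  by_contra hf
  have hf0 : f ≠ 0 := by rintro rfl; exact hf isAlgebraic_zero
  obtain ⟨v, hv⟩ := exists_place_of_transcendental (K := K) (x := f⁻¹)
    (fun h' => hf (by simpa using h'.inv))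
  rcases (v.1.inv_mem_nonunits_iff).1 hv with h' | h'
  · exact hf0 h'
  · exact h' (h v)

theorem _root_.IsAlgClosed.exists_algebraMap_eq_of_isAlgebraic [IsAlgClosed K] {f : L}
    (h : IsAlgebraic K f) : ∃ c : K, algebraMap K L c = f := by
  have h1 := IsAlgClosed.degree_eq_one_of_irreducible K (minpoly.irreducible h.isIntegral)
  exact minpoly.mem_range_of_degree_eq_one K f h1

theorem exists_algebraMap_eq_of_forall_mem [IsAlgClosed K] {f : L}
    (h : ∀ v : Place K L, f ∈ v.1) : ∃ c : K, algebraMap K L c = f :=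
  IsAlgClosed.exists_algebraMap_eq_of_isAlgebraic (isAlgebraic_of_forall_mem h)

theorem Place.mem_of_isIntegral (v : Place K L) {x : L} (hx : x ∈ v.1) {f : L}
    (hf : IsIntegral (Algebra.adjoin K {x}) f) : f ∈ v.1 := by
  obtain ⟨p, hp, hpe⟩ := hf
  have hle : ∀ a : Algebra.adjoin K {x}, (a : L) ∈ v.1 := by
    rintro ⟨a, ha⟩
    refine Algebra.adjoin_induction (p := fun a _ => a ∈ v.1) ?_ ?_ ?_ ?_ ha
    · rintro y rfl; exact hx
    · exact v.algebraMap_mem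
    · exact fun _ _ _ _ h h' => v.1.add_mem _ _ h h'
    · exact fun _ _ _ _ h h' => v.1.mul_mem _ _ h h'
  let j : Algebra.adjoin K {x} →+* v.1 :=
    { toFun := fun a => ⟨a, hle a⟩
      map_one' := rfl
      map_mul' := fun _ _ => rfl
      map_zero' := rfl
      map_add' := fun _ _ => rfl }
  have : IsIntegral v.1 f := ⟨p.map j, hp.map _, by rw [eval₂_map]; exact hpe⟩
  obtain ⟨y, hy⟩ := IsIntegrallyClosed.isIntegral_iff.1 this
  rw [← hy]
  exact y.2

section Core

variable [CharZero K] {x : L} (hx : Transcendental K x)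
  [FiniteDimensional (IntermediateField.adjoin K {x}) L]

include hx

theorem isDedekindDomain_integralClosure_adjoin :
    IsDedekindDomain (integralClosure (Algebra.adjoin K {x}) L) := by
  have e : K[X] ≃ₐ[K] Algebra.adjoin K {x} :=
    (AlgEquiv.ofInjective (aeval x) (transcendental_iff_injective.1 hx)).trans
      (Subalgebra.equivOfEq _ _ (Algebra.adjoin_singleton_eq_range_aeval K x).symm)
  have : IsPrincipalIdealRing (Algebra.adjoin K {x}) :=
    IsPrincipalIdealRing.of_surjective e.toRingEquiv.toRingHom e.surjective
  have : CharZero (IntermediateField.adjoin K {x}) := inferInstance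
  exact IsIntegralClosure.isDedekindDomain (Algebra.adjoin K {x}) (IntermediateField.adjoin K {x})
    L _

/-- A place at which `x` is finite is the localization of the integral closure of `K[x]` at a
maximal ideal. -/
theorem Place.discrete_and_exists_div (v : Place K L) (hxv : x ∈ v.1) :
    IsDiscreteValuationRing v.1 ∧ ∀ f ∈ v.1, ∃ a b : L,
      IsIntegral (Algebra.adjoin K {x}) a ∧ IsIntegral (Algebra.adjoin K {x}) b ∧
      b ∉ v.1.nonunits ∧ f = a / b := by
  have := isDedekindDomain_integralClosure_adjoin hx
  set A := integralClosure (Algebra.adjoin K {x}) L with hA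
  have : IsFractionRing A L :=
    integralClosure.isFractionRing_of_finite_extension (IntermediateField.adjoin K {x}) L
  have hle : ∀ a : A, (a : L) ∈ v.1 := fun a => v.mem_of_isIntegral hxv a.2
  let j : A →+* v.1 :=
    { toFun := fun a => ⟨a, hle a⟩
      map_one' := rfl
      map_mul' := fun _ _ => rfl
      map_zero' := rfl
      map_add' := fun _ _ => rfl }
  -- the center of `v` on the integral closure; it is not zero, as `v` is not the trivial place
  set P : Ideal A := (IsLocalRing.maximalIdeal v.1).comap j with hP
  have hPp : P.IsPrime := Ideal.comap_isPrime _ _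
  have hPmem : ∀ a : A, a ∈ P ↔ (a : L) ∈ v.1.nonunits := fun a =>
    (v.1.coe_mem_nonunits_iff (a := j a)).symm
  have hP0 : P ≠ ⊥ := by
    intro h
    apply v.2.2
    refine ValuationSubring.ext _ _ fun f => ⟨fun _ => trivial, fun _ => ?_⟩
    obtain ⟨a, b, hb, rfl⟩ := IsFractionRing.div_surjective (A := A) f
    have hb0 : b ≠ 0 := nonZeroDivisors.ne_zero hb
    have hb1 : b ∉ P := by rw [h]; exact hb0
    rw [hPmem] at hb1
    rw [div_eq_mul_inv]
    exact v.1.mul_mem _ _ (hle a) (v.inv_mem_of_notMem_nonunits hb1)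
  -- of `a / b` and `b / a` one lies in the valuation ring `A_P`, which is dominated by `O_v`
  have key : ∀ f ∈ v.1, ∃ a b : A, b ∉ P ∧ f * b = a := by
    intro f hf
    obtain ⟨a, b, hb, rfl⟩ := IsFractionRing.div_surjective (A := A) f
    have hb0 : b ≠ 0 := nonZeroDivisors.ne_zero hb
    have hb0' : (b : L) ≠ 0 := fun h => hb0 (Subtype.ext h)
    by_cases ha0 : a = 0
    · exact ⟨0, 1, (Ideal.ne_top_iff_one _).1 hPp.ne_top, by simp [ha0]⟩
    have ha0' : (a : L) ≠ 0 := fun h => ha0 (Subtype.ext h)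
    have hd := IsLocalization.AtPrime.isDiscreteValuationRing_of_dedekind_domain A hP0
      (Localization.AtPrime P)
    have hval : ∀ a b : A, algebraMap A (Localization.AtPrime P) b ∣ algebraMap A _ a →
        ∃ c s : A, s ∉ P ∧ (a : L) * s = b * c := by
      rintro a b ⟨y, hy⟩
      obtain ⟨c, s, rfl⟩ := IsLocalization.exists_mk'_eq P.primeCompl y
      refine ⟨c, s, s.2, ?_⟩
      have h1 : algebraMap A (Localization.AtPrime P) (a * s) = algebraMap A _ (b * c) := by
        rw [map_mul, map_mul, hy, mul_assoc, IsLocalization.mk'_spec]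
      have h2 := IsLocalization.injective (Localization.AtPrime P)
        P.primeCompl_le_nonZeroDivisors h1
      exact congrArg Subtype.val h2
    have : ValuationRing (Localization.AtPrime P) :=
      ((IsDiscreteValuationRing.TFAE (Localization.AtPrime P) hd.not_isField).out 0 1).1 hd
    rcases ValuationRing.dvd_total (h := this.toPreValuationRing)
      (algebraMap A (Localization.AtPrime P) b) (algebraMap A _ a) with h | h
    · obtain ⟨c, s, hs, h1⟩ := hval a b h
      refine ⟨c, s, hs, ?_⟩
      change (a : L) / b * s = c
      rw [div_mul_eq_mul_div, h1, mul_div_cancel_left₀ _ hb0']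
    · obtain ⟨c, s, hs, h1⟩ := hval b a h
      refine ⟨s, c, fun hc => ?_, ?_⟩
      · rw [hPmem] at hc hs
        apply hs
        have : (s : L) = (a : L) / b * c := by
          rw [div_mul_eq_mul_div, ← h1, mul_div_cancel_left₀ _ hb0']
        rw [this]
        exact v.mul_mem_nonunits hf hc
      · change (a : L) / b * c = s
        rw [div_mul_eq_mul_div, ← h1, mul_div_cancel_left₀ _ hb0']
  constructor
  · let _ : Algebra A v.1 := j.toAlgebra
    have : IsLocalization.AtPrime v.1 P :=
      { map_units := fun s => by
          by_contra h
          exact s.2 h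
        surj := fun z => by
          obtain ⟨a, b, hb, h⟩ := key z.1 z.2
          exact ⟨(a, ⟨b, hb⟩), Subtype.ext h⟩
        exists_of_eq := fun {a b} h => ⟨1, by
          have : a = b := Subtype.ext (congrArg (fun z : v.1 => (z : L)) h)
          rw [this]⟩ }
    exact IsLocalization.AtPrime.isDiscreteValuationRing_of_dedekind_domain A hP0 v.1
  · intro f hf
    obtain ⟨a, b, hb, h⟩ := key f hf
    rw [hPmem] at hb
    refine ⟨a, b, a.2, b.2, hb, ?_⟩
    rw [← h, mul_div_cancel_right₀]
    rintro h0
    exact hb (by rw [h0]; exact zero_mem _)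

/-- At a place that does not contain `x` the field is viewed as a finite extension of `K(x⁻¹)`. -/
theorem discretePlaces_of_finite : DiscretePlaces K L := by
  refine ⟨fun v => ?_⟩
  rcases v.mem_or_inv_mem x with h | h
  · exact (v.discrete_and_exists_div hx h).1
  · have hx' : Transcendental K x⁻¹ := fun h' => hx (by simpa using h'.inv)
    have hadj : IntermediateField.adjoin K {x⁻¹} = IntermediateField.adjoin K {x} := by
      apply le_antisymm <;> rw [IntermediateField.adjoin_simple_le_iff]
      · exact inv_mem (IntermediateField.mem_adjoin_simple_self K x)
      · rw [← inv_inv x, inv_inv x⁻¹]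
        exact inv_mem (IntermediateField.mem_adjoin_simple_self K x⁻¹)
    have : FiniteDimensional (IntermediateField.adjoin K {x⁻¹}) L := by rw [hadj]; infer_instance
    exact (v.discrete_and_exists_div hx' h).1

end Core

/-- In transcendence degree one every transcendental element is a transcendence basis. -/
theorem isAlgebraic_adjoin_of_transcendental {x f : L}
    [FiniteDimensional (IntermediateField.adjoin K {x}) L] (hf : Transcendental K f) :
    Algebra.IsAlgebraic (Algebra.adjoin K {f}) L := by
  have h1 : Algebra.IsAlgebraic (Algebra.adjoin K {x}) L :=
    (IsFractionRing.comap_isAlgebraic_iff (K := IntermediateField.adjoin K {x})).2 inferInstance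
  have h2 : Algebra.trdeg K L ≤ Cardinal.mk ({x} : Set L) :=
    Algebra.IsAlgebraic.trdeg_le_cardinalMk K {x}
  have h3 : AlgebraicIndependent K (fun _ : Unit => f) :=
    algebraicIndependent_unique_type_iff.2 hf
  have h4 := h3.isTranscendenceBasis_of_lift_trdeg_le_of_finite (by simpa using h2)
  have h5 := h4.isAlgebraic
  rwa [Set.range_const] at h5

theorem Place.exists_root_of_aeval_mem_nonunits [IsAlgClosed K] (v : Place K L) {f : L}
    {p : K[X]} (hp : p ≠ 0) (h : aeval f p ∈ v.1.nonunits) :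
    ∃ c : K, f - algebraMap K L c ∈ v.1.nonunits := by
  have hs := (IsAlgClosed.splits p).eq_prod_roots
  rw [hs, map_mul, aeval_C] at h
  rcases v.mem_nonunits_of_mul h with h | h
  · exact absurd h (v.algebraMap_notMem_nonunits (leadingCoeff_ne_zero.2 hp))
  · revert h
    refine Multiset.induction_on p.roots ?_ fun a s ih h => ?_
    · intro h
      simp only [Multiset.map_zero, Multiset.prod_zero, map_one] at h
      exact absurd h v.one_notMem_nonunits
    · rw [Multiset.map_cons, Multiset.prod_cons, map_mul] at h
      rcases v.mem_nonunits_of_mul h with h | h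
      · exact ⟨a, by simpa using h⟩
      · exact ih h

/-- Over an algebraically closed field of constants every place is rational. -/
theorem Place.exists_sub_mem_nonunits [IsAlgClosed K] (x : L)
    [FiniteDimensional (IntermediateField.adjoin K {x}) L] (v : Place K L) {f : L}
    (hf : f ∈ v.1) : ∃ c : K, f - algebraMap K L c ∈ v.1.nonunits := by
  by_cases hfa : IsAlgebraic K f
  · obtain ⟨c, rfl⟩ := IsAlgClosed.exists_algebraMap_eq_of_isAlgebraic hfa
    exact ⟨c, by rw [sub_self]; exact zero_mem _⟩
  have := isAlgebraic_adjoin_of_transcendental (x := x) hfa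
  obtain ⟨p, hp⟩ : ∃ p : L, p ∉ v.1 := by
    by_contra! h
    exact v.2.2 (ValuationSubring.ext _ _ fun f => ⟨fun _ => trivial, fun _ => h f⟩)
  have hle : ∀ a : Algebra.adjoin K {f}, (a : L) ∈ v.1 := fun a =>
    v.mem_of_isIntegral hf (isIntegral_algebraMap (R := Algebra.adjoin K {f}) (x := a))
  let j : Algebra.adjoin K {f} →+* v.1 :=
    { toFun := fun a => ⟨a, hle a⟩
      map_one' := rfl
      map_mul' := fun _ _ => rfl
      map_zero' := rfl
      map_add' := fun _ _ => rfl }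
  let _ : Algebra (Algebra.adjoin K {f}) v.1 := j.toAlgebra
  have hpn := v.inv_mem_nonunits hp
  have hpm := v.mem_of_nonunit hpn
  have hp0 : (⟨p⁻¹, hpm⟩ : v.1) ≠ 0 := fun h => by
    have h1 : p⁻¹ = 0 := congrArg (fun z : v.1 => (z : L)) h
    rw [inv_eq_zero] at h1
    rw [h1] at hp
    exact hp v.1.zero_mem
  have halg : IsAlgebraic (Algebra.adjoin K {f}) (⟨p⁻¹, hpm⟩ : v.1) := by
    have : IsScalarTower (Algebra.adjoin K {f}) v.1 L := IsScalarTower.of_algebraMap_eq fun _ => rfl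
    refine (isAlgebraic_algebraMap_iff (A := L) (S := v.1) Subtype.val_injective).1 ?_
    exact Algebra.IsAlgebraic.isAlgebraic _
  -- `p⁻¹` divides in `O_v` a nonzero polynomial in `f`, which thus lies in the maximal ideal
  obtain ⟨r, hr, s, hs⟩ := halg.exists_nonzero_dvd (mem_nonZeroDivisors_of_ne_zero hp0)
  have hs' : (r : L) = p⁻¹ * s := congrArg (fun z : v.1 => (z : L)) hs
  have hrn : (r : L) ∈ v.1.nonunits := by
    rw [hs', mul_comm]
    exact v.mul_mem_nonunits s.2 hpn
  obtain ⟨q, hq⟩ := (Algebra.adjoin_singleton_eq_range_aeval K f).le r.2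
  have hq' : aeval f q = (r : L) := hq
  refine v.exists_root_of_aeval_mem_nonunits (p := q) (fun h => hr ?_) (by rw [hq']; exact hrn)
  rw [h, map_zero] at hq'
  exact Subtype.ext hq'.symm

end Existence

/-! ### Quotients by an involution -/

section Involution

variable {K F L : Type*} [Field K] [Field F] [Field L] [Algebra K F] [Algebra K L]

/-- The transform of a place under an isomorphism of function fields. -/
def Place.transport {M : Type*} [Field M] [Algebra K M] (τ : L ≃ₐ[K] M) (v : Place K M) :
    Place K L :=
  ⟨v.1.comap (τ : L →+* M), fun c => by
    rw [ValuationSubring.mem_comap]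
    simpa using v.algebraMap_mem c, fun h => v.2.2 <| by
    refine ValuationSubring.ext _ _ fun f => ⟨fun _ => trivial, fun _ => ?_⟩
    have : τ.symm f ∈ v.1.comap (τ : L →+* M) := by rw [h]; trivial
    rw [ValuationSubring.mem_comap] at this
    simpa using this⟩

theorem Place.mem_transport {M : Type*} [Field M] [Algebra K M] {τ : L ≃ₐ[K] M} {v : Place K M}
    {f : L} : f ∈ (v.transport τ).1 ↔ τ f ∈ v.1 := Iff.rfl

theorem Place.mem_nonunits_transport {M : Type*} [Field M] [Algebra K M] {τ : L ≃ₐ[K] M}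
    {v : Place K M} {f : L} : f ∈ (v.transport τ).1.nonunits ↔ τ f ∈ v.1.nonunits := by
  rw [ValuationSubring.mem_nonunits_iff_or, ValuationSubring.mem_nonunits_iff_or,
    Place.mem_transport, map_inv₀, EmbeddingLike.map_eq_zero_iff]

theorem Place.ord_transport {M : Type*} [Field M] [Algebra K M] [DiscretePlaces K L]
    [DiscretePlaces K M] {τ : L ≃ₐ[K] M} {v : Place K M} {f : L} (hf : f ≠ 0) :
    (v.transport τ).ord f = v.ord (τ f) := by
  obtain ⟨p, hp, hp1⟩ := v.exists_ord_eq_one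
  refine Place.ord_eq_of_normalized _ (w := fun f => v.ord (τ f)) (p := τ.symm p) ?_ ?_ ?_ ?_ hf
  · simpa using hp
  · simpa using hp1
  · intro f g hf hg
    rw [map_mul, v.ord_mul (by simpa using hf) (by simpa using hg)]
  · intro f hf
    exact v.ord_nonneg_iff (by simpa using hf)

/-- Over the constants `K` every place has residue field `K`. This holds for function fields
over an algebraically closed field, see `rationalPlaces_of_finite`. -/
class RationalPlaces (K L : Type*) [Field K] [Field L] [Algebra K L] : Prop where
  exists_sub_mem : ∀ (v : Place K L) (f : L), f ∈ v.1 →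
    ∃ c : K, f - algebraMap K L c ∈ v.1.nonunits

theorem rationalPlaces_of_finite [IsAlgClosed K] (x : L)
    [FiniteDimensional (IntermediateField.adjoin K {x}) L] : RationalPlaces K L :=
  ⟨fun v _ hf => v.exists_sub_mem_nonunits x hf⟩

/-- `φ : F → L` is the quotient of the curve with function field `L` by the nontrivial
involution `τ`. -/
structure IsInvolutionQuotient (φ : F →ₐ[K] L) (τ : L ≃ₐ[K] L) : Prop where
  quot : IsQuotient τ φ
  invol : ∀ f, τ (τ f) = f
  nontriv : ∃ f, τ f ≠ f

namespace IsInvolutionQuotient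

variable {φ : F →ₐ[K] L} {τ : L ≃ₐ[K] L} (h : IsInvolutionQuotient φ τ)

include h

theorem exists_map_eq {f : L} (hf : τ f = f) : ∃ g, φ g = f := (h.quot.2 f).2 hf

theorem apply_map (f : F) : τ (φ f) = φ f := (h.quot.2 _).1 ⟨f, rfl⟩

theorem exists_norm (f : L) : ∃ n, φ n = f * τ f :=
  h.exists_map_eq (by rw [map_mul, h.invol, mul_comm])

theorem exists_trace (f : L) : ∃ n, φ n = f + τ f :=
  h.exists_map_eq (by rw [map_add, h.invol, add_comm])

omit h in
/-- A place that contains the trace and the norm of `f` contains `f`. -/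
theorem mem_of_norm_trace {f : L} {n t : F} (hn : φ n = f * τ f) (ht : φ t = f + τ f)
    {v : Place K L} (hn' : φ n ∈ v.1) (ht' : φ t ∈ v.1) : f ∈ v.1 := by
  by_contra hf
  have h1 := v.mem_of_nonunit (v.inv_mem_nonunits hf)
  have hf0 : f ≠ 0 := by rintro rfl; exact hf v.1.zero_mem
  have h2 : f = φ t - φ n * f⁻¹ := by
    rw [ht, hn]
    field_simp
    ring
  exact hf (by rw [h2]; exact sub_mem ht' (v.1.mul_mem _ _ hn' h1))

/-- The image of a place on the quotient curve. -/
def below (v : Place K L) : Place K F :=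
  ⟨v.1.comap (φ : F →+* L), fun c => by
    rw [ValuationSubring.mem_comap]
    simpa using v.algebraMap_mem c, fun htop => v.2.2 <| by
    refine ValuationSubring.ext _ _ fun f => ⟨fun _ => trivial, fun _ => ?_⟩
    have hall : ∀ g, φ g ∈ v.1 := fun g => by
      have : g ∈ v.1.comap (φ : F →+* L) := by rw [htop]; trivial
      exact this
    obtain ⟨n, hn⟩ := h.exists_norm f
    obtain ⟨t, ht⟩ := h.exists_trace f
    exact mem_of_norm_trace hn ht (hall n) (hall t)⟩

omit h in
theorem mem_below (h : IsInvolutionQuotient φ τ) {v : Place K L} {f : F} :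
    f ∈ (h.below v).1 ↔ φ f ∈ v.1 := Iff.rfl

theorem mem_nonunits_below {v : Place K L} {f : F} :
    f ∈ (h.below v).1.nonunits ↔ φ f ∈ v.1.nonunits := by
  rw [ValuationSubring.mem_nonunits_iff_or, ValuationSubring.mem_nonunits_iff_or,
    h.mem_below, map_inv₀, map_eq_zero]

theorem transport_transport (v : Place K L) : (v.transport τ).transport τ = v := by
  refine Subtype.ext (ValuationSubring.ext _ _ fun f => ?_)
  rw [Place.mem_transport, Place.mem_transport, h.invol]

theorem below_transport (v : Place K L) : h.below (v.transport τ) = h.below v := by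
  refine Subtype.ext (ValuationSubring.ext _ _ fun f => ?_)
  rw [h.mem_below, h.mem_below, Place.mem_transport, h.apply_map]

/-- Every place of the quotient curve is the image of a place. -/
theorem exists_below_eq [DiscretePlaces K F] (u : Place K F) : ∃ v, h.below v = u := by
  obtain ⟨p, hp⟩ : ∃ p : F, p ∉ u.1 := by
    by_contra! h
    exact u.2.2 (ValuationSubring.ext _ _ fun f => ⟨fun _ => trivial, fun _ => h f⟩)
  have hp0 : p ≠ 0 := by rintro rfl; exact hp u.1.zero_mem
  have hφ : Function.Injective φ := φ.toRingHom.injective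
  -- the valuation ring `O_u` lies in the valuation ring of a place `v`, and is maximal
  obtain ⟨v, hv, -⟩ := exists_place_of_notMem_range (K := K)
    (A := u.1.toSubring.map (φ : F →+* L)) (p := φ p⁻¹)
    (fun c => ⟨algebraMap K F c, u.algebraMap_mem c, by simp⟩)
    ⟨p⁻¹, u.mem_of_nonunit (u.inv_mem_nonunits hp), rfl⟩ (by simpa using hp0) (by
      rintro ⟨q, hq, hq'⟩
      rw [map_inv₀, inv_inv] at hq'
      exact hp (hφ hq' ▸ hq))
  exact ⟨v, (Place.ext_le (v := u) (v' := h.below v) fun f hf => hv _ ⟨f, hf, rfl⟩).symm⟩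

variable [CharZero K] [DiscretePlaces K L]

omit h [DiscretePlaces K L] in
/-- A function has at most one value at each of two places, and one of the constants `0`, `1`, `2`
is neither of them. -/
theorem _root_.FunctionField.Place.exists_sub_notMem_nonunits (v v' : Place K L) (f : L) :
    ∃ c : K, f - algebraMap K L c ∉ v.1.nonunits ∧ f - algebraMap K L c ∉ v'.1.nonunits := by
  by_contra! H
  have key : ∀ c d : K, c ≠ d → f - algebraMap K L c ∉ v.1.nonunits →
      f - algebraMap K L d ∉ v.1.nonunits → False := fun c d hcd hc hd =>
    hcd (v'.eq_of_sub_mem_nonunits (H c hc) (H d hd))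
  have key' : ∀ c d : K, c ≠ d → f - algebraMap K L c ∈ v.1.nonunits →
      f - algebraMap K L d ∉ v.1.nonunits := fun c d hcd hc hd =>
    hcd (v.eq_of_sub_mem_nonunits hc hd)
  have h01 : (0 : K) ≠ 1 := zero_ne_one
  have h02 : (0 : K) ≠ 2 := two_ne_zero.symm
  have h12 : (1 : K) ≠ 2 := by norm_num
  by_cases h0 : f - algebraMap K L 0 ∈ v.1.nonunits
  · exact key 1 2 h12 (key' 0 1 h01 h0) (key' 0 2 h02 h0)
  · by_cases h1 : f - algebraMap K L 1 ∈ v.1.nonunits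
    · exact key 0 2 h02 h0 (key' 1 2 h12 h1)
    · exact key 0 1 h01 h0 h1

/-- The two places of `L` above a place of the quotient are exchanged by the involution. -/
theorem eq_or_eq_transport {v v' : Place K L} (hb : h.below v' = h.below v) :
    v' = v ∨ v' = v.transport τ := by
  by_contra! H
  -- an element of `O_w` that vanishes at `v'` but not at `w`, and has no pole at `v`, `τ v`
  have key : ∀ w : Place K L, v' ≠ w → ∃ y, y ∈ v.1 ∧ y ∈ (v.transport τ).1 ∧
      y ∈ v'.1.nonunits ∧ y ∉ w.1.nonunits := by
    intro w hw
    obtain ⟨a, haw, hav⟩ : ∃ a, a ∈ w.1 ∧ a ∉ v'.1 := by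
      by_contra! hle
      exact hw (Place.ext_le (v := w) (v' := v') hle).symm
    obtain ⟨c, hc, hc'⟩ := Place.exists_sub_notMem_nonunits v (v.transport τ) a
    have hne : a - algebraMap K L c ≠ 0 := fun h0 => hc (by rw [h0]; exact zero_mem _)
    refine ⟨(a - algebraMap K L c)⁻¹, v.inv_mem_of_notMem_nonunits hc,
      (v.transport τ).inv_mem_of_notMem_nonunits hc', v'.inv_mem_nonunits fun h' => hav ?_,
      w.notMem_nonunits_of_inv_mem (inv_ne_zero hne) ?_⟩
    · simpa using add_mem h' (v'.algebraMap_mem c)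
    · rw [inv_inv]
      exact sub_mem haw (w.algebraMap_mem c)
  obtain ⟨y, y1, y2, y3, y4⟩ := key v H.1
  obtain ⟨z, z1, z2, z3, z4⟩ := key _ H.2
  -- `g` vanishes at `v'` but neither at `v` nor at `τ v`: then the norm and the trace of `g⁻¹` are
  -- regular at `v`, hence at `v'`, which is absurd
  obtain ⟨g, g3, g4, g5⟩ : ∃ g, g ∈ v'.1.nonunits ∧ g ∉ v.1.nonunits ∧
      g ∉ (v.transport τ).1.nonunits := by
    by_cases y5 : y ∈ (v.transport τ).1.nonunits
    · by_cases z5 : z ∈ v.1.nonunits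
      · refine ⟨y + z, add_mem y3 z3, fun h' => y4 ?_, fun h' => z4 ?_⟩
        · simpa using sub_mem h' z5
        · simpa using sub_mem h' y5
      · exact ⟨z, z3, z5, z4⟩
    · exact ⟨y, y3, y4, y5⟩
  have hg0 : g ≠ 0 := by rintro rfl; exact g4 (zero_mem _)
  have i1 := v.inv_mem_of_notMem_nonunits g4
  have i2 := (v.transport τ).inv_mem_of_notMem_nonunits g5
  rw [Place.mem_transport] at i2
  obtain ⟨n, hn⟩ := h.exists_norm g⁻¹
  obtain ⟨t, ht⟩ := h.exists_trace g⁻¹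
  have hmem : ∀ q, φ q ∈ v.1 → φ q ∈ v'.1 := fun q hq => by
    rw [← h.mem_below, hb]; exact hq
  refine v'.notMem_nonunits_of_inv_mem hg0 (mem_of_norm_trace hn ht (hmem n ?_) (hmem t ?_)) g3
  · rw [hn]; exact v.1.mul_mem _ _ i1 i2
  · rw [ht]; exact v.1.add_mem _ _ i1 i2

omit [CharZero K] in
/-- If the two places above a place of the quotient are distinct, the quotient map is unramified
there: by approximation some `y` has order `1` at `v` and `0` at `τ v`, and its norm has
order `1` at `v`. -/
theorem exists_ord_map_eq_one {v : Place K L} (hv : v.transport τ ≠ v) :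
    ∃ f, f ≠ 0 ∧ v.ord (φ f) = 1 := by
  set v' := v.transport τ with hv'
  obtain ⟨a, ha, ha'⟩ : ∃ a, a ∈ v.1 ∧ a ∉ v'.1 := by
    by_contra! hle
    exact hv (Place.ext_le (v := v) (v' := v') hle).symm
  obtain ⟨b, hb, hb'⟩ : ∃ a, a ∈ v'.1 ∧ a ∉ v.1 := by
    by_contra! hle
    exact hv (Place.ext_le (v := v') (v' := v) hle)
  have ha0 : a ≠ 0 := by rintro rfl; exact ha' v'.1.zero_mem
  have hb0 : b ≠ 0 := by rintro rfl; exact hb' v.1.zero_mem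
  have o1 := (v.ord_nonneg_iff ha0).2 ha
  have o2 := (v'.ord_neg_iff ha0).2 ha'
  have o3 := (v'.ord_nonneg_iff hb0).2 hb
  have o4 := (v.ord_neg_iff hb0).2 hb'
  -- `c` has a zero at `v` and a pole at `τ v`, so that `1 / (1 + c)` is close to `1` at `v` and
  -- close to `0` at `τ v`
  set c := a * b⁻¹ with hc
  have hc0 : c ≠ 0 := mul_ne_zero ha0 (inv_ne_zero hb0)
  have c1 : 0 < v.ord c := by rw [hc, v.ord_mul ha0 (inv_ne_zero hb0), v.ord_inv]; lia
  have c2 : v'.ord c < 0 := by rw [hc, v'.ord_mul ha0 (inv_ne_zero hb0), v'.ord_inv]; lia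
  have d0 : 1 + c ≠ 0 := v.add_ne_zero_of_ord_lt one_ne_zero (Or.inr (by rw [v.ord_one]; exact c1))
  have d1 : v.ord (1 + c) = 0 := by
    rw [v.ord_add_of_lt one_ne_zero (Or.inr (by rw [v.ord_one]; exact c1)), v.ord_one]
  have d2 : v'.ord (1 + c) = v'.ord c := by
    rw [add_comm, v'.ord_add_of_lt hc0 (Or.inr (by rw [v'.ord_one]; exact c2))]
  obtain ⟨p, hp0, hp⟩ := v.exists_ord_eq_one
  set n : ℕ := (v'.ord p).natAbs + 1 with hn
  have g0 : p * (1 + c)⁻¹ ^ n ≠ 0 := mul_ne_zero hp0 (pow_ne_zero _ (inv_ne_zero d0))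
  have e0 : (c * (1 + c)⁻¹) ^ 2 ≠ 0 := pow_ne_zero _ (mul_ne_zero hc0 (inv_ne_zero d0))
  have g1 : v.ord (p * (1 + c)⁻¹ ^ n) = 1 := by
    rw [v.ord_mul hp0 (pow_ne_zero _ (inv_ne_zero d0)), v.ord_pow (inv_ne_zero d0), v.ord_inv, d1,
      hp]
    simp
  have g2 : 0 < v'.ord (p * (1 + c)⁻¹ ^ n) := by
    rw [v'.ord_mul hp0 (pow_ne_zero _ (inv_ne_zero d0)), v'.ord_pow (inv_ne_zero d0), v'.ord_inv,
      d2]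
    have : (n : ℤ) ≤ n * (- v'.ord c) := le_mul_of_one_le_right (Int.natCast_nonneg _) (by lia)
    lia
  have e1 : 1 < v.ord ((c * (1 + c)⁻¹) ^ 2) := by
    rw [v.ord_pow (mul_ne_zero hc0 (inv_ne_zero d0)), v.ord_mul hc0 (inv_ne_zero d0), v.ord_inv,
      d1]
    push_cast
    lia
  have e2 : v'.ord ((c * (1 + c)⁻¹) ^ 2) = 0 := by
    rw [v'.ord_pow (mul_ne_zero hc0 (inv_ne_zero d0)), v'.ord_mul hc0 (inv_ne_zero d0), v'.ord_inv,
      d2]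
    ring
  set y := p * (1 + c)⁻¹ ^ n + (c * (1 + c)⁻¹) ^ 2 with hy
  have hy0 : y ≠ 0 := v.add_ne_zero_of_ord_lt g0 (Or.inr (by lia))
  have y1 : v.ord y = 1 := by rw [hy, v.ord_add_of_lt g0 (Or.inr (by lia)), g1]
  have y2 : v'.ord y = 0 := by rw [hy, add_comm, v'.ord_add_of_lt e0 (Or.inr (by lia)), e2]
  obtain ⟨f, hf⟩ := h.exists_norm y
  rw [hv', Place.ord_transport hy0] at y2
  have hτy : τ y ≠ 0 := by simpa using hy0
  refine ⟨f, fun h0 => mul_ne_zero hy0 hτy (by rw [← hf, h0, map_zero]), ?_⟩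
  rw [hf, v.ord_mul hy0 hτy, y1, y2, add_zero]

omit [CharZero K] in
/-- At a fixed point of the involution the quotient map is ramified: if some function of the
quotient had order `1` there, the involution would be trivial on the completion. -/
theorem ord_map_ne_one [RationalPlaces K L] {v : Place K L} (hv : v.transport τ = v) {f : F}
    (hf : f ≠ 0) : v.ord (φ f) ≠ 1 := by
  intro h1
  have hφf : φ f ≠ 0 := by simpa using hf
  have hmem : ∀ g, g ∈ v.1 → τ g ∈ v.1 := fun g hg => by
    rw [← hv] at hg; exact hg
  -- expansion in powers of the local parameter `φ f`, with constant coefficients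
  have key : ∀ (n : ℕ) (g : L), g ∈ v.1 → ∃ (p : F) (r : L), r ∈ v.1 ∧ g = φ p + r * φ f ^ n := by
    intro n g hg
    induction n with
    | zero => exact ⟨0, g, hg, by simp⟩
    | succ n ih =>
      obtain ⟨p, r, hr, rfl⟩ := ih
      obtain ⟨c, hc⟩ := RationalPlaces.exists_sub_mem v r hr
      refine ⟨p + algebraMap K F c * f ^ n, (r - algebraMap K L c) / φ f, ?_, ?_⟩
      · by_cases h0 : r - algebraMap K L c = 0
        · rw [h0, zero_div]; exact v.1.zero_mem
        · rw [← v.le_ord_div_iff h0 hφf, h1]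
          exact (v.ord_pos_iff h0).2 hc
      · rw [map_add, map_mul, map_pow, AlgHom.commutes]
        field_simp
        ring
  -- `τ g - g` is divisible by all powers of `φ f`
  have fixed : ∀ g ∈ v.1, τ g = g := by
    intro g hg
    by_contra hne
    have hne' : τ g - g ≠ 0 := sub_ne_zero.2 hne
    set N := (v.ord (τ g - g)).natAbs + 1 with hN
    obtain ⟨p, r, hr, hgr⟩ := key N g hg
    have h2 : τ g - g = (τ r - r) * φ f ^ N := by
      rw [hgr, map_add, map_mul, map_pow, h.apply_map, h.apply_map]
      ring
    have h3 : (τ g - g) / φ f ^ N ∈ v.1 := by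
      rw [h2, mul_div_cancel_right₀ _ (pow_ne_zero _ hφf)]
      exact sub_mem (hmem r hr) hr
    rw [← v.le_ord_div_iff hne' (pow_ne_zero _ hφf), v.ord_pow hφf, h1] at h3
    lia
  obtain ⟨g, hg⟩ := h.nontriv
  rcases v.mem_or_inv_mem g with h2 | h2
  · exact hg (fixed g h2)
  · have := fixed _ h2
    rw [map_inv₀, inv_inj] at this
    exact hg this

omit [CharZero K] in
/-- The norm of a local parameter at a fixed point of the involution has order two. -/
theorem exists_ord_map_eq_two {v : Place K L} (hv : v.transport τ = v) :
    ∃ f, f ≠ 0 ∧ v.ord (φ f) = 2 := by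
  obtain ⟨p, hp, hp1⟩ := v.exists_ord_eq_one
  obtain ⟨f, hf⟩ := h.exists_norm p
  have hτ : τ p ≠ 0 := by simpa using hp
  refine ⟨f, fun h0 => mul_ne_zero hp hτ (by rw [← hf, h0, map_zero]), ?_⟩
  have h1 : v.ord (τ p) = 1 := by rw [← Place.ord_transport hp, hv, hp1]
  rw [hf, v.ord_mul hp hτ, h1, hp1]
  rfl

omit [CharZero K] in
theorem even_ord_map [RationalPlaces K L] {v : Place K L} (hv : v.transport τ = v) {f : F}
    (hf : f ≠ 0) : Even (v.ord (φ f)) := by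
  rw [← Int.not_odd_iff_even]
  rintro ⟨k, hk⟩
  obtain ⟨g, hg, hg2⟩ := h.exists_ord_map_eq_two hv
  have hφg : φ g ≠ 0 := by simpa using hg
  have hφf : φ f ≠ 0 := by simpa using hf
  refine h.ord_map_ne_one hv (f := f * g ^ (-k)) (mul_ne_zero hf (zpow_ne_zero _ hg)) ?_
  rw [map_mul, map_zpow₀, v.ord_mul hφf (zpow_ne_zero _ hφg), v.ord_zpow hφg, hk, hg2]
  ring

omit [CharZero K] in
theorem ramificationIndex_of_ne {v : Place K L} (hv : v.transport τ ≠ v) :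
    ramificationIndex φ v = 1 := by
  obtain ⟨f, -, hf⟩ := h.exists_ord_map_eq_one hv
  refine le_antisymm (Nat.sInf_le ⟨one_pos, f, by simpa using hf⟩) ?_
  exact le_csInf ⟨1, one_pos, f, by simpa using hf⟩ fun n hn => hn.1

omit [CharZero K] in
theorem ramificationIndex_of_eq [RationalPlaces K L] {v : Place K L} (hv : v.transport τ = v) :
    ramificationIndex φ v = 2 := by
  obtain ⟨f, -, hf⟩ := h.exists_ord_map_eq_two hv
  refine le_antisymm (Nat.sInf_le ⟨two_pos, f, by simpa using hf⟩) ?_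
  refine le_csInf ⟨2, two_pos, f, by simpa using hf⟩ fun n hn => ?_
  obtain ⟨hn0, g, hg⟩ := hn
  have hg0 : g ≠ 0 := by
    rintro rfl
    have := v.ord_inv 0
    rw [inv_zero] at this
    rw [map_zero] at hg
    lia
  obtain ⟨k, hk⟩ := h.even_ord_map hv hg0
  lia

omit [CharZero K] in
theorem ramificationIndex_eq [RationalPlaces K L] (v : Place K L) :
    ramificationIndex φ v = 1 ∨ ramificationIndex φ v = 2 := by
  by_cases hv : v.transport τ = v
  · exact Or.inr (h.ramificationIndex_of_eq hv)
  · exact Or.inl (h.ramificationIndex_of_ne hv)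

omit [CharZero K] in
/-- Orders of functions on the quotient and of their pull-backs differ by the ramification index. -/
theorem ord_map [RationalPlaces K L] [DiscretePlaces K F] (v : Place K L) {f : F} (hf : f ≠ 0) :
    v.ord (φ f) = ramificationIndex φ v * (h.below v).ord f := by
  obtain ⟨p, hp, hpe, hdvd⟩ : ∃ p, p ≠ 0 ∧ v.ord (φ p) = ramificationIndex φ v ∧
      ∀ f, f ≠ 0 → (ramificationIndex φ v : ℤ) ∣ v.ord (φ f) := by
    by_cases hv : v.transport τ = v
    · obtain ⟨p, hp, hp2⟩ := h.exists_ord_map_eq_two hv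
      rw [h.ramificationIndex_of_eq hv]
      exact ⟨p, hp, hp2, fun f hf => (h.even_ord_map hv hf).two_dvd⟩
    · obtain ⟨p, hp, hp2⟩ := h.exists_ord_map_eq_one hv
      rw [h.ramificationIndex_of_ne hv]
      exact ⟨p, hp, hp2, fun f hf => one_dvd _⟩
  have he : (0 : ℤ) < ramificationIndex φ v := by
    rcases h.ramificationIndex_eq v with h1 | h1 <;> rw [h1] <;> norm_num
  have hne : ∀ f, f ≠ 0 → φ f ≠ 0 := fun f hf => by simpa using hf
  have := (h.below v).ord_eq_of_normalized (w := fun f => v.ord (φ f) / ramificationIndex φ v)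
    (p := p) hp (by rw [hpe, Int.ediv_self he.ne']) (fun f g hf hg => by
      rw [map_mul, v.ord_mul (hne f hf) (hne g hg), Int.add_ediv_of_dvd_left (hdvd f hf)])
    (fun f hf => by
      rw [Int.ediv_nonneg_iff_of_pos he, v.ord_nonneg_iff (hne f hf), h.mem_below]) hf
  rw [this, Int.mul_ediv_cancel' (hdvd f hf)]

omit [CharZero K] in
theorem ramificationIndex_transport [RationalPlaces K L] (v : Place K L) :
    ramificationIndex φ (v.transport τ) = ramificationIndex φ v := by
  by_cases hv : v.transport τ = v
  · rw [hv]
  · rw [h.ramificationIndex_of_ne hv, h.ramificationIndex_of_ne]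
    rw [h.transport_transport]
    exact Ne.symm hv

/-- The coefficients of the pull-back of a divisor under the quotient by an involution. -/
theorem pullback_apply [DiscretePlaces K F] (D : Divisor K F) (v : Place K L) :
    pullback φ D v = D (h.below v) * ramificationIndex φ v := by
  classical
  have key : (Finsupp.applyAddHom v).comp (pullback φ) =
      (AddMonoidHom.mulRight (ramificationIndex φ v : ℤ)).comp
        (Finsupp.applyAddHom (h.below v)) := by
    refine Finsupp.addHom_ext fun u n => ?_
    have hfin : Finite {w : Place K L // w.1.comap (φ : F →+* L) = u.1} := by
      obtain ⟨v, rfl⟩ := h.exists_below_eq u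
      refine Set.Finite.subset (Set.toFinite {v, v.transport τ}) fun w hw => ?_
      exact h.eq_or_eq_transport (Subtype.ext hw)
    have := Fintype.ofFinite {w : Place K L // w.1.comap (φ : F →+* L) = u.1}
    simp only [AddMonoidHom.comp_apply, pullback, Finsupp.liftAddHom_apply_single,
      zmultiplesHom_apply, Finsupp.applyAddHom_apply, Finsupp.smul_apply,
      AddMonoidHom.mulRight_apply]
    rw [finsum_eq_sum_of_fintype, Finsupp.finsetSum_apply]
    simp only [Finsupp.single_apply]
    by_cases hv : h.below v = u
    · have hv' : v.1.comap (φ : F →+* L) = u.1 := congrArg Subtype.val hv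
      rw [Finset.sum_eq_single_of_mem
        (⟨v, hv'⟩ : {w : Place K L // w.1.comap (φ : F →+* L) = u.1}) (Finset.mem_univ _)]
      · rw [if_pos rfl, if_pos hv.symm, smul_eq_mul]
      · intro w _ hw
        rw [if_neg]
        intro hwv
        exact hw (Subtype.ext hwv)
    · rw [if_neg (Ne.symm hv), Finset.sum_eq_zero, smul_zero, zero_mul]
      intro w _
      rw [if_neg]
      rintro rfl
      exact hv (Subtype.ext w.2)
  exact DFunLike.congr_fun key D

/-- The pull-back of the point below `v` is `v + τ v`. -/
theorem pullback_single_below [DiscretePlaces K F] [RationalPlaces K L] (v : Place K L) :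
    pullback φ (Finsupp.single (h.below v) 1) =
      Finsupp.single v 1 + Finsupp.single (v.transport τ) 1 := by
  classical
  ext w
  rw [h.pullback_apply, Finsupp.add_apply]
  simp only [Finsupp.single_apply]
  by_cases hw : h.below w = h.below v
  · rw [if_pos hw.symm, one_mul]
    by_cases hv : v.transport τ = v
    · have hwv : w = v := by
        rcases h.eq_or_eq_transport hw with h1 | h1
        · exact h1
        · rw [h1, hv]
      rw [hwv, hv, if_pos rfl, h.ramificationIndex_of_eq hv]
      rfl
    · rcases h.eq_or_eq_transport hw with h1 | h1
      · rw [h1, if_pos rfl, if_neg hv, h.ramificationIndex_of_ne hv]; rfl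
      · rw [h1, if_pos rfl, if_neg (Ne.symm hv), h.ramificationIndex_transport,
          h.ramificationIndex_of_ne hv]; rfl
  · rw [if_neg (Ne.symm hw), if_neg, if_neg, zero_mul, add_zero]
    · rintro rfl; exact hw (h.below_transport v)
    · rintro rfl; exact hw rfl

end IsInvolutionQuotient

end Involution

end FunctionField

/-! ### Lifting maps out of function fields -/

section Lift

/-- `B[X] / (f)` is integral over `B`, so a nonzero ideal of it, such as the kernel of a map
that is not injective, meets `B` nontrivially. -/
theorem AdjoinRoot.lift_injective {B M : Type*} [CommRing B] [IsDomain B] [CommRing M]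
    [IsDomain M] {f : B[X]} (hf : f.Monic)
    [IsDomain (AdjoinRoot f)] (i : AdjoinRoot f →+* M)
    (hi : Function.Injective (i.comp (AdjoinRoot.of f))) : Function.Injective i := by
  have : Module.Finite B (AdjoinRoot f) := hf.finite_adjoinRoot
  rw [RingHom.injective_iff_ker_eq_bot]
  refine Ideal.eq_bot_of_comap_eq_bot (R := B) ?_
  rw [AdjoinRoot.algebraMap_eq, RingHom.comap_ker]
  exact (RingHom.injective_iff_ker_eq_bot _).1 hi

namespace QuadField

variable {K : Type*} [Field K] {g : K[X]} {M : Type*} [Field M] [Algebra K M]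

theorem monic_sq_sub_C (g : K[X]) : (X ^ 2 - C g : K[X][X]).Monic :=
  monic_X_pow_sub_C _ two_ne_zero

/-- For a monic polynomial of degree two irreducibility is the absence of roots. -/
theorem isDomain_of_not_isSquare (hg : ¬ IsSquare g) : IsDomain (QuadRing g) := by
  apply AdjoinRoot.isDomain_of_prime
  apply Irreducible.prime
  have hd : (X ^ 2 - C g : K[X][X]).natDegree = 2 := natDegree_X_pow_sub_C
  rw [(monic_sq_sub_C g).irreducible_iff_roots_eq_zero_of_degree_le_three hd.ge
    (by rw [hd]; norm_num), Multiset.eq_zero_iff_forall_notMem]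
  intro p hp
  rw [mem_roots (monic_sq_sub_C g).ne_zero, IsRoot.def] at hp
  simp only [eval_sub, eval_pow, eval_X, eval_C, sub_eq_zero] at hp
  exact hg ⟨p, by rw [← hp, sq]⟩

theorem exists_ring_eq (r : QuadRing g) : ∃ p q : K[X],
    r = AdjoinRoot.of _ p + AdjoinRoot.of _ q * AdjoinRoot.root _ := by
  obtain ⟨f, rfl⟩ := AdjoinRoot.mk_surjective r
  have h := modByMonic_add_div f (X ^ 2 - C g)
  have hd : (f %ₘ (X ^ 2 - C g)).degree < 2 := by
    refine (degree_modByMonic_lt _ (monic_sq_sub_C g)).trans_eq ?_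
    exact degree_X_pow_sub_C two_pos _
  have h2 : (f %ₘ (X ^ 2 - C g)).natDegree ≤ 1 := by
    rw [natDegree_le_iff_degree_le]
    exact Order.le_of_lt_succ hd
  obtain ⟨a, b, hab⟩ := exists_eq_X_add_C_of_natDegree_le_one h2
  refine ⟨b, a, ?_⟩
  rw [← h, map_add, map_mul, AdjoinRoot.mk_self, zero_mul, add_zero, hab, map_add, map_mul,
    AdjoinRoot.mk_C, AdjoinRoot.mk_C, AdjoinRoot.mk_X, add_comm]

/-- The map to a field `M` given by a transcendental element `x` and a square root `y`
of `g(x)`. -/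
def ringLift (x y : M) (hy : y ^ 2 = aeval x g) : QuadRing g →ₐ[K] M :=
  AdjoinRoot.liftAlgHom _ (aeval x) y (by simp [hy])

theorem ringLift_injective [IsDomain (QuadRing g)] {x y : M} (hy : y ^ 2 = aeval x g)
    (hx : Transcendental K x) : Function.Injective (ringLift x y hy) := by
  refine AdjoinRoot.lift_injective (monic_sq_sub_C g) (ringLift x y hy).toRingHom ?_
  have : (ringLift x y hy).toRingHom.comp (AdjoinRoot.of _) =
      (aeval x : K[X] →ₐ[K] M).toRingHom := by
    ext p
    · simp [ringLift]
    · simp [ringLift]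
  rw [this]
  exact transcendental_iff_injective.1 hx

variable [IsDomain (QuadRing g)]

/-- The map of function fields given by a transcendental element `x` and a square root `y`
of `g(x)`. -/
def lift (x y : M) (hy : y ^ 2 = aeval x g) (hx : Transcendental K x) : QuadField g →ₐ[K] M :=
  IsFractionRing.liftAlgHom (ringLift_injective hy hx)

theorem lift_algebraMap {x y : M} (hy : y ^ 2 = aeval x g) (hx : Transcendental K x)
    (r : QuadRing g) : lift x y hy hx (algebraMap _ _ r) = ringLift x y hy r :=
  IsFractionRing.lift_algebraMap (ringLift_injective hy hx) r

@[simp] theorem lift_x {x y : M} (hy : y ^ 2 = aeval x g) (hx : Transcendental K x) :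
    lift x y hy hx (QuadField.x g) = x := by
  rw [QuadField.x, lift_algebraMap]; simp [ringLift]

@[simp] theorem lift_y {x y : M} (hy : y ^ 2 = aeval x g) (hx : Transcendental K x) :
    lift x y hy hx (QuadField.y g) = y := by
  rw [QuadField.y, lift_algebraMap]; simp [ringLift]

end QuadField

end Lift

namespace FunctionField

/-! ### Quadratic function fields -/

section Quadratic

variable {K L : Type*} [Field K] [Field L] [Algebra K L]

/-- `L` is the function field of the affine curve `y² = g(x)` with coordinate functions `x`, `y`:
it is generated over `K` by `x`, `y`, where `x` is transcendental, `y² = g(x)` and `y ∉ K(x)`. -/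
structure IsQuadratic (g : K[X]) (x y : L) : Prop where
  transc : Transcendental K x
  sq : y ^ 2 = aeval x g
  gen : ∀ S : IntermediateField K L, x ∈ S → y ∈ S → S = ⊤
  indep : ∀ p q : K[X], aeval x p = aeval x q * y → q = 0

theorem _root_.IntermediateField.mem_of_algebraMap_fractionRing {R : Type*} [CommRing R]
    [Algebra K R] [IsDomain R] (S : IntermediateField K (FractionRing R))
    (h : ∀ r : R, algebraMap R _ r ∈ S) : S = ⊤ := by
  rw [eq_top_iff]
  intro f _
  obtain ⟨a, b, -, rfl⟩ := IsFractionRing.div_surjective (A := R) f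
  exact S.div_mem (h a) (h b)

theorem _root_.IntermediateField.aeval_mem (S : IntermediateField K L) {x : L} (hx : x ∈ S)
    (p : K[X]) : aeval x p ∈ S := by
  change aeval (S.val ⟨x, hx⟩) p ∈ S
  rw [aeval_algHom_apply]
  exact Subtype.prop _

/-- The standard model of the function field of `y² = g(x)`. -/
theorem isQuadratic_quadField {g : K[X]} [IsDomain (QuadRing g)] :
    IsQuadratic g (QuadField.x g) (QuadField.y g) := by
  have hof : ∀ p : K[X], aeval (QuadField.x g) p =
      algebraMap (QuadRing g) (QuadField g) (AdjoinRoot.of _ p) := by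
    intro p
    induction p using Polynomial.induction_on' with
    | add p q hp hq => simp only [map_add, hp, hq]
    | monomial n c =>
      rw [aeval_monomial, ← C_mul_X_pow_eq_monomial, map_mul, map_pow, map_mul, map_pow]
      rfl
  have hinj : Function.Injective (algebraMap (QuadRing g) (QuadField g)) :=
    IsFractionRing.injective _ _
  have key : ∀ p q : K[X], aeval (QuadField.x g) p = aeval (QuadField.x g) q * QuadField.y g →
      p = 0 ∧ q = 0 := by
    intro p q h
    rw [hof, hof, QuadField.y, ← map_mul] at h
    have h1 := hinj h
    have h2 : AdjoinRoot.mk (X ^ 2 - C g : K[X][X]) (C p - C q * X) = 0 := by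
      rw [map_sub, map_mul, AdjoinRoot.mk_C, AdjoinRoot.mk_C, AdjoinRoot.mk_X, h1, sub_self]
    rw [AdjoinRoot.mk_eq_zero] at h2
    have h3 : (C p - C q * X : K[X][X]) = 0 := by
      refine eq_zero_of_dvd_of_degree_lt h2 ?_
      rw [degree_X_pow_sub_C two_pos]
      refine (degree_sub_le _ _).trans_lt ?_
      rw [max_lt_iff]
      refine ⟨degree_C_le.trans_lt (by norm_num), ?_⟩
      refine (degree_C_mul_X_le q).trans_lt ?_
      norm_num
    have h4 := congrArg (fun r => coeff r 0) h3
    have h5 := congrArg (fun r => coeff r 1) h3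
    simp [coeff_C] at h4 h5
    exact ⟨h4, h5⟩
  refine ⟨?_, ?_, ?_, fun p q h => (key p q h).2⟩
  · rw [transcendental_iff]
    intro p hp
    exact (key p 0 (by rw [hp, map_zero, zero_mul])).1
  · rw [hof, QuadField.y, ← map_pow]
    congr 1
    have := AdjoinRoot.mk_self (f := (X ^ 2 - C g : K[X][X]))
    rw [map_sub, map_pow, AdjoinRoot.mk_X, AdjoinRoot.mk_C, sub_eq_zero] at this
    exact this
  · intro S hx hy
    refine IntermediateField.mem_of_algebraMap_fractionRing S fun r => ?_
    obtain ⟨p, q, rfl⟩ := QuadField.exists_ring_eq r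
    rw [map_add, map_mul, ← hof, ← hof]
    exact add_mem (S.aeval_mem hx p) (mul_mem (S.aeval_mem hx q) hy)

/-- Two homomorphisms that agree on generators are equal. -/
theorem algHom_eq_of_gen {M : Type*} [Field M] [Algebra K M] {s : Set L}
    (gen : ∀ S : IntermediateField K L, s ⊆ S → S = ⊤) {φ ψ : L →ₐ[K] M}
    (h : ∀ f ∈ s, φ f = ψ f) : φ = ψ := by
  let S : IntermediateField K L :=
    { AlgHom.equalizer φ ψ with
      inv_mem' := fun f hf => by
        change φ f⁻¹ = ψ f⁻¹
        rw [map_inv₀, map_inv₀]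
        exact congrArg _ hf }
  have hS := gen S h
  ext f
  have : f ∈ S := by rw [hS]; trivial
  exact this

theorem _root_.AlgHom.surjective_of_gen {M : Type*} [Field M] [Algebra K M] {s : Set L}
    (gen : ∀ S : IntermediateField K L, s ⊆ S → S = ⊤) {φ : M →ₐ[K] L}
    (h : ∀ f ∈ s, ∃ m, φ m = f) : Function.Surjective φ := by
  have := gen φ.fieldRange h
  rwa [AlgHom.fieldRange_eq_top] at this

namespace IsQuadratic

variable {g : K[X]} {x y : L} (h : IsQuadratic g x y)

include h

theorem gen_set (S : IntermediateField K L) (hS : ({x, y} : Set L) ⊆ S) : S = ⊤ :=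
  h.gen S (hS (by simp)) (hS (by simp))

theorem y_ne_zero : y ≠ 0 := by
  rintro rfl
  exact one_ne_zero (h.indep 0 1 (by simp))

theorem x_ne_zero : x ≠ 0 := by
  rintro rfl
  exact h.transc isAlgebraic_zero

theorem aeval_ne_zero {p : K[X]} (hp : p ≠ 0) : aeval x p ≠ 0 := fun h0 =>
  hp ((transcendental_iff.1 h.transc) p h0)

theorem not_isSquare : ¬ IsSquare g := by
  rintro ⟨p, hp⟩
  have h1 : (y - aeval x p) * (y + aeval x p) = 0 := by
    have := h.sq
    rw [hp, map_mul] at this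
    linear_combination this
  rcases mul_eq_zero.1 h1 with h2 | h2
  · exact one_ne_zero (h.indep p 1 (by rw [map_one]; linear_combination -h2))
  · exact one_ne_zero (h.indep (-p) 1 (by rw [map_one, map_neg]; linear_combination -h2))

theorem indep_fst {p q : K[X]} (hpq : aeval x p = aeval x q * y) : p = 0 := by
  have := h.indep p q hpq
  rw [this, map_zero, zero_mul] at hpq
  exact (transcendental_iff.1 h.transc) p hpq

theorem neg : IsQuadratic g x (-y) := by
  refine ⟨h.transc, by rw [neg_sq, h.sq], fun S hx hy => h.gen S hx (by simpa using hy),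
    fun p q hpq => ?_⟩
  have := h.indep p (-q) (by rw [hpq, map_neg]; ring)
  simpa using this

/-- The identification of `L` with the standard model of the function field. -/
def equiv [IsDomain (QuadRing g)] : QuadField g ≃ₐ[K] L :=
  AlgEquiv.ofBijective (QuadField.lift x y h.sq h.transc)
    ⟨(QuadField.lift x y h.sq h.transc).toRingHom.injective,
      AlgHom.surjective_of_gen h.gen_set (by
        rintro f (rfl | rfl)
        · exact ⟨_, QuadField.lift_x h.sq h.transc⟩
        · exact ⟨_, QuadField.lift_y h.sq h.transc⟩)⟩

/-- The hyperelliptic involution. -/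
theorem exists_involution : ∃ ι : L ≃ₐ[K] L, ι x = x ∧ ι y = -y := by
  have := QuadField.isDomain_of_not_isSquare h.not_isSquare
  have hx : h.equiv (QuadField.x g) = x := QuadField.lift_x h.sq h.transc
  have hy : h.equiv (QuadField.y g) = y := QuadField.lift_y h.sq h.transc
  have hx' : h.neg.equiv (QuadField.x g) = x := QuadField.lift_x h.neg.sq h.neg.transc
  have hy' : h.neg.equiv (QuadField.y g) = -y := QuadField.lift_y h.neg.sq h.neg.transc
  refine ⟨h.equiv.symm.trans h.neg.equiv, ?_, ?_⟩
  · rw [AlgEquiv.trans_apply, (AlgEquiv.symm_apply_eq _).2 hx.symm, hx']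
  · rw [AlgEquiv.trans_apply, (AlgEquiv.symm_apply_eq _).2 hy.symm, hy']

theorem finiteDimensional : FiniteDimensional (IntermediateField.adjoin K {x}) L := by
  set F := IntermediateField.adjoin K {x}
  have hxF : x ∈ F := IntermediateField.mem_adjoin_simple_self K x
  have hint : IsIntegral F y := by
    refine ⟨X ^ 2 - C ⟨aeval x g, F.aeval_mem hxF g⟩, monic_X_pow_sub_C _ two_ne_zero, ?_⟩
    simp only [eval₂_sub, eval₂_pow, eval₂_X, eval₂_C, h.sq]
    exact sub_self _
  have hfin := IntermediateField.adjoin.finiteDimensional hint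
  have htop : IntermediateField.adjoin F {y} = ⊤ := by
    have h1 := h.gen ((IntermediateField.adjoin F {y}).restrictScalars K)
      ((IntermediateField.adjoin F {y}).algebraMap_mem ⟨x, hxF⟩)
      (IntermediateField.mem_adjoin_simple_self F y)
    rw [eq_top_iff]
    intro f _
    have : f ∈ (IntermediateField.adjoin F {y}).restrictScalars K := by rw [h1]; trivial
    exact this
  rw [htop] at hfin
  exact LinearEquiv.finiteDimensional (IntermediateField.topEquiv (F := F) (E := L)).toLinearEquiv

/-- The functions `(p(x) + q(x) y) / d(x)` form a field. -/
theorem exists_mul_eq (f : L) : ∃ p q d : K[X], d ≠ 0 ∧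
    f * aeval x d = aeval x p + aeval x q * y := by
  let S : IntermediateField K L :=
    { carrier := {f | ∃ p q d : K[X], d ≠ 0 ∧ f * aeval x d = aeval x p + aeval x q * y}
      mul_mem' := by
        rintro a b ⟨p, q, d, hd, h1⟩ ⟨p', q', d', hd', h2⟩
        refine ⟨p * p' + q * q' * g, p * q' + q * p', d * d', mul_ne_zero hd hd', ?_⟩
        simp only [map_add, map_mul, ← h.sq]
        linear_combination b * aeval x d' * h1 + (aeval x p + aeval x q * y) * h2
      add_mem' := by
        rintro a b ⟨p, q, d, hd, h1⟩ ⟨p', q', d', hd', h2⟩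
        refine ⟨p * d' + p' * d, q * d' + q' * d, d * d', mul_ne_zero hd hd', ?_⟩
        simp only [map_add, map_mul]
        linear_combination aeval x d' * h1 + aeval x d * h2
      algebraMap_mem' := fun c => ⟨C c, 0, 1, one_ne_zero, by simp⟩
      inv_mem' := by
        rintro a ⟨p, q, d, hd, h1⟩
        by_cases ha : a = 0
        · exact ⟨0, 0, 1, one_ne_zero, by simp [ha]⟩
        have hd' := h.aeval_ne_zero hd
        have hne : p * p - q * q * g ≠ 0 := by
          intro h0
          have h3 : (aeval x p + aeval x q * y) * (aeval x p - aeval x q * y) = 0 := by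
            have := congrArg (aeval x) h0
            simp only [map_sub, map_mul, map_zero, ← h.sq] at this
            linear_combination this
          rcases mul_eq_zero.1 h3 with h4 | h4
          · rw [h4] at h1
            exact mul_ne_zero ha hd' h1
          · have h5 := h.indep p q (sub_eq_zero.1 h4)
            have h6 := h.indep_fst (sub_eq_zero.1 h4)
            rw [h5, h6] at h1
            simp only [map_zero, zero_mul, add_zero] at h1
            exact mul_ne_zero ha hd' h1
        refine ⟨d * p, -(d * q), p * p - q * q * g, hne, ?_⟩
        simp only [map_sub, map_mul, map_neg, ← h.sq]
        field_simp
        linear_combination -(aeval x p - aeval x q * y) * h1 }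
  have hS : S = ⊤ := h.gen S ⟨X, 0, 1, one_ne_zero, by simp⟩ ⟨0, 1, 1, one_ne_zero, by simp⟩
  have : f ∈ S := by rw [hS]; trivial
  exact this

variable [CharZero K]

theorem discretePlaces : DiscretePlaces K L :=
  have := h.finiteDimensional
  discretePlaces_of_finite h.transc

omit [CharZero K] in
theorem rationalPlaces [IsAlgClosed K] : RationalPlaces K L :=
  have := h.finiteDimensional
  rationalPlaces_of_finite x

/-- The projection of the curve `y² = g(x)` to the `x`-line is the quotient by the hyperelliptic
involution. -/
theorem isInvolutionQuotient {ι : L ≃ₐ[K] L} (hιx : ι x = x) (hιy : ι y = -y)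
    {φ : FractionRing K[X] →ₐ[K] L} (hφ : φ (algebraMap K[X] _ X) = x) :
    IsInvolutionQuotient φ ι := by
  have : CharZero L := charZero_of_injective_algebraMap (algebraMap K L).injective
  have hφp : ∀ p : K[X], φ (algebraMap K[X] _ p) = aeval x p := by
    intro p
    induction p using Polynomial.induction_on' with
    | add p q hp hq => simp only [map_add, hp, hq]
    | monomial n c =>
      rw [aeval_monomial, ← C_mul_X_pow_eq_monomial, map_mul, map_pow, map_mul, map_pow, hφ]
      congr 1
      exact φ.commutes c
  have hιp : ∀ p : K[X], ι (aeval x p) = aeval x p := by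
    intro p
    rw [← hιx]
    simp only [hιx]
    have := aeval_algHom_apply (ι : L →ₐ[K] L) x p
    rw [AlgEquiv.coe_toAlgHom, hιx] at this
    exact this.symm
  refine ⟨⟨φ.toRingHom.injective, fun f => ⟨?_, fun hf => ?_⟩⟩, fun f => ?_, y, ?_⟩
  · rintro ⟨r, rfl⟩
    obtain ⟨a, b, -, rfl⟩ := IsFractionRing.div_surjective (A := K[X]) r
    change ι (φ _) = φ _
    rw [map_div₀, map_div₀, hφp, hφp, hιp, hιp]
  · obtain ⟨p, q, d, hd, h1⟩ := h.exists_mul_eq f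
    have h2 := congrArg ι h1
    rw [map_mul, hf, hιp, map_add, map_mul, hιp, hιp, hιy, h1] at h2
    have h3 : aeval x q * y = 0 := by
      have h4 : 2 * (aeval x q * y) = 0 := by linear_combination h2
      simpa using h4
    rw [h3, add_zero] at h1
    refine ⟨algebraMap K[X] _ p / algebraMap K[X] _ d, ?_⟩
    change φ _ = f
    rw [map_div₀, hφp, hφp, ← h1, mul_div_cancel_right₀ _ (h.aeval_ne_zero hd)]
  · have : (ι : L →ₐ[K] L).comp ι = AlgHom.id K L := by
      refine algHom_eq_of_gen h.gen_set ?_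
      rintro f (rfl | rfl)
      · simp [hιx]
      · simp [hιy]
    exact DFunLike.congr_fun this f
  · rw [hιy]
    intro h1
    have h4 : 2 * y = 0 := by linear_combination -h1
    have : y = 0 := by simpa using h4
    exact h.y_ne_zero this

omit [CharZero K] in
theorem exists_fractionRing_map : ∃ φ : FractionRing K[X] →ₐ[K] L,
    φ (algebraMap K[X] _ X) = x := by
  refine ⟨IsFractionRing.liftAlgHom (transcendental_iff_injective.1 h.transc), ?_⟩
  rw [IsFractionRing.liftAlgHom_apply, IsFractionRing.lift_algebraMap]
  exact aeval_X x

end IsQuadratic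

end Quadratic

/-! ### Integral functions and orders of polynomials -/

section Integral

variable {K L : Type*} [Field K] [Field L] [Algebra K L]

theorem Place.aeval_mem (v : Place K L) {x : L} (hx : x ∈ v.1) (p : K[X]) : aeval x p ∈ v.1 :=
  v.mem_of_isIntegral hx <| by
    have : aeval x p ∈ Algebra.adjoin K {x} := aeval_mem_adjoin_singleton K x
    exact isIntegral_algebraMap (R := Algebra.adjoin K {x}) (x := ⟨_, this⟩)

/-- At a pole of `x`, the order of a polynomial in `x` is governed by its leading term. -/
theorem Place.ord_aeval_of_notMem [DiscretePlaces K L] (v : Place K L) {x : L} (hx : x ∉ v.1)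
    {p : K[X]} (hp : p ≠ 0) : aeval x p ≠ 0 ∧ v.ord (aeval x p) = p.natDegree * v.ord x := by
  have hx0 : x ≠ 0 := by rintro rfl; exact hx v.1.zero_mem
  have hneg := (v.ord_neg_iff hx0).2 hx
  induction hn : p.natDegree using Nat.strong_induction_on generalizing p with
  | _ n ih =>
    have hlc : aeval x (C p.leadingCoeff * X ^ p.natDegree) ≠ 0 := by
      rw [map_mul, aeval_C, map_pow, aeval_X]
      exact mul_ne_zero (by simpa using hp) (pow_ne_zero _ hx0)
    have hlo : v.ord (aeval x (C p.leadingCoeff * X ^ p.natDegree)) = p.natDegree * v.ord x := by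
      rw [map_mul, aeval_C, map_pow, aeval_X, v.ord_mul (by simpa using hp) (pow_ne_zero _ hx0),
        v.ord_algebraMap (leadingCoeff_ne_zero.2 hp), v.ord_pow hx0, zero_add]
    have hsplit : aeval x p =
        aeval x (C p.leadingCoeff * X ^ p.natDegree) + aeval x p.eraseLead := by
      rw [← map_add, add_comm, eraseLead_add_C_mul_X_pow]
    have hlt : aeval x p.eraseLead = 0 ∨
        v.ord (aeval x (C p.leadingCoeff * X ^ p.natDegree)) < v.ord (aeval x p.eraseLead) := by
      by_cases he : p.eraseLead = 0
      · left; rw [he, map_zero]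
      · right
        have hlt : p.eraseLead.natDegree < p.natDegree := by
          rcases p.eraseLead_natDegree_lt_or_eraseLead_eq_zero with h | h
          · exact h
          · exact absurd h he
        rw [(ih _ (hn ▸ hlt) he rfl).2, hlo]
        exact mul_lt_mul_of_neg_right (by exact_mod_cast hlt) hneg
    rw [hsplit, ← hn, ← hlo]
    exact ⟨v.add_ne_zero_of_ord_lt hlc hlt, v.ord_add_of_lt hlc hlt⟩

theorem Place.mem_of_aeval_mem [DiscretePlaces K L] (v : Place K L) {x : L} {p : K[X]}
    (hp : p.natDegree ≠ 0) (h : aeval x p ∈ v.1) : x ∈ v.1 := by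
  by_contra hx
  have hx0 : x ≠ 0 := by rintro rfl; exact hx v.1.zero_mem
  have hp0 : p ≠ 0 := by rintro rfl; exact hp rfl
  obtain ⟨h1, h2⟩ := v.ord_aeval_of_notMem hx hp0
  have h3 := (v.ord_nonneg_iff h1).2 h
  have h4 := (v.ord_neg_iff hx0).2 hx
  have : (0 : ℤ) < p.natDegree := by exact_mod_cast Nat.pos_of_ne_zero hp
  nlinarith

/-- Reduction of a fraction `p / d` to lowest terms. -/
theorem _root_.Polynomial.exists_eq_mul_isCoprime (p : K[X]) {d : K[X]} (hd : d ≠ 0) :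
    ∃ c p' d' : K[X], c ≠ 0 ∧ d' ≠ 0 ∧ p = c * p' ∧ d = c * d' ∧ IsCoprime p' d' := by
  let _ : GCDMonoid K[X] := UniqueFactorizationMonoid.toGCDMonoid _
  obtain ⟨p', d', hp, hd', hu⟩ := extract_gcd p d
  refine ⟨gcd p d, p', d', fun h0 => hd ((gcd_eq_zero_iff _ _).1 h0).2, ?_, hp, hd',
    (gcd_isUnit_iff _ _).1 hu⟩
  rintro rfl
  exact hd (by rw [hd', mul_zero])

/-- `K[x]` is integrally closed in `K(x)`, in terms of places. -/
theorem dvd_of_forall_div_mem [DiscretePlaces K L] {x : L} (hx : Transcendental K x) {p d : K[X]}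
    (hd : d ≠ 0) (h : ∀ v : Place K L, x ∈ v.1 → aeval x p / aeval x d ∈ v.1) : d ∣ p := by
  obtain ⟨c, p', d', hc0, hd0, rfl, rfl, hcop⟩ := exists_eq_mul_isCoprime p hd
  have hne : ∀ q : K[X], q ≠ 0 → aeval x q ≠ 0 := fun q hq h0 =>
    hq ((transcendental_iff.1 hx) q h0)
  by_cases hu : d'.natDegree = 0
  · have : IsUnit d' := by
      rw [Polynomial.isUnit_iff_degree_eq_zero, degree_eq_natDegree hd0, hu]; rfl
    exact mul_dvd_mul_left c (this.dvd)
  · exfalso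
    -- a zero of the reduced denominator is a pole of the fraction
    obtain ⟨v, hv⟩ := exists_place_of_transcendental (hx.aeval d' hu
      (mem_nonZeroDivisors_of_ne_zero (leadingCoeff_ne_zero.2 hd0)))
    have hxv := v.mem_of_aeval_mem hu (v.mem_of_nonunit hv)
    have h1 := h v hxv
    rw [map_mul, map_mul, mul_div_mul_left _ _ (hne _ hc0)] at h1
    have h3 : aeval x p' ∈ v.1.nonunits := by
      have := v.mul_mem_nonunits h1 hv
      rwa [div_mul_cancel₀ _ (hne _ hd0)] at this
    obtain ⟨a, b, hab⟩ := hcop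
    have h4 := congrArg (aeval x) hab
    simp only [map_add, map_mul, map_one] at h4
    apply v.one_notMem_nonunits
    rw [← h4]
    exact add_mem (v.mul_mem_nonunits (v.aeval_mem hxv a) h3)
      (v.mul_mem_nonunits (v.aeval_mem hxv b) hv)

theorem _root_.Polynomial.dvd_of_sq_dvd_sq_mul {d q g : K[X]} (hd : d ≠ 0) (hg : Squarefree g)
    (h : d ^ 2 ∣ q ^ 2 * g) : d ∣ q := by
  obtain ⟨c, q', d', hc0, hd0, rfl, rfl, hcop⟩ := exists_eq_mul_isCoprime q hd
  rw [mul_pow, mul_pow, mul_assoc] at h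
  have h1 : d' ^ 2 ∣ q' ^ 2 * g := (mul_dvd_mul_iff_left (pow_ne_zero 2 hc0)).1 h
  have h2 : d' ^ 2 ∣ g := hcop.symm.pow.dvd_of_dvd_mul_left h1
  exact mul_dvd_mul_left c (hg d' (by rwa [← sq])).dvd

namespace IsQuadratic

variable {g : K[X]} {x y : L} (h : IsQuadratic g x y) [CharZero K]

omit [CharZero K] in
theorem _root_.AlgEquiv.apply_aeval_of_eq {ι : L ≃ₐ[K] L} (hιx : ι x = x) (p : K[X]) :
    ι (aeval x p) = aeval x p := by
  have := aeval_algHom_apply (ι : L →ₐ[K] L) x p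
  rw [AlgEquiv.coe_toAlgHom, hιx] at this
  exact this.symm

include h

/-- For squarefree `g` the ring `K[x, y]` is integrally closed: a function whose poles all lie
above the pole of `x` is a polynomial in `x` and `y`. -/
theorem exists_eq_of_forall_mem (hg : Squarefree g) {f : L}
    (hf : ∀ v : Place K L, x ∈ v.1 → f ∈ v.1) :
    ∃ p q : K[X], f = aeval x p + aeval x q * y := by
  have := h.discretePlaces
  have : CharZero L := charZero_of_injective_algebraMap (algebraMap K L).injective
  obtain ⟨ι, hιx, hιy⟩ := h.exists_involution
  obtain ⟨p, q, d, hd, h1⟩ := h.exists_mul_eq f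
  have hd' := h.aeval_ne_zero hd
  have hf' : ∀ v : Place K L, x ∈ v.1 → ι f ∈ v.1 := fun v hv =>
    hf (v.transport ι) (by rw [Place.mem_transport, hιx]; exact hv)
  have h2 := congrArg ι h1
  simp only [map_mul, map_add, AlgEquiv.apply_aeval_of_eq hιx, hιy] at h2
  have c2 : ∀ v : Place K L, (2 : L)⁻¹ ∈ v.1 := fun v => by
    have := v.algebraMap_mem (2⁻¹ : K)
    rwa [map_inv₀, map_ofNat] at this
  -- the trace of `f` is integral over `K[x]`, and so is the square of `f - ι f`, which is
  -- a polynomial multiple of `g / d²`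
  obtain ⟨p', rfl⟩ : d ∣ p := by
    refine dvd_of_forall_div_mem h.transc hd fun v hv => ?_
    have : aeval x p / aeval x d = (f + ι f) * 2⁻¹ := by
      field_simp
      linear_combination -h1 - h2
    rw [this]
    exact v.1.mul_mem _ _ (v.1.add_mem _ _ (hf v hv) (hf' v hv)) (c2 v)
  obtain ⟨q', rfl⟩ : d ∣ q := by
    refine dvd_of_sq_dvd_sq_mul hd hg (dvd_of_forall_div_mem h.transc (pow_ne_zero 2 hd)
      fun v hv => ?_)
    have : aeval x (q ^ 2 * g) / aeval x (d ^ 2) = ((f - ι f) * 2⁻¹) ^ 2 := by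
      have h3 : (f - ι f) * aeval x d = 2 * (aeval x q * y) := by linear_combination h1 - h2
      rw [map_mul, map_pow, map_pow, ← h.sq]
      field_simp
      linear_combination -((f - ι f) * aeval x d + 2 * (aeval x q * y)) * h3
    rw [this]
    exact pow_mem (v.1.mul_mem _ _ (sub_mem (hf v hv) (hf' v hv)) (c2 v)) 2
  refine ⟨p', q', mul_right_cancel₀ hd' ?_⟩
  rw [h1, map_mul, map_mul]
  ring

end IsQuadratic

end Integral

/-! ### Differentials of a quadratic function field -/

section Differentials

variable {K L : Type*} [Field K] [Field L] [Algebra K L] {g : K[X]} {x y : L} [CharZero K]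

/-- The differentials of a quadratic function field are the multiples of `dx`. -/
theorem IsQuadratic.exists_kaehler_equiv (h : IsQuadratic g x y) :
    ∃ E : Ω[L⁄K] ≃ₗ[L] L, E (KaehlerDifferential.D K L x) = 1 := by
  obtain ⟨φ, hφ⟩ := h.exists_fractionRing_map
  obtain ⟨ι, hιx, hιy⟩ := h.exists_involution
  have hq := h.isInvolutionQuotient hιx hιy hφ
  let _ : Algebra (FractionRing K[X]) L := φ.toRingHom.toAlgebra
  let _ : Algebra K[X] L := (aeval x : K[X] →ₐ[K] L).toRingHom.toAlgebra
  have : IsScalarTower K K[X] L := IsScalarTower.of_algebraMap_eq fun c => by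
    change algebraMap K L c = aeval x (C c)
    rw [aeval_C]
  have : IsScalarTower K[X] (FractionRing K[X]) L := by
    refine IsScalarTower.of_algebraMap_eq' ?_
    change (aeval x : K[X] →ₐ[K] L).toRingHom =
      (φ.comp (IsScalarTower.toAlgHom K K[X] (FractionRing K[X]))).toRingHom
    congr 1
    ext
    simp [hφ]
  have : CharZero (FractionRing K[X]) :=
    charZero_of_injective_algebraMap (algebraMap K (FractionRing K[X])).injective
  have : Algebra.IsAlgebraic (FractionRing K[X]) L := by
    refine ⟨fun f => IsIntegral.isAlgebraic ?_⟩
    obtain ⟨n, hn⟩ := hq.exists_norm f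
    obtain ⟨t, ht⟩ := hq.exists_trace f
    refine ⟨X ^ 2 + (C (-t) * X + C n), ?_, ?_⟩
    · exact monic_X_pow_add (by
        refine (degree_linear_le).trans_lt ?_
        norm_num)
    · have hn' : algebraMap (FractionRing K[X]) L n = f * ι f := hn
      have ht' : algebraMap (FractionRing K[X]) L t = f + ι f := ht
      simp only [eval₂_add, eval₂_mul, eval₂_pow, eval₂_X, eval₂_C,
        map_neg (algebraMap (FractionRing K[X]) L), hn', ht']
      ring
  -- `L` is separable over `K(x)`, so formally étale over `K[x]`, and its differentials are obtained
  -- from those of `K[x]` by base change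
  have : Algebra.FormallyEtale (FractionRing K[X]) L := Algebra.FormallyEtale.of_isSeparable _ _
  have : Algebra.FormallyEtale K[X] (FractionRing K[X]) :=
    Algebra.FormallyEtale.of_isLocalization (nonZeroDivisors K[X])
  have : Algebra.FormallyEtale K[X] L := Algebra.FormallyEtale.comp K[X] (FractionRing K[X]) L
  let e1 := KaehlerDifferential.tensorKaehlerEquivOfFormallyEtale K K[X] L
  let e2 : TensorProduct K[X] L (Ω[K[X]⁄K]) ≃ₗ[L] TensorProduct K[X] L K[X] :=
    LinearEquiv.baseChange K[X] L _ _ (KaehlerDifferential.polynomialEquiv K)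
  let e3 : TensorProduct K[X] L K[X] ≃ₗ[L] L := TensorProduct.AlgebraTensorModule.rid K[X] L L
  refine ⟨e1.symm.trans (e2.trans e3), ?_⟩
  have h1 : e1 (1 ⊗ₜ KaehlerDifferential.D K K[X] X) = KaehlerDifferential.D K L x := by
    have h2 := KaehlerDifferential.tensorKaehlerEquivOfFormallyEtale_symm_D_algebraMap K K[X] L X
    rw [LinearEquiv.symm_apply_eq] at h2
    rw [← h2]
    congr 1
    change aeval x X = x
    rw [aeval_X]
  rw [← h1, LinearEquiv.trans_apply, LinearEquiv.symm_apply_apply, LinearEquiv.trans_apply]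
  simp [e2, e3]

end Differentials

/-! ### The genus of a hyperelliptic curve -/

section Chart

variable {K L : Type*} [Field K] [Field L] [Algebra K L] {g : K[X]} {x y : L}

theorem aeval_inv_reflect {x : L} (hx : x ≠ 0) {N : ℕ} {p : K[X]} (hp : p.natDegree ≤ N) :
    aeval x⁻¹ (p.reflect N) = aeval x p * x⁻¹ ^ N := by
  let _ : Invertible x := invertibleOfNonzero hx
  have := eval₂_reflect_mul_pow (algebraMap K L) x N p hp
  rw [invOf_eq_inv] at this
  rw [aeval_def, aeval_def, ← this, mul_assoc, ← mul_pow, mul_inv_cancel₀ hx, one_pow, mul_one]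

/-- The chart at infinity of the curve `y² = g(x)`. -/
theorem IsQuadratic.chart (h : IsQuadratic g x y) {n : ℕ} (hn : g.natDegree ≤ 2 * n) :
    IsQuadratic (g.reflect (2 * n)) x⁻¹ (y * x⁻¹ ^ n) := by
  have hx := h.x_ne_zero
  refine ⟨fun h' => h.transc (by simpa using h'.inv), ?_, fun S hxS hyS => ?_, fun p q hpq => ?_⟩
  · rw [aeval_inv_reflect hx hn, mul_pow, h.sq, ← pow_mul, mul_comm n]
  · have hx' : x ∈ S := by simpa using S.inv_mem hxS
    refine h.gen S hx' ?_
    have := S.mul_mem hyS (pow_mem hx' n)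
    rwa [mul_assoc, ← mul_pow, inv_mul_cancel₀ hx, one_pow, mul_one] at this
  · set N := max p.natDegree q.natDegree
    have h1 := aeval_inv_reflect (inv_ne_zero hx) (le_max_left p.natDegree q.natDegree)
    have h2 := aeval_inv_reflect (inv_ne_zero hx) (le_max_right p.natDegree q.natDegree)
    rw [inv_inv] at h1 h2
    have h3 := h.indep (p.reflect N * X ^ n) (q.reflect N) (by
      rw [map_mul, map_pow, aeval_X, h1, h2, hpq]
      have : x⁻¹ ^ n * x ^ n = 1 := by rw [← mul_pow, inv_mul_cancel₀ hx, one_pow]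
      linear_combination aeval x⁻¹ q * y * x ^ N * this)
    exact reflect_eq_zero_iff.1 h3

/-- Reversal in degree `n` preserves squarefreeness as long as it gives at most a simple zero
at the origin, that is for `n ≤ deg g + 1`. -/
theorem _root_.Polynomial.squarefree_reflect {n : ℕ} (hg : Squarefree g)
    (hn : g.natDegree ≤ n) (hn' : n ≤ g.natDegree + 1) : Squarefree (g.reflect n) := by
  have hg0 : g ≠ 0 := hg.ne_zero
  rintro c ⟨e, he⟩
  have hr0 : g.reflect n ≠ 0 := fun h0 => hg0 (reflect_eq_zero_iff.1 h0)
  have hc0 : c ≠ 0 := by rintro rfl; exact hr0 (by rw [he]; ring)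
  have he0 : e ≠ 0 := by rintro rfl; exact hr0 (by rw [he]; ring)
  have hdeg : (g.reflect n).natDegree ≤ n := (natDegree_reflect_le).trans (by simp [hn])
  have hdeg' : c.natDegree + c.natDegree + e.natDegree ≤ n := by
    rw [he, natDegree_mul (mul_ne_zero hc0 hc0) he0, natDegree_mul hc0 hc0] at hdeg
    exact hdeg
  obtain ⟨m, hm⟩ := Nat.exists_eq_add_of_le hdeg'
  have h1 : g = c.reflect c.natDegree * c.reflect c.natDegree * e.reflect (e.natDegree + m) := by
    rw [← reflect_mul c c le_rfl le_rfl, ← reflect_mul (c * c) e (natDegree_mul_le) (by lia), ← he]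
    rw [show c.natDegree + c.natDegree + (e.natDegree + m) = n by lia, reflect_reflect]
  -- the reversal of `c` is constant, so `c` is a constant times a power of `X`
  have h2 : IsUnit c.reverse := hg c.reverse ⟨_, h1⟩
  have h3 : c.reverse.natDegree = 0 := natDegree_eq_zero_of_isUnit h2
  have h4 := c.natDegree_eq_reverse_natDegree_add_natTrailingDegree
  have h5 : c.natDegree = 0 := by
    by_contra hcd
    have h6 : X ∣ c := by
      rw [X_dvd_iff]
      exact coeff_eq_zero_of_lt_natTrailingDegree (by lia)
    have h7 : X ^ 2 ∣ g.reflect n := by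
      rw [he, sq]
      exact Dvd.dvd.mul_right (mul_dvd_mul h6 h6) e
    rw [X_pow_dvd_iff] at h7
    have h8 := h7 0 (by norm_num)
    have h9 := h7 1 (by norm_num)
    rw [coeff_reflect, revAt_le (by lia)] at h8
    have hlc : g.coeff g.natDegree ≠ 0 := by simpa using hg0
    rcases hn.eq_or_lt with h10 | h10
    · rw [Nat.sub_zero, ← h10] at h8
      exact hlc h8
    · rw [coeff_reflect, revAt_le (by lia), show n - 1 = g.natDegree by lia] at h9
      exact hlc h9
  exact (Polynomial.isUnit_iff_degree_eq_zero).2 (by rw [degree_eq_natDegree hc0, h5]; rfl)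

end Chart

section Genus

variable {K L : Type*} [Field K] [Field L] [Algebra K L] {g : K[X]} {x y : L}

/-- The differentials that are regular at the place `v`. -/
abbrev regularAt (v : Place K L) : Submodule K (Ω[L⁄K]) :=
  Submodule.span K {ω | ∃ f ∈ v.1, ∃ g ∈ v.1, ω = f • KaehlerDifferential.D K L g}

theorem smul_mem_regularAt {v : Place K L} {f : L} (hf : f ∈ v.1) {ω : Ω[L⁄K]}
    (hω : ω ∈ regularAt v) : f • ω ∈ regularAt v := by
  induction hω using Submodule.span_induction with
  | mem ω hω =>
    obtain ⟨a, ha, b, hb, rfl⟩ := hω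
    rw [smul_smul]
    exact Submodule.subset_span ⟨_, v.1.mul_mem _ _ hf ha, b, hb, rfl⟩
  | zero => rw [smul_zero]; exact zero_mem _
  | add ω ω' _ _ h h' => rw [smul_add]; exact add_mem h h'
  | smul c ω _ h => rw [smul_comm]; exact Submodule.smul_mem _ c h

namespace IsQuadratic

variable [CharZero K] (h : IsQuadratic g x y)

include h

omit [CharZero K] in
theorem two_y_smul_D : (2 * y) • KaehlerDifferential.D K L y =
    aeval x (derivative g) • KaehlerDifferential.D K L x := by
  have h1 := congrArg (KaehlerDifferential.D K L) h.sq
  rw [Derivation.leibniz_pow, Derivation.map_aeval] at h1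
  rw [← h1]
  simp [mul_smul, two_smul]

/-- For squarefree `g` the differential `dx / y` is regular at the finite places. -/
theorem inv_smul_D_mem (hg : Squarefree g) {v : Place K L} (hv : x ∈ v.1) :
    y⁻¹ • KaehlerDifferential.D K L x ∈ regularAt v := by
  have : CharZero L := charZero_of_injective_algebraMap (algebraMap K L).injective
  by_cases hy : y ∈ v.1.nonunits
  · -- at a branch point `dx / y = 2 dy / g'(x)`
    obtain ⟨a, b, hab⟩ : IsCoprime g (derivative g) :=
      (PerfectField.separable_iff_squarefree).2 hg
    have h1 := congrArg (aeval x) hab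
    simp only [map_add, map_mul, map_one, ← h.sq] at h1
    have h2 : aeval x (derivative g) ∉ v.1.nonunits := by
      intro h3
      apply v.one_notMem_nonunits
      rw [← h1, pow_two]
      exact add_mem (v.mul_mem_nonunits (v.aeval_mem hv a)
        (v.mul_mem_nonunits (v.mem_of_nonunit hy) hy)) (v.mul_mem_nonunits (v.aeval_mem hv b) h3)
    have h3 : aeval x (derivative g) ≠ 0 := fun h0 => h2 (by rw [h0]; exact zero_mem _)
    have h4 : y⁻¹ • KaehlerDifferential.D K L x =
        (2 * (aeval x (derivative g))⁻¹) • KaehlerDifferential.D K L y := by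
      have h5 : KaehlerDifferential.D K L x =
          (aeval x (derivative g))⁻¹ • (2 * y) • KaehlerDifferential.D K L y := by
        rw [h.two_y_smul_D, inv_smul_smul₀ h3]
      rw [h5, smul_smul, smul_smul]
      congr 1
      have := h.y_ne_zero
      field_simp
    rw [h4]
    refine Submodule.subset_span ⟨_, v.1.mul_mem _ _ ?_ (v.inv_mem_of_notMem_nonunits h2), y,
      v.mem_of_nonunit hy, rfl⟩
    have := v.algebraMap_mem (2 : K)
    rwa [map_ofNat] at this
  · exact Submodule.subset_span ⟨y⁻¹, v.inv_mem_of_notMem_nonunits hy, x, hv, rfl⟩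

/-- At a finite place the regular differentials are the regular multiples of `dx / y`. -/
theorem mem_of_smul_mem_regularAt (hg : Squarefree g) {v : Place K L} (hv : x ∈ v.1) {f : L}
    (hf : f • y⁻¹ • KaehlerDifferential.D K L x ∈ regularAt v) : f ∈ v.1 := by
  have := h.finiteDimensional
  have : CharZero L := charZero_of_injective_algebraMap (algebraMap K L).injective
  obtain ⟨E, hE⟩ := h.exists_kaehler_equiv
  set D := KaehlerDifferential.D K L
  have hyv : y ∈ v.1 := v.mem_of_pow_mem two_ne_zero (by rw [h.sq]; exact v.aeval_mem hv g)
  have h2v : (2 : L)⁻¹ ∈ v.1 := by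
    have := v.algebraMap_mem (2⁻¹ : K)
    rwa [map_inv₀, map_ofNat] at this
  have hy0 := h.y_ne_zero
  have hEp : ∀ p : K[X], E (D (aeval x p)) = aeval x (derivative p) := fun p => by
    rw [Derivation.map_aeval, map_smul, hE, smul_eq_mul, mul_one]
  have hEy : y * E (D y) = 2⁻¹ * aeval x (derivative g) := by
    have := congrArg E h.two_y_smul_D
    rw [map_smul, map_smul, hE, smul_eq_mul, smul_eq_mul, mul_one] at this
    rw [← this]
    ring
  -- integral functions are polynomials in `x` and `y`
  have hint : ∀ a, IsIntegral (Algebra.adjoin K {x}) a → y * E (D a) ∈ v.1 := by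
    intro a ha
    obtain ⟨p, q, rfl⟩ := h.exists_eq_of_forall_mem hg fun w hw => w.mem_of_isIntegral hw ha
    have : y * E (D (aeval x p + aeval x q * y)) =
        aeval x (derivative p) * y + aeval x (derivative q) * aeval x g
          + aeval x q * (2⁻¹ * aeval x (derivative g)) := by
      rw [map_add, map_add, hEp, Derivation.leibniz, map_add, map_smul, map_smul, hEp, ← hEy,
        ← h.sq, smul_eq_mul, smul_eq_mul]
      ring
    rw [this]
    refine v.1.add_mem _ _ (v.1.add_mem _ _ (v.1.mul_mem _ _ (v.aeval_mem hv _) hyv)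
      (v.1.mul_mem _ _ (v.aeval_mem hv _) (v.aeval_mem hv _))) (v.1.mul_mem _ _ (v.aeval_mem hv _)
      (v.1.mul_mem _ _ h2v (v.aeval_mem hv _)))
  -- elements of `O_v` are fractions of integral functions with invertible denominator
  have hall : ∀ a ∈ v.1, y * E (D a) ∈ v.1 := by
    intro a ha
    obtain ⟨b, c, hb, hc, hcu, rfl⟩ := (v.discrete_and_exists_div h.transc hv).2 a ha
    have hc0 : c ≠ 0 := by rintro rfl; exact hcu (zero_mem _)
    have hbv := v.mem_of_isIntegral hv hb
    have hci := v.inv_mem_of_notMem_nonunits hcu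
    have : y * E (D (b / c)) = c⁻¹ * (y * E (D b)) - (b / c) * (c⁻¹ * (y * E (D c))) := by
      have h1 : D b = (b / c) • D c + c • D (b / c) := by
        rw [← Derivation.leibniz, div_mul_cancel₀ _ hc0]
      rw [h1, map_add, map_smul, map_smul, smul_eq_mul, smul_eq_mul]
      field_simp
      ring
    rw [this]
    exact sub_mem (v.1.mul_mem _ _ hci (hint b hb))
      (v.1.mul_mem _ _ ha (v.1.mul_mem _ _ hci (hint c hc)))
  have key : ∀ ω ∈ regularAt v, y * E ω ∈ v.1 := by
    intro ω hω
    induction hω using Submodule.span_induction with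
    | mem ω hω =>
      obtain ⟨a, ha, b, hb, rfl⟩ := hω
      rw [map_smul, smul_eq_mul, mul_left_comm]
      exact v.1.mul_mem _ _ ha (hall b hb)
    | zero => rw [map_zero, mul_zero]; exact v.1.zero_mem
    | add ω ω' _ _ h h' => rw [map_add, mul_add]; exact v.1.add_mem _ _ h h'
    | smul c ω _ h =>
      rw [← algebraMap_smul L c ω, map_smul, smul_eq_mul, mul_left_comm]
      exact v.1.mul_mem _ _ (v.algebraMap_mem c) h
  have := key _ hf
  rw [map_smul, map_smul, hE, smul_eq_mul, smul_eq_mul, mul_one] at this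
  rwa [mul_left_comm, mul_inv_cancel₀ hy0, mul_one] at this

omit [CharZero K] in
/-- The differential `f dx / y` in the chart at infinity. -/
theorem smul_D_eq_chart (n : ℕ) (f : L) :
    f • y⁻¹ • KaehlerDifferential.D K L x =
      (-(f * x * x⁻¹ ^ n)) • (y * x⁻¹ ^ (n + 1))⁻¹ • KaehlerDifferential.D K L x⁻¹ := by
  have hx := h.x_ne_zero
  have hy := h.y_ne_zero
  have h1 : KaehlerDifferential.D K L x⁻¹ = (-x⁻¹ ^ 2) • KaehlerDifferential.D K L x := by
    rw [Derivation.leibniz_inv]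
  rw [h1, smul_smul, smul_smul, smul_smul]
  congr 1
  have h2 : x⁻¹ ^ n * x ^ n = 1 := by rw [← mul_pow, inv_mul_cancel₀ hx, one_pow]
  have h3 : x⁻¹ * x = 1 := inv_mul_cancel₀ hx
  rw [mul_inv, ← inv_pow, inv_inv]
  linear_combination (-(f * y⁻¹)) * h2 - f * y⁻¹ * x⁻¹ ^ n * x ^ n * (1 + x⁻¹ * x) * h3

/-- The regular differentials of `y² = g(x)` are the differentials `p(x) dx / y` with
`deg p < n`, where `deg g` is `2n + 1` or `2n + 2`: regularity at the finite places makes the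
coefficient of `dx / y` a polynomial in `x` and `y`, and the places at infinity exclude `y` and
bound the degree. -/
theorem smul_mem_regularDifferentials_iff (hg : Squarefree g) {n : ℕ}
    (hn : 2 * n + 1 ≤ g.natDegree) (hn' : g.natDegree ≤ 2 * n + 2) (f : L) :
    f • y⁻¹ • KaehlerDifferential.D K L x ∈ regularDifferentials K L ↔
      ∃ p ∈ degreeLT K n, aeval x p = f := by
  have := h.discretePlaces
  have : CharZero L := charZero_of_injective_algebraMap (algebraMap K L).injective
  have hx := h.x_ne_zero
  have hc := h.chart (n := n + 1) (by lia)
  have hcg : Squarefree (g.reflect (2 * (n + 1))) := squarefree_reflect hg (by lia) (by lia)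
  have hreg : ∀ ω : Ω[L⁄K], ω ∈ regularDifferentials K L ↔ ∀ v : Place K L, ω ∈ regularAt v := by
    intro ω
    rw [regularDifferentials, Submodule.mem_iInf]
  rw [hreg]
  constructor
  · intro hf
    obtain ⟨p, q, rfl⟩ := h.exists_eq_of_forall_mem hg
      fun v hv => h.mem_of_smul_mem_regularAt hg hv (hf v)
    have hinf : ∀ v : Place K L, x ∉ v.1 → (aeval x p + aeval x q * y) * x * x⁻¹ ^ n ∈ v.1 := by
      intro v hv
      have h1 := hf v
      rw [h.smul_D_eq_chart n] at h1
      have h2 := hc.mem_of_smul_mem_regularAt hcg (v.mem_of_nonunit (v.inv_mem_nonunits hv)) h1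
      simpa using neg_mem h2
    obtain ⟨ι, hιx, hιy⟩ := h.exists_involution
    have hinf' : ∀ v : Place K L, x ∉ v.1 → (aeval x p - aeval x q * y) * x * x⁻¹ ^ n ∈ v.1 := by
      intro v hv
      have := hinf (v.transport ι) (by rw [Place.mem_transport, hιx]; exact hv)
      rw [Place.mem_transport] at this
      simpa [AlgEquiv.apply_aeval_of_eq hιx, hιx, hιy, sub_eq_add_neg] using this
    obtain ⟨v, hv⟩ := exists_place_of_transcendental hc.transc
    have hxv : x ∉ v.1 := ((v.1.inv_mem_nonunits_iff).1 hv).resolve_left hx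
    have hox := (v.ord_neg_iff hx).2 hxv
    have h2v : (2 : L)⁻¹ ∈ v.1 := by
      have := v.algebraMap_mem (2⁻¹ : K)
      rwa [map_inv₀, map_ofNat] at this
    have m1 := v.1.mul_mem _ _ (v.1.add_mem _ _ (hinf v hxv) (hinf' v hxv)) h2v
    have m2 := v.1.mul_mem _ _ (sub_mem (hinf v hxv) (hinf' v hxv)) h2v
    -- `p(x) x^(1 - n)` and the square of `q(x) y x^(1 - n)` are regular at infinity
    rw [show ((aeval x p + aeval x q * y) * x * x⁻¹ ^ n + (aeval x p - aeval x q * y) * x * x⁻¹ ^ n)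
      * 2⁻¹ = aeval x p * x * x⁻¹ ^ n by ring] at m1
    have m3 := pow_mem m2 2
    rw [show (((aeval x p + aeval x q * y) * x * x⁻¹ ^ n
      - (aeval x p - aeval x q * y) * x * x⁻¹ ^ n) * 2⁻¹) ^ 2
      = aeval x (q ^ 2 * g) * x ^ 2 * x⁻¹ ^ (2 * n) by
        rw [map_mul, map_pow, ← h.sq]; ring] at m3
    have ho1 : v.ord (x⁻¹ ^ n) = -(n * v.ord x) := by
      rw [v.ord_pow (inv_ne_zero hx), v.ord_inv]; ring
    have ho2 : v.ord (x⁻¹ ^ (2 * n)) = -(2 * n * v.ord x) := by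
      rw [v.ord_pow (inv_ne_zero hx), v.ord_inv]; push_cast; ring
    have hq0 : q = 0 := by
      by_contra hq
      have hqg : q ^ 2 * g ≠ 0 := mul_ne_zero (pow_ne_zero 2 hq) hg.ne_zero
      obtain ⟨n1, n2⟩ := v.ord_aeval_of_notMem hxv hqg
      rw [← v.ord_nonneg_iff (mul_ne_zero (mul_ne_zero n1 (pow_ne_zero 2 hx))
          (pow_ne_zero _ (inv_ne_zero hx))),
        v.ord_mul (mul_ne_zero n1 (pow_ne_zero 2 hx)) (pow_ne_zero _ (inv_ne_zero hx)),
        v.ord_mul n1 (pow_ne_zero 2 hx), ho2, n2, v.ord_pow hx,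
        natDegree_mul (pow_ne_zero 2 hq) hg.ne_zero, natDegree_pow] at m3
      have : (2 * n + 1 : ℤ) ≤ g.natDegree := by exact_mod_cast hn
      push_cast at m3
      nlinarith [Int.natCast_nonneg q.natDegree]
    refine ⟨p, ?_, by rw [hq0]; simp⟩
    rw [mem_degreeLT]
    by_cases hp : p = 0
    · rw [hp, degree_zero]; exact WithBot.bot_lt_coe n
    obtain ⟨n1, n2⟩ := v.ord_aeval_of_notMem hxv hp
    rw [← v.ord_nonneg_iff (mul_ne_zero (mul_ne_zero n1 hx) (pow_ne_zero _ (inv_ne_zero hx))),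
      v.ord_mul (mul_ne_zero n1 hx) (pow_ne_zero _ (inv_ne_zero hx)), v.ord_mul n1 hx, ho1,
      n2] at m1
    rw [degree_eq_natDegree hp, Nat.cast_lt]
    by_contra hlt
    push Not at hlt
    have : (n : ℤ) ≤ p.natDegree := by exact_mod_cast hlt
    nlinarith
  · rintro ⟨p, hp, rfl⟩ v
    by_cases hv : x ∈ v.1
    · exact smul_mem_regularAt (v.aeval_mem hv p) (h.inv_smul_D_mem hg hv)
    · have hv' := v.mem_of_nonunit (v.inv_mem_nonunits hv)
      rw [h.smul_D_eq_chart n]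
      refine smul_mem_regularAt (neg_mem ?_) (hc.inv_smul_D_mem hcg hv')
      rcases n with _ | n
      · have hp0 : p = 0 := by
          rw [mem_degreeLT] at hp
          simpa using hp
        rw [hp0, map_zero, zero_mul, zero_mul]
        exact v.1.zero_mem
      · rw [mem_degreeLT] at hp
        have hpd : p.natDegree ≤ n := by
          rw [natDegree_le_iff_degree_le]
          exact Order.le_of_lt_succ hp
        have := v.aeval_mem hv' (p.reflect n)
        rw [aeval_inv_reflect hx hpd] at this
        rwa [pow_succ, mul_assoc, mul_left_comm x, mul_inv_cancel₀ hx, mul_one]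

/-- A hyperelliptic curve `y² = g(x)` with `g` squarefree of degree `2n + 1` or `2n + 2` has
genus `n`. -/
theorem genus_eq (hg : Squarefree g) {n : ℕ} (hn : 2 * n + 1 ≤ g.natDegree)
    (hn' : g.natDegree ≤ 2 * n + 2) : genus K L = n := by
  obtain ⟨E, hE⟩ := h.exists_kaehler_equiv
  have hy := h.y_ne_zero
  let Φ : K[X] →ₗ[K] Ω[L⁄K] :=
    ((LinearMap.toSpanSingleton L _ (y⁻¹ • KaehlerDifferential.D K L x)).restrictScalars K).comp
      (aeval x : K[X] →ₐ[K] L).toLinearMap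
  have hΦ : ∀ p, Φ p = aeval x p • y⁻¹ • KaehlerDifferential.D K L x := fun _ => rfl
  have hinj : Function.Injective Φ := by
    rw [injective_iff_map_eq_zero]
    intro p hp
    have := congrArg E (hΦ p ▸ hp)
    rw [map_smul, map_smul, hE, map_zero, smul_eq_mul, smul_eq_mul, mul_one] at this
    exact (transcendental_iff.1 h.transc) p ((mul_eq_zero.1 this).resolve_right (inv_ne_zero hy))
  have hmap : regularDifferentials K L = (degreeLT K n).map Φ := by
    ext ω
    have hω : ω = (y * E ω) • y⁻¹ • KaehlerDifferential.D K L x := by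
      apply E.injective
      rw [map_smul, map_smul, hE, smul_eq_mul, smul_eq_mul]
      field_simp
    rw [hω, h.smul_mem_regularDifferentials_iff hg hn hn', Submodule.mem_map]
    refine exists_congr fun p => and_congr_right fun _ => ?_
    rw [hΦ]
    constructor
    · intro h1; rw [h1]
    · intro h1
      have := congrArg E h1
      rw [map_smul, map_smul, map_smul, map_smul, hE] at this
      simpa [hy] using this
  rw [genus, hmap, ← (Submodule.equivMapOfInjective Φ hinj (degreeLT K n)).finrank_eq,
    (degreeLTEquiv K n).finrank_eq, Module.finrank_fin_fun]

end IsQuadratic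

end Genus

end FunctionField

/-! ### The polynomials of the curves -/

section Polynomials

variable {k : Type*} [Field k] (a b : k)

theorem natDegree_f4 : (f4 a b).natDegree = 4 := by
  unfold f4
  compute_degree!

theorem f4_ne_zero : f4 a b ≠ 0 := by
  intro h
  have := natDegree_f4 a b
  rw [h, natDegree_zero] at this
  norm_num at this

theorem natDegree_one_sub_X : (1 - X : k[X]).natDegree = 1 := by
  compute_degree!

theorem natDegree_gHbar : (gHbar a b).natDegree = 5 := by
  have h : (1 - X : k[X]) ≠ 0 := by
    intro h
    have := natDegree_one_sub_X (k := k)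
    rw [h, natDegree_zero] at this
    norm_num at this
  rw [gHbar, natDegree_mul h (f4_ne_zero a b), natDegree_f4, natDegree_one_sub_X]

theorem natDegree_gE : (gE a b).natDegree = 4 := by
  rw [gE, natDegree_comp, natDegree_f4, natDegree_one_sub_X]

theorem gCalHbar_eq : gCalHbar a b = (gE a b).comp (X ^ 2) := by
  rw [gCalHbar, gE, comp_assoc]
  simp

theorem natDegree_gCalHbar : (gCalHbar a b).natDegree = 8 := by
  rw [gCalHbar_eq, natDegree_comp, natDegree_gE, natDegree_X_pow]

theorem f4_eq_comp : f4 a b = (gE a b).comp (1 - X) := by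
  rw [gE, comp_assoc]
  simp

theorem eval_one_f4 : (f4 a b).eval 1 = 1 - a - b := by
  simp [f4]
  ring

section Map

variable {F : Type*} [Field F] (i : k →+* F)

theorem map_f4 : (f4 a b).map i = f4 (i a) (i b) := by
  simp [f4, map_ofNat]

theorem map_gE : (gE a b).map i = gE (i a) (i b) := by
  rw [gE, gE, Polynomial.map_comp, map_f4]
  simp

theorem map_DeltaAB : i (DeltaAB a b) = DeltaAB (i a) (i b) := by
  simp [DeltaAB, map_ofNat]

end Map

variable [CharZero k]

theorem Δ_curveE : (curveE a b).Δ = -(a ^ 5 * DeltaAB a b) / 2 ^ 4 := by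
  simp only [WeierstrassCurve.Δ, WeierstrassCurve.b₂, WeierstrassCurve.b₄, WeierstrassCurve.b₆,
    WeierstrassCurve.b₈, curveE, DeltaAB]
  field_simp
  ring

theorem c₄_curveE : (curveE a b).c₄ = 64 * a ^ 2 + 4 * a ^ 2 * b + 16 * a * b ^ 2 + a ^ 2 * b ^ 2
    + 2 * a * b ^ 3 + b ^ 4 := by
  simp only [WeierstrassCurve.c₄, WeierstrassCurve.b₂, WeierstrassCurve.b₄, curveE]
  field_simp
  ring

/-- This factorization makes the Weierstrass equation a multiple of the quartic equation, see
`curveE_equation`. -/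
theorem a₆_curveE : (curveE a b).a₆ = (curveE a b).a₂ * (curveE a b).a₄ := by
  simp only [curveE]
  ring

/-- The quartic `f₄(1 - w)` in terms of the coefficients of the Weierstrass equation. -/
theorem four_mul_gE : 4 * gE a b = C 4 * X ^ 4 + C (4 * (curveE a b).a₁) * X ^ 3
    + C ((curveE a b).a₁ ^ 2 + 4 * (curveE a b).a₂) * X ^ 2 + C (2 * (curveE a b).a₃) * X
    - C (curveE a b).a₄ := by
  apply Polynomial.funext
  intro w
  simp only [gE, f4, curveE, eval_mul, eval_comp, eval_add, eval_sub, eval_pow, eval_X, eval_C,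
    eval_one, eval_ofNat]
  field_simp
  ring

variable {a b} (hD : a * DeltaAB a b ≠ 0)

include hD

theorem Δ_curveE_ne_zero : (curveE a b).Δ ≠ 0 := by
  rw [Δ_curveE]
  have h1 := left_ne_zero_of_mul hD
  have h2 := right_ne_zero_of_mul hD
  exact div_ne_zero (neg_ne_zero.2 (mul_ne_zero (pow_ne_zero 5 h1) h2)) (by norm_num)

/-- A multiple root of `f₄(1 - w)` would give a singular point of the Weierstrass curve. -/
theorem eval_derivative_gE_ne_zero {w : k} (hw : (gE a b).eval w = 0) :
    (derivative (gE a b)).eval w ≠ 0 := by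
  intro hw'
  set W := curveE a b with hW
  have h1 := congrArg (eval w) (four_mul_gE a b)
  have h2 := congrArg (fun p => eval w (derivative p)) (four_mul_gE a b)
  have h6 := a₆_curveE a b
  simp only [eval_mul, eval_ofNat, hw, eval_add, eval_sub, eval_pow, eval_X, eval_C,
    derivative_mul, derivative_add, derivative_sub, derivative_C,
    derivative_X, derivative_ofNat, hw', ← hW] at h1 h2 h6
  have h3 : W.toAffine.Equation (2 * w ^ 2 + W.a₁ * w)
      (2 * w * (2 * w ^ 2 + W.a₁ * w + W.a₂)) := by
    rw [WeierstrassCurve.Affine.equation_iff, h6]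
    linear_combination (-(2 * w ^ 2 + W.a₁ * w + W.a₂)) * h1
  have h4 := (WeierstrassCurve.Affine.equation_iff_nonsingular_of_Δ_ne_zero
    (Δ_curveE_ne_zero hD)).1 h3
  rw [WeierstrassCurve.Affine.nonsingular_iff] at h4
  norm_num at h2
  have h5 : 2 * (2 * w * (2 * w ^ 2 + W.a₁ * w + W.a₂)) + W.a₁ * (2 * w ^ 2 + W.a₁ * w)
      + W.a₃ = 0 := by
    linear_combination (-1 / 2 : k) * h2
  rcases h4.2 with h | h
  · apply h
    linear_combination w * h2 - h1
  · apply h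
    linear_combination h5

theorem separable_gE : (gE a b).Separable := by
  -- a common root lies in the algebraic closure, where the Weierstrass curve is still nonsingular
  let F := AlgebraicClosure k
  rw [Polynomial.Separable, Polynomial.isCoprime_iff_aeval_ne_zero_of_isAlgClosed k F]
  intro w
  by_contra! h
  have hD' : algebraMap k F a * DeltaAB (algebraMap k F a) (algebraMap k F b) ≠ 0 := by
    rw [← map_DeltaAB, ← map_mul]
    exact (_root_.map_ne_zero _).2 hD
  have h1 := h.1
  have h2 := h.2
  rw [← eval_map_algebraMap, map_gE] at h1
  rw [← eval_map_algebraMap, ← derivative_map, map_gE] at h2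
  exact eval_derivative_gE_ne_zero hD' h1 h2

theorem squarefree_gE : Squarefree (gE a b) := (separable_gE hD).squarefree

theorem squarefree_f4 : Squarefree (f4 a b) := by
  apply Separable.squarefree
  obtain ⟨u, v, huv⟩ := separable_gE hD
  refine ⟨u.comp (1 - X), -v.comp (1 - X), ?_⟩
  have := congrArg (fun p => p.comp (1 - X)) huv
  simp only [add_comp, mul_comp, one_comp] at this
  rw [f4_eq_comp, derivative_comp, derivative_sub, derivative_one, derivative_X]
  linear_combination this

/-- The polynomial `f₄(1 - w²)` has a multiple root at `w = 0` exactly if `f₄(1) = 1 - a - b`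
vanishes. -/
theorem separable_gCalHbar (hab : a + b ≠ 1) : (gCalHbar a b).Separable := by
  obtain ⟨u, v, huv⟩ := separable_gE hD
  rw [Polynomial.Separable, gCalHbar_eq, derivative_comp]
  have h1 : IsCoprime ((gE a b).comp (X ^ 2)) ((derivative (gE a b)).comp (X ^ 2)) := by
    refine ⟨u.comp (X ^ 2), v.comp (X ^ 2), ?_⟩
    have := congrArg (fun p => p.comp (X ^ 2)) huv
    simpa only [add_comp, mul_comp, one_comp] using this
  have h2 : IsCoprime ((gE a b).comp (X ^ 2)) X := by
    refine (Irreducible.coprime_iff_not_dvd irreducible_X).2 ?_ |>.symm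
    rw [X_dvd_iff, coeff_zero_eq_eval_zero, eval_comp]
    simp [gE, eval_comp, eval_one_f4]
    intro h
    exact hab (by linear_combination -h)
  have h3 : IsCoprime ((gE a b).comp (X ^ 2)) (derivative (X ^ 2)) := by
    rw [derivative_X_pow]
    have : IsUnit (C ((2 : ℕ) : k)) := isUnit_C.2 (by simp)
    exact (isCoprime_mul_unit_left_right this _ _).2 (by simpa using h2)
  exact h3.mul_right h1

theorem squarefree_gCalHbar (hab : a + b ≠ 1) : Squarefree (gCalHbar a b) :=
  (separable_gCalHbar hD hab).squarefree

/-- As `f₄(1) = 1 - a - b`, the condition `a + b ≠ 1` prevents `t = 1` from being a double root. -/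
theorem squarefree_gHbar (hab : a + b ≠ 1) : Squarefree (gHbar a b) := by
  obtain ⟨q, hq⟩ := X_sub_C_dvd_sub_C_eval (a := 1) (p := f4 a b)
  rw [eval_one_f4] at hq
  have hc : (C (1 - a - b)⁻¹ : k[X]) * C (1 - a - b) = 1 := by
    rw [← C_mul, inv_mul_cancel₀, C_1]
    exact fun h => hab (by linear_combination -h)
  have hcop : IsCoprime (1 - X) (f4 a b) := by
    refine ⟨C (1 - a - b)⁻¹ * q, C (1 - a - b)⁻¹, ?_⟩
    rw [C_1] at hq
    linear_combination C (1 - a - b)⁻¹ * hq + hc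
  have hsep : (1 - X : k[X]).Separable := ⟨0, -1, by simp⟩
  rw [gHbar, squarefree_mul_iff]
  exact ⟨hcop.isRelPrime, hsep.squarefree, squarefree_f4 hD⟩

omit [CharZero k] hD in
theorem not_isSquare_gHbar : ¬ IsSquare (gHbar a b) := by
  rintro ⟨p, hp⟩
  have := natDegree_gHbar a b
  rw [hp, ← pow_two, natDegree_pow] at this
  lia

theorem not_isSquare_gE : ¬ IsSquare (gE a b) := by
  rintro ⟨p, hp⟩
  have h1 := natDegree_gE a b
  have h2 : IsUnit p := squarefree_gE hD p ⟨1, by rw [hp, mul_one]⟩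
  rw [hp, ← pow_two, natDegree_pow, natDegree_eq_zero_of_isUnit h2] at h1
  norm_num at h1

theorem not_isSquare_gCalHbar : ¬ IsSquare (gCalHbar a b) := by
  rintro ⟨p, hp⟩
  have h1 := natDegree_gCalHbar a b
  rw [hp, ← pow_two, natDegree_pow] at h1
  obtain ⟨u, v, huv⟩ := separable_gE hD
  have h2 := congrArg (fun p => p.comp (X ^ 2)) huv
  simp only [add_comp, mul_comp, one_comp] at h2
  rw [← gCalHbar_eq, hp] at h2
  -- the derivative of `p² = gE(X²)` shows that `p` divides `X`
  have h3 := congrArg derivative hp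
  rw [gCalHbar_eq, derivative_comp, derivative_X_pow, derivative_mul] at h3
  have h4 : (X : k[X]) = p * (X * u.comp (X ^ 2) * p + v.comp (X ^ 2) * derivative p) := by
    have h5 : (C 2 : k[X]) * X =
        C 2 * (p * (X * u.comp (X ^ 2) * p + v.comp (X ^ 2) * derivative p)) := by
      push_cast at h3
      simp only [map_ofNat] at h3 ⊢
      linear_combination (-2 * X) * h2 + v.comp (X ^ 2) * h3
    exact mul_left_cancel₀ (by simp) h5
  have h5 := natDegree_le_of_dvd ⟨_, h4⟩ X_ne_zero
  rw [natDegree_X] at h5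
  lia

end Polynomials

/-! ### Irreducibility of the plane quintic -/

namespace FunctionField

/-- A polynomial of odd degree is not a square in `K(x)`. -/
theorem IsQuadratic.of_odd_natDegree {K L : Type*} [Field K] [Field L] [Algebra K L] {g : K[X]}
    {x y : L} (hx : Transcendental K x) (hy : y ^ 2 = aeval x g)
    (gen : ∀ S : IntermediateField K L, x ∈ S → y ∈ S → S = ⊤) (hg : Odd g.natDegree) :
    IsQuadratic g x y := by
  refine ⟨hx, hy, gen, fun p q hpq => ?_⟩
  by_contra hq
  have h1 : p ^ 2 = q ^ 2 * g := by
    apply transcendental_iff_injective.1 hx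
    rw [map_mul, map_pow, map_pow, hpq, mul_pow, hy]
  have hg0 : g ≠ 0 := by rintro rfl; simp at hg
  have h2 := congrArg natDegree h1
  rw [natDegree_mul (pow_ne_zero 2 hq) hg0, natDegree_pow, natDegree_pow] at h2
  obtain ⟨m, hm⟩ := hg
  lia

end FunctionField

section Quintic

variable {k : Type*} [Field k] (a b : k)

/-- The polynomial `P(t)` with `x⁵ + z⁵ = P(xz)` on the quintic. -/
def sumPoly : k[X] := C (b + 2) * X ^ 2 + C (a - b) * X - C a

/-- The discriminant of the equation `u² - P(t) u + t⁵ = 0` of `u = x⁵` is four times the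
right-hand side of the equation of the genus two curve. -/
theorem sumPoly_sq [CharZero k] : sumPoly a b ^ 2 = 4 * gHbar a b + 4 * X ^ 5 := by
  apply Polynomial.funext
  intro w
  simp only [sumPoly, gHbar, f4, eval_mul, eval_add, eval_sub, eval_pow, eval_X, eval_C,
    eval_one, eval_ofNat]
  field_simp
  ring

variable {a b} [CharZero k] (hD : a * DeltaAB a b ≠ 0)

include hD

/-- An element with fifth power `s + P(t) / 2` would have norm `c t`, and its coordinates would
violate that `f₄` is squarefree. -/
theorem pow_five_ne {L : Type*} [Field L] [Algebra k L] {t s : L}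
    (h : IsQuadratic (gHbar a b) t s) (v : L) : v ^ 5 ≠ s + aeval t (sumPoly a b) / 2 := by
  intro hv
  have := h.discretePlaces
  have : CharZero L := charZero_of_injective_algebraMap (algebraMap k L).injective
  obtain ⟨ι, hιt, hιs⟩ := h.exists_involution
  have hιv : ι v ^ 5 = -s + aeval t (sumPoly a b) / 2 := by
    rw [← map_pow, hv, map_add, hιs, map_div₀, AlgEquiv.apply_aeval_of_eq hιt, map_ofNat]
  obtain ⟨p, q, d, hd, h1⟩ := h.exists_mul_eq v
  have h2 : ι v * aeval t d = aeval t p - aeval t q * s := by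
    have := congrArg ι h1
    rwa [map_mul, map_add, map_mul, AlgEquiv.apply_aeval_of_eq hιt, AlgEquiv.apply_aeval_of_eq hιt,
      AlgEquiv.apply_aeval_of_eq hιt, hιs, mul_neg, ← sub_eq_add_neg] at this
  have hd0 := h.aeval_ne_zero hd
  have hhalf : ∀ w : Place k L, t ∈ w.1 → aeval t (sumPoly a b) / 2 ∈ w.1 := by
    intro w hw
    have := w.1.mul_mem _ _ (w.aeval_mem hw (sumPoly a b)) (w.algebraMap_mem (2⁻¹ : k))
    rwa [map_inv₀, map_ofNat, ← div_eq_mul_inv] at this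
  have hsw : ∀ w : Place k L, t ∈ w.1 → s ∈ w.1 := fun w hw =>
    w.mem_of_pow_mem two_ne_zero (by rw [h.sq]; exact w.aeval_mem hw _)
  have hvw : ∀ w : Place k L, t ∈ w.1 → v ∈ w.1 := fun w hw =>
    w.mem_of_pow_mem (n := 5) (by norm_num)
      (by rw [hv]; exact w.1.add_mem _ _ (hsw w hw) (hhalf w hw))
  have hvw' : ∀ w : Place k L, t ∈ w.1 → ι v ∈ w.1 := fun w hw =>
    w.mem_of_pow_mem (n := 5) (by norm_num)
      (by rw [hιv]; exact w.1.add_mem _ _ (neg_mem (hsw w hw)) (hhalf w hw))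
  -- the trace and the norm of `v` are polynomials in `t`
  obtain ⟨A, rfl⟩ : d ∣ p := by
    have : d ∣ C 2 * p := by
      refine dvd_of_forall_div_mem h.transc hd fun w hw => ?_
      have := w.1.add_mem _ _ (hvw w hw) (hvw' w hw)
      convert this using 1
      rw [div_eq_iff hd0, map_mul, aeval_C, map_ofNat]
      linear_combination -h1 - h2
    exact (IsUnit.dvd_mul_left (isUnit_C.2 (by simp))).1 this
  obtain ⟨N, hN⟩ : d ^ 2 ∣ (d * A) ^ 2 - q ^ 2 * gHbar a b := by
    refine dvd_of_forall_div_mem h.transc (pow_ne_zero 2 hd) fun w hw => ?_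
    have := w.1.mul_mem _ _ (hvw w hw) (hvw' w hw)
    convert this using 1
    rw [div_eq_iff (by rw [map_pow]; exact pow_ne_zero 2 hd0)]
    simp only [map_sub, map_mul, map_pow, ← h.sq]
    simp only [map_mul] at h1 h2
    linear_combination (-(ι v * aeval t d)) * h1 - (aeval t d * aeval t A + aeval t q * s) * h2
  have hvN : v * ι v = aeval t N := by
    apply mul_right_cancel₀ (pow_ne_zero 2 hd0)
    have := congrArg (aeval t) hN
    simp only [map_sub, map_mul, map_pow, ← h.sq] at this
    simp only [map_mul] at h1 h2
    linear_combination (ι v * aeval t d) * h1 + (aeval t d * aeval t A + aeval t q * s) * h2 + this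
  -- the norm of `s + P(t) / 2` is `t⁵`
  have hN5 : N ^ 5 = X ^ 5 := by
    apply transcendental_iff_injective.1 h.transc
    rw [map_pow, map_pow, ← hvN, mul_pow, hv, hιv, aeval_X]
    have := congrArg (aeval t) (sumPoly_sq a b)
    simp only [map_add, map_mul, map_pow, map_ofNat, aeval_X, ← h.sq] at this
    linear_combination (1 / 4 : L) * this
  have hNd : N.natDegree = 1 := by
    have := congrArg natDegree hN5
    rw [natDegree_pow, natDegree_X_pow] at this
    lia
  have hg0 : gHbar a b ≠ 0 := fun h0 => by
    have := natDegree_gHbar a b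
    rw [h0, natDegree_zero] at this
    lia
  have hE : q ^ 2 * gHbar a b = d ^ 2 * (A ^ 2 - N) := by linear_combination -hN
  have hq : q ≠ 0 := by
    rintro rfl
    have h3 : A ^ 2 - N = 0 := by simpa [hd] using hE.symm
    have := congrArg natDegree (sub_eq_zero.1 h3)
    rw [natDegree_pow] at this
    lia
  have hE0 : A ^ 2 - N ≠ 0 := by
    intro h0
    rw [h0, mul_zero] at hE
    exact mul_ne_zero (pow_ne_zero 2 hq) hg0 hE
  -- comparing degrees, `A` is constant and `deg d = deg q + 2`, while `d` divides `q (1 - X)`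
  have hdeg := congrArg natDegree hE
  rw [natDegree_mul (pow_ne_zero 2 hq) hg0, natDegree_mul (pow_ne_zero 2 hd) hE0, natDegree_pow,
    natDegree_pow, natDegree_gHbar] at hdeg
  have hA : A.natDegree = 0 := by
    by_contra hA
    rw [natDegree_sub_eq_left_of_natDegree_lt (by rw [natDegree_pow]; lia), natDegree_pow] at hdeg
    lia
  rw [natDegree_sub_eq_right_of_natDegree_lt (by rw [natDegree_pow]; lia), hNd] at hdeg
  have hdvd : d ∣ q * (1 - X) := by
    refine dvd_of_sq_dvd_sq_mul hd (squarefree_f4 hD) ⟨(A ^ 2 - N) * (1 - X), ?_⟩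
    rw [gHbar] at hE
    linear_combination (1 - X) * hE
  have h1X : (1 - X : k[X]) ≠ 0 := fun h0 => by
    have := natDegree_one_sub_X (k := k)
    rw [h0, natDegree_zero] at this
    lia
  have := natDegree_le_of_dvd hdvd (mul_ne_zero hq h1X)
  rw [natDegree_mul hq h1X, natDegree_one_sub_X] at this
  lia

omit hD in
/-- The equation of `u = x⁵` over `k(t)`. -/
theorem irreducible_quadratic :
    Irreducible (X ^ 2 - C (sumPoly a b) * X + C (X ^ 5) : k[X][X]) := by
  have hm : (X ^ 2 - C (sumPoly a b) * X + C (X ^ 5) : k[X][X]).Monic := by monicity!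
  have hd : (X ^ 2 - C (sumPoly a b) * X + C (X ^ 5) : k[X][X]).natDegree = 2 := by
    compute_degree!
  rw [hm.irreducible_iff_roots_eq_zero_of_degree_le_three hd.ge (by rw [hd]; norm_num),
    Multiset.eq_zero_iff_forall_notMem]
  intro p hp
  rw [mem_roots hm.ne_zero, IsRoot.def] at hp
  simp only [eval_add, eval_sub, eval_mul, eval_pow, eval_X, eval_C] at hp
  apply not_isSquare_gHbar (a := a) (b := b)
  refine ⟨C 2⁻¹ * (2 * p - sumPoly a b), ?_⟩
  have h2 : (C 2⁻¹ : k[X]) * 2 = 1 := by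
    rw [← C_ofNat, ← C_mul]
    simp
  linear_combination (-4 * C 2⁻¹ ^ 2) * hp - C 2⁻¹ ^ 2 * sumPoly_sq a b
    - gHbar a b * (2 * C 2⁻¹ + 1) * h2

/-- The equation of `x` over `k(t)`: it is irreducible since `u` generates a quadratic extension of
`k(t)`, the function field of the genus two curve, in which `u` is not a fifth power. -/
theorem irreducible_comp_pow_five :
    Irreducible ((X ^ 2 - C (sumPoly a b) * X + C (X ^ 5) : k[X][X]).comp (X ^ 5)) := by
  have hm : (X ^ 2 - C (sumPoly a b) * X + C (X ^ 5) : k[X][X]).Monic := by monicity!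
  set f : k[X][X] := X ^ 2 - C (sumPoly a b) * X + C (X ^ 5)
  let F := FractionRing k[X]
  have hm5 : (f.comp (X ^ 5)).Monic := hm.comp (monic_X_pow 5) (by simp)
  rw [hm5.irreducible_iff_irreducible_map_fraction_map (K := F), Polynomial.map_comp,
    Polynomial.map_pow, map_X]
  refine irreducible_comp (hm.map _) (monic_X_pow 5)
    ((hm.irreducible_iff_irreducible_map_fraction_map (K := F)).1 irreducible_quadratic) ?_
  intro E _ _ x hx
  rw [Polynomial.map_pow, map_X]
  have hint : IsIntegral F x := by
    by_contra hx'
    rw [minpoly.eq_zero hx'] at hx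
    exact (hm.map _).ne_zero hx.symm
  refine X_pow_sub_C_irreducible_of_prime (by norm_num) ?_
  set L := IntermediateField.adjoin F {x}
  set u : L := IntermediateField.AdjoinSimple.gen F x
  let _ : Algebra k L := ((algebraMap F L).comp (algebraMap k F)).toAlgebra
  have : IsScalarTower k F L := IsScalarTower.of_algebraMap_eq fun _ => rfl
  let φ : F →ₐ[k] L := IsScalarTower.toAlgHom k F L
  have hφ : ∀ p : k[X], aeval (φ (algebraMap k[X] F X)) p = φ (algebraMap k[X] F p) := by
    intro p
    induction p using Polynomial.induction_on' with
    | add p q hp hq => simp only [map_add, hp, hq]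
    | monomial n c =>
      rw [aeval_monomial, ← C_mul_X_pow_eq_monomial, map_mul, map_pow, map_mul, map_pow]
      rfl
  have hu : u ^ 2 - aeval (φ (algebraMap k[X] F X)) (sumPoly a b) * u
      + (φ (algebraMap k[X] F X)) ^ 5 = 0 := by
    have := minpoly.aeval F u
    rw [IntermediateField.minpoly_gen, hx] at this
    simp only [f, Polynomial.map_add, Polynomial.map_sub, Polynomial.map_mul, Polynomial.map_pow,
      map_X, map_C, map_add, map_sub, map_mul, map_pow, aeval_X, aeval_C] at this
    rw [hφ]
    exact this
  have : CharZero L := charZero_of_injective_algebraMap (algebraMap k L).injective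
  have hq : IsQuadratic (gHbar a b) (φ (algebraMap k[X] F X))
      (u - aeval (φ (algebraMap k[X] F X)) (sumPoly a b) / 2) := by
    refine IsQuadratic.of_odd_natDegree ?_ ?_ ?_ (by rw [natDegree_gHbar]; decide)
    · rw [transcendental_iff_injective]
      intro p q hpq
      rw [hφ, hφ] at hpq
      exact IsFractionRing.injective k[X] F (φ.toRingHom.injective hpq)
    · have := congrArg (aeval (φ (algebraMap k[X] F X))) (sumPoly_sq a b)
      simp only [map_add, map_mul, map_pow, map_ofNat, aeval_X] at this
      linear_combination hu + (1 / 4 : L) * this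
    · intro S hSt hSs
      have hSp := S.aeval_mem hSt
      have hSF : ∀ f : F, algebraMap F L f ∈ S := by
        intro f
        obtain ⟨p, q, -, rfl⟩ := IsFractionRing.div_surjective (A := k[X]) f
        rw [map_div₀]
        refine S.div_mem ?_ ?_
        · have := hSp p; rwa [hφ] at this
        · have := hSp q; rwa [hφ] at this
      have hSu : u ∈ S := by
        have := add_mem hSs (S.div_mem (hSp (sumPoly a b)) (ofNat_mem S 2))
        simpa using this
      rw [eq_top_iff]
      intro f _
      have htop := (IntermediateField.adjoin.powerBasis hint).adjoin_gen_eq_top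
      rw [IntermediateField.adjoin.powerBasis_gen] at htop
      have hf : f ∈ Algebra.adjoin F {IntermediateField.AdjoinSimple.gen F x} := by
        rw [htop]; trivial
      induction hf using Algebra.adjoin_induction with
      | mem f hf => rw [Set.mem_singleton_iff] at hf; rw [hf]; exact hSu
      | algebraMap f => exact hSF f
      | add f g _ _ h h' => exact add_mem (h trivial) (h' trivial)
      | mul f g _ _ h h' => exact mul_mem (h trivial) (h' trivial)
  intro v hv
  refine pow_five_ne hD hq v ?_
  rw [hv]
  ring

omit hD in
/-- Multiplying the equation of `z` over `k(x)` by a power of `x` gives the equation of `t = xz`,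
which as a polynomial in `x` and `t` is the equation of `x` over `k(t)`. -/
theorem scaleRoots_quintic : (quintic a b).scaleRoots X =
    Bivariate.swap ((X ^ 2 - C (sumPoly a b) * X + C (X ^ 5) : k[X][X]).comp (X ^ 5)) := by
  have hd : (quintic a b).natDegree = 5 := by
    unfold quintic
    compute_degree!
  have h1 : Bivariate.swap ((X ^ 2 - C (sumPoly a b) * X + C (X ^ 5) : k[X][X]).comp (X ^ 5)) =
      X ^ 5 - C (C (b + 2) * X ^ 5) * X ^ 2 - C (C (a - b) * X ^ 5) * X
        + C (X ^ 10 + C a * X ^ 5) := by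
    simp only [sumPoly, add_comp, sub_comp, mul_comp, pow_comp, X_comp, C_comp, map_add, map_sub,
      map_mul, map_pow, Bivariate.swap_Y, Bivariate.swap_X, Bivariate.swap_C_C]
    ring
  rw [h1]
  ext1 n
  rw [coeff_scaleRoots, hd]
  by_cases hn : n ≤ 5
  · interval_cases n <;> simp only [quintic, coeff_add, coeff_sub, coeff_C_mul, coeff_X_pow,
      coeff_X, coeff_C] <;> norm_num <;> ring
  · rw [coeff_eq_zero_of_natDegree_lt (by lia), zero_mul, coeff_eq_zero_of_natDegree_lt]
    refine lt_of_le_of_lt ?_ (not_le.1 hn)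
    compute_degree

omit hD [CharZero k] in
theorem monic_quintic : (quintic a b).Monic := by
  unfold quintic
  monicity!

theorem irreducible_quintic : Irreducible (quintic a b) := by
  have h1 : Irreducible ((quintic a b).scaleRoots X) := by
    rw [scaleRoots_quintic]
    exact (MulEquiv.irreducible_iff Bivariate.swap).2 (irreducible_comp_pow_five hD)
  -- a factorization of the quintic scales to a factorization of the scaled quintic
  rw [monic_quintic.irreducible_iff_natDegree]
  refine ⟨?_, fun f g hf hg hfg => ?_⟩
  · intro h
    rw [h, one_scaleRoots] at h1
    exact not_irreducible_one h1
  · rw [← hfg, mul_scaleRoots_of_noZeroDivisors] at h1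
    rcases h1.isUnit_or_isUnit rfl with h2 | h2
    · left
      rw [← natDegree_scaleRoots f X]
      exact natDegree_eq_zero_of_isUnit h2
    · right
      rw [← natDegree_scaleRoots g X]
      exact natDegree_eq_zero_of_isUnit h2

theorem isDomain_HRing : IsDomain (HRing a b) :=
  AdjoinRoot.isDomain_of_prime (irreducible_quintic hD).prime

end Quintic

/-! ### Cyclic quotients -/

namespace FunctionField

/-- Kummer theory: if `L` is generated over the image of `φ` by an element on which `τ` acts by a
primitive `n`-th root of unity, and whose `n`-th power lies in the image, then the image of `φ` is
the fixed field of `τ`. -/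
theorem isQuotient_of_kummer {K F L : Type*} [Field K] [CharZero K] [Field F] [Field L]
    [Algebra K F] [Algebra K L] (φ : F →ₐ[K] L) (τ : L ≃ₐ[K] L) {n : ℕ} (hn : n ≠ 0) {ζ : K}
    (hζ : IsPrimitiveRoot ζ n) {x : L} (hτ : ∀ f, τ (φ f) = φ f) (hx : τ x = algebraMap K L ζ * x)
    {c : F} (hxn : x ^ n = φ c)
    (gen : ∀ S : IntermediateField K L, (∀ f, φ f ∈ S) → x ∈ S → S = ⊤) : IsQuotient τ φ := by
  refine ⟨φ.toRingHom.injective, fun f => ⟨?_, fun hf => ?_⟩⟩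
  · rintro ⟨g, rfl⟩
    exact hτ g
  let _ : Algebra F L := φ.toRingHom.toAlgebra
  have : IsScalarTower K F L := IsScalarTower.of_algebraMap_eq fun c => (φ.commutes c).symm
  have hint : IsIntegral F x := by
    refine ⟨X ^ n - C c, monic_X_pow_sub_C _ hn, ?_⟩
    rw [eval₂_sub, eval₂_pow, eval₂_X, eval₂_C, hxn]
    exact sub_self _
  have htop : Algebra.adjoin F {x} = ⊤ := by
    have h1 := gen ((IntermediateField.adjoin F {x}).restrictScalars K)
      (IntermediateField.adjoin F {x}).algebraMap_mem
      (IntermediateField.mem_adjoin_simple_self F x)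
    rw [← IntermediateField.adjoin_simple_toSubalgebra_of_isAlgebraic hint.isAlgebraic, eq_top_iff]
    intro f _
    have : f ∈ (IntermediateField.adjoin F {x}).restrictScalars K := by rw [h1]; trivial
    exact this
  -- the trace `∑ τ ^ j` maps `L` to the image of `φ`
  have key : ∀ f : L, ∑ j ∈ Finset.range n, τ^[j] f ∈ φ.range := by
    intro f
    have hf : f ∈ Algebra.adjoin F {x} := by rw [htop]; trivial
    rw [Algebra.adjoin_singleton_eq_range_aeval] at hf
    obtain ⟨p, rfl⟩ := hf
    induction p using Polynomial.induction_on' with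
    | add p q hp hq =>
      have : ∀ j, τ^[j] (aeval x (p + q)) = τ^[j] (aeval x p) + τ^[j] (aeval x q) := fun j => by
        rw [map_add, iterate_map_add]
      simp only [AlgHom.toRingHom_eq_coe, RingHom.coe_coe] at hp hq ⊢
      simp only [this, Finset.sum_add_distrib]
      exact add_mem hp hq
    | monomial i g =>
      have h1 : ∀ j, τ^[j] (aeval x (monomial i g)) =
          φ g * x ^ i * (algebraMap K L (ζ ^ i)) ^ j := by
        intro j
        rw [aeval_monomial]
        induction j with
        | zero => rw [pow_zero, mul_one]; rfl
        | succ j ih =>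
          rw [Function.iterate_succ_apply', ih, map_mul, map_mul, hτ, map_pow, map_pow, hx,
            AlgEquiv.commutes, mul_pow, ← map_pow, pow_succ]
          ring
      simp only [AlgHom.toRingHom_eq_coe, RingHom.coe_coe, h1, ← Finset.mul_sum]
      by_cases hi : n ∣ i
      · obtain ⟨m, rfl⟩ := hi
        rw [pow_mul, hxn, pow_mul, hζ.pow_eq_one, one_pow, map_one]
        refine ⟨g * c ^ m * n, ?_⟩
        simp
      · have h2 : ζ ^ i ≠ 1 := fun h => hi ((hζ.pow_eq_one_iff_dvd i).1 h)
        have h3 : ∑ j ∈ Finset.range n, (algebraMap K L (ζ ^ i)) ^ j = 0 := by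
          have h4 := geom_sum_mul (algebraMap K L (ζ ^ i)) n
          rw [← map_pow, ← pow_mul, mul_comm i, pow_mul, hζ.pow_eq_one, one_pow, map_one, sub_self,
            mul_eq_zero] at h4
          refine h4.resolve_right fun h5 => h2 ?_
          rw [sub_eq_zero, ← map_one (algebraMap K L)] at h5
          exact (algebraMap K L).injective h5
        rw [h3, mul_zero]
        exact zero_mem _
  have h1 := key f
  simp only [Function.iterate_fixed hf, Finset.sum_const, Finset.card_range, nsmul_eq_mul] at h1
  have h2 := φ.range.smul_mem h1 ((n : K)⁻¹)
  rwa [← map_natCast (algebraMap K L), ← Algebra.smul_def, smul_smul, inv_mul_cancel₀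
    (Nat.cast_ne_zero.2 hn), one_smul] at h2

end FunctionField

/-! ### The function field of the plane quintic -/

theorem AlgHom.apply_eq_aeval {R A : Type*} [CommRing R] [CommRing A] [Algebra R A]
    (φ : R[X] →ₐ[R] A) (p : R[X]) : φ p = aeval (φ X) p := by
  rw [aeval_algHom_apply, aeval_X_left_apply]

theorem AdjoinRoot.mem_of_root_mem {R : Type*} [CommRing R] {f : R[X]} (T : Subring (AdjoinRoot f))
    (h1 : ∀ r, AdjoinRoot.of f r ∈ T) (h2 : AdjoinRoot.root f ∈ T) (r : AdjoinRoot f) : r ∈ T := by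
  induction r using AdjoinRoot.induction_on with
  | ih p =>
    induction p using Polynomial.induction_on' with
    | add p q hp hq => rw [map_add]; exact add_mem hp hq
    | monomial n c =>
      rw [← C_mul_X_pow_eq_monomial, map_mul, map_pow, AdjoinRoot.mk_C, AdjoinRoot.mk_X]
      exact mul_mem (h1 c) (pow_mem h2 n)

theorem IsAlgebraic.of_algebraMap_mul {K L : Type*} [Field K] [Field L] [Algebra K L] {c : K}
    (hc : c ≠ 0) {x : L} (h : IsAlgebraic K (algebraMap K L c * x)) : IsAlgebraic K x := by
  have := (isAlgebraic_algebraMap (R := K) (A := L) c⁻¹).mul h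
  rwa [← mul_assoc, ← map_mul, inv_mul_cancel₀ hc, map_one, one_mul] at this

section Curves

variable {k : Type*} [Field k] {a b : k}

namespace HField

variable [IsDomain (HRing a b)] {M : Type*} [Field M] [Algebra k M]

omit [IsDomain (HRing a b)] in
theorem aeval_x (p : k[X]) : aeval (x a b) p =
    algebraMap (HRing a b) (HField a b) (AdjoinRoot.of _ p) :=
  (((IsScalarTower.toAlgHom k (HRing a b) (HField a b)).comp
    (IsScalarTower.toAlgHom k k[X] (HRing a b))).apply_eq_aeval p).symm

omit [IsDomain (HRing a b)] in
theorem transcendental_x : Transcendental k (x a b) := by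
  rw [transcendental_iff_injective]
  intro p q hpq
  rw [aeval_x, aeval_x] at hpq
  refine AdjoinRoot.of.injective_of_degree_ne_zero ?_ (IsFractionRing.injective _ _ hpq)
  have : (quintic a b).degree = 5 := by
    unfold quintic
    compute_degree!
  rw [this]
  norm_num

theorem eq_top_of_mem (S : IntermediateField k (HField a b)) (hx : x a b ∈ S) (hz : z a b ∈ S) :
    S = ⊤ := by
  refine S.mem_of_algebraMap_fractionRing fun r => ?_
  have hr : AdjoinRoot.root (quintic a b) ∈
      S.toSubring.comap (algebraMap (HRing a b) (HField a b)) := hz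
  refine AdjoinRoot.mem_of_root_mem _ (fun p => ?_) hr r
  have := S.aeval_mem hx p
  rwa [aeval_x] at this

omit [IsDomain (HRing a b)] in
theorem aeval_sumPoly {M : Type*} [CommRing M] [Algebra k M] (t : M) : aeval t (sumPoly a b) =
    algebraMap k M (b + 2) * t ^ 2 + algebraMap k M (a - b) * t - algebraMap k M a := by
  simp [sumPoly]

omit [IsDomain (HRing a b)] in
theorem eval₂_quintic {M : Type*} [CommRing M] [Algebra k M] (x z : M) :
    eval₂ ((aeval x : k[X] →ₐ[k] M) : k[X] →+* M) z (quintic a b)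
      = x ^ 5 + z ^ 5 - aeval (x * z) (sumPoly a b) := by
  rw [aeval_sumPoly (a := a) (b := b)]
  simp [quintic, eval₂_sub, eval₂_add, eval₂_mul, eval₂_pow]
  ring

omit [IsDomain (HRing a b)] in
theorem add_pow_five : x a b ^ 5 + z a b ^ 5 = aeval (x a b * z a b) (sumPoly a b) := by
  have h1 := eval₂_quintic (a := a) (b := b) (x a b) (z a b)
  rw [← sub_eq_zero, ← h1]
  have h2 : ((aeval (x a b) : k[X] →ₐ[k] HField a b) : k[X] →+* HField a b) =
      (algebraMap (HRing a b) (HField a b)).comp (AdjoinRoot.of (quintic a b)) := by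
    apply RingHom.ext
    exact aeval_x
  rw [h2, z, HRing.z, ← hom_eval₂, AdjoinRoot.eval₂_root, map_zero]

/-- The map of function fields given by a transcendental element `x` and an element `z` with
`x⁵ + z⁵ = P(xz)`. -/
def lift (x z : M) (hx : Transcendental k x) (h : x ^ 5 + z ^ 5 = aeval (x * z) (sumPoly a b)) :
    HField a b →ₐ[k] M :=
  IsFractionRing.liftAlgHom (g := AdjoinRoot.liftAlgHom (quintic a b) (aeval x) z
      (by rw [eval₂_quintic, h, sub_self])) <| by
    refine AdjoinRoot.lift_injective monic_quintic (AdjoinRoot.liftAlgHom (quintic a b) (aeval x) z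
      (by rw [eval₂_quintic, h, sub_self])).toRingHom ?_
    intro p q hpq
    apply transcendental_iff_injective.1 hx
    simpa using hpq

@[simp] theorem lift_x {x' z' : M} (hx : Transcendental k x')
    (h : x' ^ 5 + z' ^ 5 = aeval (x' * z') (sumPoly a b)) : lift x' z' hx h (x a b) = x' := by
  rw [lift, IsFractionRing.liftAlgHom_apply, x, IsFractionRing.lift_algebraMap]
  simp [HRing.x]

@[simp] theorem lift_z {x' z' : M} (hx : Transcendental k x')
    (h : x' ^ 5 + z' ^ 5 = aeval (x' * z') (sumPoly a b)) : lift x' z' hx h (z a b) = z' := by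
  rw [lift, IsFractionRing.liftAlgHom_apply, z, IsFractionRing.lift_algebraMap]
  simp [HRing.z]

omit [IsDomain (HRing a b)] in
theorem x_ne_zero : x a b ≠ 0 := fun h => transcendental_x (by rw [h]; exact isAlgebraic_zero)

/-- The function `t = xz` is not constant. -/
theorem transcendental_mul : Transcendental k (x a b * z a b) := by
  intro halg
  -- otherwise `x` would have no poles
  obtain ⟨v, hv⟩ := exists_place_of_transcendental (K := k) (x := (x a b)⁻¹)
    fun h => transcendental_x (by simpa using h.inv)
  set t := x a b * z a b
  have ht : t ∈ v.1 := by
    refine v.mem_of_isIntegral (x := 0) v.1.zero_mem ?_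
    exact halg.isIntegral.tower_top
  have h1 := v.aeval_mem ht (sumPoly a b)
  have h2 : (1 : HField a b) = ((x a b)⁻¹ ^ 4 * aeval t (sumPoly a b)) * (x a b)⁻¹
      - ((x a b)⁻¹ ^ 9 * t ^ 5) * (x a b)⁻¹ := by
    have h3 := add_pow_five (a := a) (b := b)
    have h4 := x_ne_zero (a := a) (b := b)
    rw [← h3]
    simp only [t]
    field_simp
    ring
  have hm := v.mem_of_nonunit hv
  refine v.one_notMem_nonunits ?_
  rw [h2]
  exact sub_mem (v.mul_mem_nonunits (v.1.mul_mem _ _ (pow_mem hm 4) h1) hv)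
    (v.mul_mem_nonunits (v.1.mul_mem _ _ (pow_mem hm 9) (pow_mem ht 5)) hv)

/-- The function `s = x⁵ - P(t) / 2` satisfies `s² = (1 - t) f₄(t)`. -/
theorem quotient_sq [CharZero k] : (x a b ^ 5 - aeval (x a b * z a b) (sumPoly a b) / 2) ^ 2 =
    aeval (x a b * z a b) (gHbar a b) := by
  have : CharZero (HField a b) := charZero_of_injective_algebraMap (algebraMap k _).injective
  have h1 := congrArg (aeval (x a b * z a b)) (sumPoly_sq a b)
  simp only [map_add, map_mul, map_pow, map_ofNat, aeval_X] at h1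
  have h2 := add_pow_five (a := a) (b := b)
  linear_combination (1 / 4 : HField a b) * h1 + x a b ^ 5 * h2

/-- The automorphism `(x, z) ↦ (ζ x, ζ⁻¹ z)` of the quintic. -/
theorem exists_scale {ζ : k} (hζ : ζ ^ 5 = 1) : ∃ α : HField a b ≃ₐ[k] HField a b,
    α (x a b) = algebraMap k _ ζ * x a b ∧ α (z a b) = algebraMap k _ ζ⁻¹ * z a b := by
  have hζ0 : ζ ≠ 0 := by rintro rfl; norm_num at hζ
  have hm : algebraMap k (HField a b) ζ * algebraMap k (HField a b) ζ⁻¹ = 1 := by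
    rw [← map_mul, mul_inv_cancel₀ hζ0, map_one]
  have hx : Transcendental k (algebraMap k _ ζ * x a b) :=
    fun h => transcendental_x (h.of_algebraMap_mul hζ0)
  have h : (algebraMap k _ ζ * x a b) ^ 5 + (algebraMap k _ ζ⁻¹ * z a b) ^ 5 =
      aeval ((algebraMap k _ ζ * x a b) * (algebraMap k _ ζ⁻¹ * z a b)) (sumPoly a b) := by
    rw [mul_mul_mul_comm, hm, one_mul, ← add_pow_five, mul_pow, mul_pow, ← map_pow, ← map_pow,
      inv_pow, hζ, inv_one, map_one, one_mul, one_mul]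
  refine ⟨AlgEquiv.ofBijective (lift _ _ hx h) ⟨(lift _ _ hx h).toRingHom.injective,
    AlgHom.surjective_of_gen (s := {x a b, z a b})
      (fun S hS => eq_top_of_mem S (hS (by simp)) (hS (by simp))) ?_⟩, lift_x hx h, lift_z hx h⟩
  rintro f (rfl | rfl)
  · refine ⟨algebraMap k _ ζ⁻¹ * x a b, ?_⟩
    rw [map_mul, AlgHom.commutes, lift_x, ← mul_assoc, mul_comm (algebraMap k _ ζ⁻¹), hm, one_mul]
  · refine ⟨algebraMap k _ ζ * z a b, ?_⟩
    rw [map_mul, AlgHom.commutes, lift_z, ← mul_assoc, hm, one_mul]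

variable [CharZero k]

theorem exists_quotientMap [IsDomain (QuadRing (gHbar a b))] :
    ∃ p : QuadField (gHbar a b) →ₐ[k] HField a b,
      p (QuadField.x _) = x a b * z a b ∧
      p (QuadField.y _) = x a b ^ 5 - aeval (x a b * z a b) (sumPoly a b) / 2 :=
  ⟨QuadField.lift _ _ quotient_sq transcendental_mul, QuadField.lift_x _ _, QuadField.lift_y _ _⟩

theorem isQuotient [IsDomain (QuadRing (gHbar a b))] {ζ : k} (hζ : IsPrimitiveRoot ζ 5)
    {α : HField a b ≃ₐ[k] HField a b} (hαx : α (x a b) = algebraMap k _ ζ * x a b)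
    (hαz : α (z a b) = algebraMap k _ ζ⁻¹ * z a b) {p : QuadField (gHbar a b) →ₐ[k] HField a b}
    (hpx : p (QuadField.x _) = x a b * z a b)
    (hpy : p (QuadField.y _) = x a b ^ 5 - aeval (x a b * z a b) (sumPoly a b) / 2) :
    IsQuotient α p := by
  have : CharZero (HField a b) := charZero_of_injective_algebraMap (algebraMap k _).injective
  have hζ0 : ζ ≠ 0 := hζ.ne_zero (by norm_num)
  have hα : α (x a b * z a b) = x a b * z a b := by
    rw [map_mul, hαx, hαz, mul_mul_mul_comm, ← map_mul, mul_inv_cancel₀ hζ0, map_one, one_mul]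
  have hx5 : x a b ^ 5 = p (QuadField.y _ + aeval (QuadField.x _) (sumPoly a b) / 2) := by
    rw [map_add, map_div₀, map_ofNat, ← aeval_algHom_apply, hpx, hpy]
    ring
  refine isQuotient_of_kummer p α (by norm_num) hζ ?_ hαx hx5 fun S hS hxS => ?_
  · have : (α : HField a b →ₐ[k] HField a b).comp p = p := by
      refine algHom_eq_of_gen isQuadratic_quadField.gen_set ?_
      rintro f (rfl | rfl)
      · simpa [hpx] using hα
      · have h5 : α (x a b ^ 5) = x a b ^ 5 := by
          rw [map_pow, hαx, mul_pow, ← map_pow, hζ.pow_eq_one, map_one, one_mul]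
        change α (p _) = p _
        rw [hpy, map_sub, h5, map_div₀, AlgEquiv.apply_aeval_of_eq hα, map_ofNat]
    exact DFunLike.congr_fun this
  · refine eq_top_of_mem S hxS ?_
    have := S.div_mem (hS (QuadField.x _)) hxS
    rwa [hpx, mul_div_cancel_left₀ _ (x_ne_zero (a := a) (b := b))] at this

/-- The function `1 - t` is not a square on the quintic: a square root would be invariant under
the automorphism of odd order, and so lie in the function field `k(t, s)` of the quotient. -/
theorem sq_ne {ζ : k} (hζ : IsPrimitiveRoot ζ 5) (hD : a * DeltaAB a b ≠ 0) (y : HField a b) :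
    y ^ 2 ≠ 1 - x a b * z a b := by
  intro hy
  have := QuadField.isDomain_of_not_isSquare (not_isSquare_gHbar (a := a) (b := b))
  have : CharZero (HField a b) := charZero_of_injective_algebraMap (algebraMap k _).injective
  obtain ⟨α, hαx, hαz⟩ := exists_scale (a := a) (b := b) hζ.pow_eq_one
  obtain ⟨p, hpx, hpy⟩ := exists_quotientMap (a := a) (b := b)
  have hq := isQuotient hζ hαx hαz hpx hpy
  have ht : α (x a b * z a b) = x a b * z a b := by
    rw [← hpx]
    exact (hq.2 _).1 ⟨_, rfl⟩
  have hy0 : y ≠ 0 := by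
    rintro rfl
    refine transcendental_mul (k := k) (a := a) (b := b) ?_
    have : x a b * z a b = 1 := by linear_combination hy
    rw [this]
    exact isAlgebraic_one
  have hαy : α y = y := by
    have h1 : α y ^ 2 = y ^ 2 := by rw [← map_pow, hy, map_sub, map_one, ht]
    rcases sq_eq_sq_iff_eq_or_eq_neg.1 h1 with h2 | h2
    · exact h2
    · exfalso
      -- `y ↦ -y` is impossible for an automorphism of odd order
      have h3 : (α ^ 5 : HField a b ≃ₐ[k] HField a b) = 1 := by
        have : ((α ^ 5 : HField a b ≃ₐ[k] HField a b) : HField a b →ₐ[k] HField a b) =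
            AlgHom.id k _ := by
          refine algHom_eq_of_gen (s := {x a b, z a b})
            (fun S hS => eq_top_of_mem S (hS (by simp)) (hS (by simp))) ?_
          have e1 : algebraMap k (HField a b) ζ ^ 5 = 1 := by
            rw [← map_pow, hζ.pow_eq_one, map_one]
          have e2 : algebraMap k (HField a b) ζ⁻¹ ^ 5 = 1 := by
            rw [← map_pow, inv_pow, hζ.pow_eq_one, inv_one, map_one]
          rintro f (rfl | rfl)
          · simp only [pow_succ, pow_zero, one_mul, AlgEquiv.coe_toAlgHom, AlgEquiv.mul_apply, hαx,
              map_mul, AlgEquiv.commutes, AlgHom.id_apply]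
            linear_combination x a b * e1
          · simp only [pow_succ, pow_zero, one_mul, AlgEquiv.coe_toAlgHom, AlgEquiv.mul_apply, hαz,
              map_mul, AlgEquiv.commutes, AlgHom.id_apply]
            linear_combination z a b * e2
        ext f
        exact DFunLike.congr_fun this f
      have h4 := DFunLike.congr_fun h3 y
      simp only [pow_succ, pow_zero, one_mul, AlgEquiv.mul_apply, h2, map_neg, neg_neg,
        AlgEquiv.one_apply] at h4
      have : 2 * y = 0 := by linear_combination -h4
      exact hy0 (by simpa using this)
  obtain ⟨f, hf⟩ := (hq.2 y).2 hαy
  have h := isQuadratic_quadField (g := gHbar a b)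
  set t := QuadField.x (gHbar a b)
  set s := QuadField.y (gHbar a b)
  have hf2 : f ^ 2 = aeval t (1 - X : k[X]) := by
    apply p.toRingHom.injective
    change p (f ^ 2) = p _
    rw [map_pow]
    change p f = y at hf
    rw [hf, hy, ← aeval_algHom_apply, hpx]
    simp
  have : CharZero (QuadField (gHbar a b)) :=
    charZero_of_injective_algebraMap (algebraMap k _).injective
  -- if `f = (A + B s) / d` squares to `1 - t`, then `A B = 0`, so that `1 - t` or `f₄(t)` is
  -- a square in `k(t)`
  obtain ⟨A, B, d, hd, h1⟩ := h.exists_mul_eq f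
  have h2 : aeval t (d ^ 2 * (1 - X) - A ^ 2 - B ^ 2 * gHbar a b) = aeval t (C 2 * A * B) * s := by
    simp only [map_sub, map_mul, map_pow, ← h.sq, map_ofNat] at hf2 ⊢
    linear_combination (-aeval t d ^ 2) * hf2 + (f * aeval t d + aeval t A + aeval t B * s) * h1
  have h3 := h.indep _ _ h2
  have h4 := h.indep_fst h2
  have h1X : (1 - X : k[X]) ≠ 0 := fun h0 => by
    have := natDegree_one_sub_X (k := k)
    rw [h0, natDegree_zero] at this
    lia
  have hdd : (d ^ 2 * (1 - X)).natDegree = 2 * d.natDegree + 1 := by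
    rw [natDegree_mul (pow_ne_zero 2 hd) h1X, natDegree_pow, natDegree_one_sub_X]
  rcases mul_eq_zero.1 h3 with h5 | rfl
  · have hA : A = 0 := by simpa using h5
    subst hA
    have h6 : d ^ 2 = B ^ 2 * f4 a b := by
      apply mul_right_cancel₀ h1X
      rw [gHbar] at h4
      linear_combination h4
    have h7 : d ∣ B := dvd_of_sq_dvd_sq_mul hd (squarefree_f4 hD) ⟨1, by rw [← h6, mul_one]⟩
    have hB : B ≠ 0 := by
      rintro rfl
      simp [hd] at h6
    have h8 := natDegree_le_of_dvd h7 hB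
    have h9 := congrArg natDegree h6
    rw [natDegree_mul (pow_ne_zero 2 hB) (f4_ne_zero a b), natDegree_pow, natDegree_pow,
      natDegree_f4] at h9
    lia
  · have h6 : d ^ 2 * (1 - X) = A ^ 2 := by linear_combination h4
    rw [h6, natDegree_pow] at hdd
    lia

end HField

end Curves

/-! ### The double cover of the quintic -/

section Cover

variable {k : Type*} [Field k] {a b : k}

/-- The monic polynomial `w² - (1 - xz)` is prime over the coordinate ring of the quintic since it
is irreducible over the function field. -/
theorem isDomain_CalHRing [CharZero k] [IsDomain (HRing a b)] {ζ : k} (hζ : IsPrimitiveRoot ζ 5)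
    (hD : a * DeltaAB a b ≠ 0) : IsDomain (CalHRing a b) := by
  apply AdjoinRoot.isDomain_of_prime
  set i := algebraMap (HRing a b) (HField a b)
  have hi : Function.Injective i := IsFractionRing.injective _ _
  have hm : (X ^ 2 - C (1 - HRing.x a b * HRing.z a b) : (HRing a b)[X]).Monic :=
    monic_X_pow_sub_C _ two_ne_zero
  have hd : (X ^ 2 - C (i (1 - HRing.x a b * HRing.z a b)) : (HField a b)[X]).natDegree = 2 :=
    natDegree_X_pow_sub_C
  have hp : Prime (X ^ 2 - C (i (1 - HRing.x a b * HRing.z a b)) : (HField a b)[X]) := by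
    apply Irreducible.prime
    have hm' : (X ^ 2 - C (i (1 - HRing.x a b * HRing.z a b)) : (HField a b)[X]).Monic :=
      monic_X_pow_sub_C _ two_ne_zero
    rw [hm'.irreducible_iff_roots_eq_zero_of_degree_le_three hd.ge (by rw [hd]; norm_num),
      Multiset.eq_zero_iff_forall_notMem]
    intro y hy
    rw [mem_roots hm'.ne_zero, IsRoot.def] at hy
    simp only [eval_sub, eval_pow, eval_X, eval_C, sub_eq_zero] at hy
    refine HField.sq_ne hζ hD y ?_
    rw [hy, map_sub, map_one, map_mul]
    rfl
  have hmap : (X ^ 2 - C (1 - HRing.x a b * HRing.z a b) : (HRing a b)[X]).map i =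
      X ^ 2 - C (i (1 - HRing.x a b * HRing.z a b)) := by simp
  rw [← hmap] at hp
  refine ⟨hm.ne_zero, fun hu => hp.not_isUnit (hu.map (mapRingHom i)), fun f g hfg => ?_⟩
  rw [← map_dvd_map i hi hm, Polynomial.map_mul] at hfg
  rw [← map_dvd_map i hi hm, ← map_dvd_map i hi hm (y := g)]
  exact hp.dvd_or_dvd hfg

namespace CalHField

variable [IsDomain (HRing a b)] [IsDomain (CalHRing a b)] {M : Type*} [Field M] [Algebra k M]

omit [IsDomain (CalHRing a b)] in
theorem of_injective : Function.Injective
    (AdjoinRoot.of (X ^ 2 - C (1 - HRing.x a b * HRing.z a b) : (HRing a b)[X])) := by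
  apply AdjoinRoot.of.injective_of_degree_ne_zero
  rw [degree_X_pow_sub_C two_pos]
  norm_num

theorem ringMap_injective (a b : k) [IsDomain (HRing a b)] [IsDomain (CalHRing a b)] :
    Function.Injective ((IsScalarTower.toAlgHom k (CalHRing a b) (CalHField a b)).comp
      (IsScalarTower.toAlgHom k (HRing a b) (CalHRing a b))) :=
  (IsFractionRing.injective (CalHRing a b) (CalHField a b)).comp of_injective

/-- The inclusion of the function field of the quintic into that of its double cover. -/
def ofHField (a b : k) [IsDomain (HRing a b)] [IsDomain (CalHRing a b)] :
    HField a b →ₐ[k] CalHField a b :=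
  IsFractionRing.liftAlgHom (ringMap_injective a b)

theorem ofHField_algebraMap (r : HRing a b) : ofHField a b (algebraMap _ _ r) =
    algebraMap (CalHRing a b) (CalHField a b) (AdjoinRoot.of _ r) := by
  rw [ofHField, IsFractionRing.liftAlgHom_apply, IsFractionRing.lift_algebraMap]
  rfl

@[simp] theorem ofHField_x : ofHField a b (HField.x a b) = x a b := ofHField_algebraMap _

@[simp] theorem ofHField_z : ofHField a b (HField.z a b) = z a b := ofHField_algebraMap _

omit [IsDomain (HRing a b)] [IsDomain (CalHRing a b)] in
theorem w_sq : w a b ^ 2 = 1 - x a b * z a b := by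
  have := AdjoinRoot.mk_self (f := (X ^ 2 - C (1 - HRing.x a b * HRing.z a b) : (HRing a b)[X]))
  rw [map_sub (AdjoinRoot.mk _), map_pow, AdjoinRoot.mk_X, AdjoinRoot.mk_C, sub_eq_zero] at this
  rw [w, ← map_pow, this, map_sub (AdjoinRoot.of _), map_sub (algebraMap _ _), map_mul, map_mul,
    map_one, map_one]
  rfl

theorem eq_top_of_mem (S : IntermediateField k (CalHField a b)) (hx : x a b ∈ S) (hz : z a b ∈ S)
    (hw : w a b ∈ S) : S = ⊤ := by
  refine S.mem_of_algebraMap_fractionRing fun r => ?_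
  have hr : AdjoinRoot.root (X ^ 2 - C (1 - HRing.x a b * HRing.z a b) : (HRing a b)[X]) ∈
      S.toSubring.comap (algebraMap (CalHRing a b) (CalHField a b)) := hw
  refine AdjoinRoot.mem_of_root_mem _ (fun f => ?_) hr r
  have hf : S.comap (ofHField a b) = ⊤ := by
    refine HField.eq_top_of_mem _ ?_ ?_
    · change ofHField a b (HField.x a b) ∈ S
      rwa [ofHField_x]
    · change ofHField a b (HField.z a b) ∈ S
      rwa [ofHField_z]
  have hf' : algebraMap (HRing a b) (HField a b) f ∈ S.comap (ofHField a b) := by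
    rw [hf]; trivial
  change ofHField a b (algebraMap _ _ f) ∈ S at hf'
  rwa [ofHField_algebraMap] at hf'

theorem exists_lift (φ : HField a b →ₐ[k] M) (w' : M)
    (h : w' ^ 2 = 1 - φ (HField.x a b) * φ (HField.z a b)) :
    ∃ ψ : CalHField a b →ₐ[k] M, ψ.comp (ofHField a b) = φ ∧ ψ (w a b) = w' := by
  let i : HRing a b →ₐ[k] M := φ.comp (IsScalarTower.toAlgHom k (HRing a b) (HField a b))
  have hi : ∀ r, i r = φ (algebraMap _ _ r) := fun _ => rfl
  have h0 : eval₂ (i : HRing a b →+* M) w'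
      (X ^ 2 - C (1 - HRing.x a b * HRing.z a b) : (HRing a b)[X]) = 0 := by
    rw [eval₂_sub, eval₂_pow, eval₂_X, eval₂_C, h, sub_eq_zero, map_sub, map_mul, map_one]
    rfl
  have hinj : Function.Injective (AdjoinRoot.liftAlgHom _ i w' h0) := by
    refine AdjoinRoot.lift_injective (monic_X_pow_sub_C _ two_ne_zero)
      (AdjoinRoot.liftAlgHom _ i w' h0).toRingHom ?_
    intro p q hpq
    refine IsFractionRing.injective (HRing a b) (HField a b) (φ.toRingHom.injective ?_)
    simpa [hi] using hpq
  refine ⟨IsFractionRing.liftAlgHom hinj, ?_, ?_⟩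
  · refine algHom_eq_of_gen (s := {HField.x a b, HField.z a b})
      (fun S hS => HField.eq_top_of_mem S (hS (by simp)) (hS (by simp))) ?_
    rintro f (rfl | rfl)
    · rw [AlgHom.comp_apply, ofHField_x, IsFractionRing.liftAlgHom_apply, x,
        IsFractionRing.lift_algebraMap]
      simp [hi, HField.x]
    · rw [AlgHom.comp_apply, ofHField_z, IsFractionRing.liftAlgHom_apply, z,
        IsFractionRing.lift_algebraMap]
      simp [hi, HField.z]
  · rw [IsFractionRing.liftAlgHom_apply, w, IsFractionRing.lift_algebraMap]
    simp

/-- The lift to the double cover of the automorphism of order five that fixes `w`. -/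
theorem exists_scale {ζ : k} (hζ : ζ ^ 5 = 1) : ∃ α : CalHField a b ≃ₐ[k] CalHField a b,
    α (x a b) = algebraMap k _ ζ * x a b ∧ α (z a b) = algebraMap k _ ζ⁻¹ * z a b ∧
      α (w a b) = w a b := by
  have hζ0 : ζ ≠ 0 := by rintro rfl; norm_num at hζ
  obtain ⟨α₀, hx, hz⟩ := HField.exists_scale (a := a) (b := b) hζ
  have hm : algebraMap k (CalHField a b) ζ * algebraMap k (CalHField a b) ζ⁻¹ = 1 := by
    rw [← map_mul, mul_inv_cancel₀ hζ0, map_one]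
  obtain ⟨ψ, h1, h2⟩ := exists_lift ((ofHField a b).comp α₀.toAlgHom) (w a b) (by
    have e1 : (ofHField a b).comp α₀.toAlgHom (HField.x a b) = algebraMap k _ ζ * x a b := by
      change ofHField a b (α₀ _) = _
      rw [hx, map_mul, AlgHom.commutes, ofHField_x]
    have e2 : (ofHField a b).comp α₀.toAlgHom (HField.z a b) = algebraMap k _ ζ⁻¹ * z a b := by
      change ofHField a b (α₀ _) = _
      rw [hz, map_mul, AlgHom.commutes, ofHField_z]
    rw [e1, e2, mul_mul_mul_comm, hm, one_mul, w_sq])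
  have hψx : ψ (x a b) = algebraMap k _ ζ * x a b := by
    rw [← ofHField_x]
    have := DFunLike.congr_fun h1 (HField.x a b)
    change ψ (ofHField a b _) = ofHField a b (α₀ _) at this
    rw [this, hx, map_mul, AlgHom.commutes]
  have hψz : ψ (z a b) = algebraMap k _ ζ⁻¹ * z a b := by
    rw [← ofHField_z]
    have := DFunLike.congr_fun h1 (HField.z a b)
    change ψ (ofHField a b _) = ofHField a b (α₀ _) at this
    rw [this, hz, map_mul, AlgHom.commutes]
  refine ⟨AlgEquiv.ofBijective ψ ⟨ψ.toRingHom.injective,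
    AlgHom.surjective_of_gen (s := {x a b, z a b, w a b})
      (fun S hS => eq_top_of_mem S (hS (by simp)) (hS (by simp)) (hS (by simp))) ?_⟩,
      hψx, hψz, h2⟩
  rintro f (rfl | rfl | rfl)
  · refine ⟨algebraMap k _ ζ⁻¹ * x a b, ?_⟩
    rw [map_mul, AlgHom.commutes, hψx, ← mul_assoc, mul_comm (algebraMap k _ ζ⁻¹), hm, one_mul]
  · refine ⟨algebraMap k _ ζ * z a b, ?_⟩
    rw [map_mul, AlgHom.commutes, hψz, ← mul_assoc, hm, one_mul]
  · exact ⟨_, h2⟩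

theorem x_ne_zero : x a b ≠ 0 := by
  rw [← ofHField_x]
  exact (_root_.map_ne_zero _).2 HField.x_ne_zero

theorem transcendental_w : Transcendental k (w a b) := by
  intro h
  have h1 : IsAlgebraic k (ofHField a b (HField.x a b * HField.z a b)) := by
    have : ofHField a b (HField.x a b * HField.z a b) = 1 - w a b ^ 2 := by
      rw [w_sq, map_mul, ofHField_x, ofHField_z]
      ring
    rw [this]
    exact isAlgebraic_one.sub (h.pow 2)
  exact HField.transcendental_mul
    ((isAlgebraic_algHom_iff (ofHField a b) (ofHField a b).toRingHom.injective).1 h1)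

theorem w_ne_zero : w a b ≠ 0 := fun h => transcendental_w (by rw [h]; exact isAlgebraic_zero)

end CalHField

end Cover

/-! ### The hyperelliptic quotients -/

section Hyperelliptic

variable {k : Type*} [Field k] {a b : k} {L : Type*} [Field L] [Algebra k L]

theorem aeval_gHbar_one_sub_sq (w : L) :
    aeval (1 - w ^ 2) (gHbar a b) = w ^ 2 * aeval w (gCalHbar a b) := by
  rw [gHbar, gCalHbar, map_mul, aeval_comp]
  simp

theorem aeval_gE_sq (w : L) : aeval (w ^ 2) (gE a b) = aeval w (gCalHbar a b) := by
  rw [gCalHbar_eq, aeval_comp]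
  simp

theorem aeval_neg_gCalHbar (w : L) : aeval (-w) (gCalHbar a b) = aeval w (gCalHbar a b) := by
  rw [← aeval_gE_sq, ← aeval_gE_sq, neg_sq]

theorem transcendental_neg {x : L} (hx : Transcendental k x) : Transcendental k (-x) :=
  fun h => hx (by simpa using h.neg)

theorem transcendental_one_sub_sq {x : L} (hx : Transcendental k x) :
    Transcendental k (1 - x ^ 2) := fun h => hx.pow two_pos (by
  simpa using (isAlgebraic_one (R := k) (A := L)).sub h)

namespace CalHField

variable [IsDomain (HRing a b)] [IsDomain (CalHRing a b)] [CharZero k]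

theorem quotient_sq : (ofHField a b (HField.x a b ^ 5
      - aeval (HField.x a b * HField.z a b) (sumPoly a b) / 2) / w a b) ^ 2 =
    aeval (w a b) (gCalHbar a b) := by
  rw [div_pow, ← map_pow, HField.quotient_sq, ← aeval_algHom_apply, map_mul, ofHField_x,
    ofHField_z, show x a b * z a b = 1 - w a b ^ 2 by rw [w_sq]; ring, aeval_gHbar_one_sub_sq,
    mul_div_cancel_left₀ _ (pow_ne_zero 2 (w_ne_zero (a := a) (b := b)))]

theorem exists_quotientMap [IsDomain (QuadRing (gCalHbar a b))] :
    ∃ p : QuadField (gCalHbar a b) →ₐ[k] CalHField a b,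
      p (QuadField.x _) = w a b ∧
      p (QuadField.y _) = ofHField a b (HField.x a b ^ 5
        - aeval (HField.x a b * HField.z a b) (sumPoly a b) / 2) / w a b :=
  ⟨QuadField.lift _ _ quotient_sq transcendental_w, QuadField.lift_x _ _, QuadField.lift_y _ _⟩

theorem isQuotient [IsDomain (QuadRing (gCalHbar a b))] {ζ : k} (hζ : IsPrimitiveRoot ζ 5)
    {α : CalHField a b ≃ₐ[k] CalHField a b} (hαx : α (x a b) = algebraMap k _ ζ * x a b)
    (hαw : α (w a b) = w a b) {p : QuadField (gCalHbar a b) →ₐ[k] CalHField a b}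
    (hpx : p (QuadField.x _) = w a b)
    (hpy : p (QuadField.y _) = ofHField a b (HField.x a b ^ 5
        - aeval (HField.x a b * HField.z a b) (sumPoly a b) / 2) / w a b) :
    IsQuotient α p := by
  have hζ0 : ζ ≠ 0 := hζ.ne_zero (by norm_num)
  have hxz : x a b * z a b = 1 - w a b ^ 2 := by rw [w_sq]; ring
  have hpy' : p (QuadField.y _) =
      (x a b ^ 5 - aeval (1 - w a b ^ 2) (sumPoly a b) / 2) / w a b := by
    rw [hpy, map_sub (ofHField a b), map_div₀, ← aeval_algHom_apply, map_mul, map_pow,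
      ofHField_x, ofHField_z, hxz, map_ofNat]
  have hα : α (1 - w a b ^ 2) = 1 - w a b ^ 2 := by
    rw [map_sub α, map_one, map_pow, hαw]
  have hx5 : x a b ^ 5 = p (QuadField.y _ * QuadField.x _
      + aeval (1 - QuadField.x _ ^ 2) (sumPoly a b) / 2) := by
    rw [map_add, map_div₀, map_ofNat, ← aeval_algHom_apply, map_mul, map_sub p, map_one, map_pow,
      hpx, hpy', div_mul_cancel₀ _ w_ne_zero]
    ring
  refine isQuotient_of_kummer p α (by norm_num) hζ ?_ hαx hx5 fun S hS hxS => ?_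
  · have : (α : CalHField a b →ₐ[k] CalHField a b).comp p = p := by
      refine algHom_eq_of_gen isQuadratic_quadField.gen_set ?_
      rintro f (rfl | rfl)
      · simpa [hpx] using hαw
      · have h5 : α (x a b ^ 5) = x a b ^ 5 := by
          rw [map_pow, hαx, mul_pow, ← map_pow, hζ.pow_eq_one, map_one, one_mul]
        change α (p _) = p _
        rw [hpy', map_div₀, map_sub α, h5, map_div₀, AlgEquiv.apply_aeval_of_eq hα, map_ofNat, hαw]
    exact DFunLike.congr_fun this
  · have hw := hS (QuadField.x _)
    rw [hpx] at hw
    refine eq_top_of_mem S hxS ?_ hw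
    have := S.div_mem (sub_mem (one_mem S) (pow_mem hw 2)) hxS
    rwa [← hxz, mul_div_cancel_left₀ _ (x_ne_zero (a := a) (b := b))] at this

end CalHField

namespace QuadField

variable [IsDomain (QuadRing (gCalHbar a b))]

local notation "xx" => QuadField.x (gCalHbar a b)
local notation "yy" => QuadField.y (gCalHbar a b)

/-- The involutions `(w, r) ↦ (-w, ±r)`. -/
theorem exists_negX {y' : QuadField (gCalHbar a b)} (hy' : y' = yy ∨ y' = -yy) :
    ∃ τ : QuadField (gCalHbar a b) ≃ₐ[k] QuadField (gCalHbar a b), τ xx = -xx ∧ τ yy = y' := by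
  have h := isQuadratic_quadField (g := gCalHbar a b)
  have hy2 : y' ^ 2 = aeval (-xx) (gCalHbar a b) := by
    rw [aeval_neg_gCalHbar, ← h.sq]
    rcases hy' with rfl | rfl
    · rfl
    · rw [neg_sq]
  have hx := transcendental_neg h.transc
  refine ⟨AlgEquiv.ofBijective (lift (-xx) y' hy2 hx) ⟨(lift (-xx) y' hy2 hx).toRingHom.injective,
    AlgHom.surjective_of_gen h.gen_set ?_⟩, lift_x hy2 hx, lift_y hy2 hx⟩
  rintro f (rfl | rfl)
  · exact ⟨-xx, by rw [map_neg, lift_x, neg_neg]⟩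
  · rcases hy' with rfl | rfl
    · exact ⟨yy, lift_y hy2 hx⟩
    · exact ⟨-yy, by rw [map_neg, lift_y, neg_neg]⟩

theorem exists_mapHbar [IsDomain (QuadRing (gHbar a b))] :
    ∃ π : QuadField (gHbar a b) →ₐ[k] QuadField (gCalHbar a b),
      π (QuadField.x _) = 1 - xx ^ 2 ∧ π (QuadField.y _) = xx * yy := by
  have h := isQuadratic_quadField (g := gCalHbar a b)
  exact ⟨lift (1 - xx ^ 2) (xx * yy) (by rw [aeval_gHbar_one_sub_sq, mul_pow, h.sq])
    (transcendental_one_sub_sq h.transc), lift_x _ _, lift_y _ _⟩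

theorem exists_mapE [IsDomain (QuadRing (gE a b))] :
    ∃ q : QuadField (gE a b) →ₐ[k] QuadField (gCalHbar a b),
      q (QuadField.x _) = xx ^ 2 ∧ q (QuadField.y _) = yy := by
  have h := isQuadratic_quadField (g := gCalHbar a b)
  exact ⟨lift (xx ^ 2) yy (by rw [aeval_gE_sq, h.sq]) (h.transc.pow two_pos), lift_x _ _,
    lift_y _ _⟩

variable [CharZero k]

/-- A subfield fixed by an involution `w ↦ -w` is the fixed field as soon as it contains `w²` and
generates the function field together with `w`. -/
theorem isInvolutionQuotient_of_negX {g : k[X]} [IsDomain (QuadRing g)]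
    {π : QuadField g →ₐ[k] QuadField (gCalHbar a b)}
    {τ : QuadField (gCalHbar a b) ≃ₐ[k] QuadField (gCalHbar a b)} (hτx : τ xx = -xx)
    (hτy : τ yy = yy ∨ τ yy = -yy) (hx : τ (π (QuadField.x g)) = π (QuadField.x g))
    (hy : τ (π (QuadField.y g)) = π (QuadField.y g)) (c : QuadField g) (hc : xx ^ 2 = π c)
    (hyS : ∀ S : IntermediateField k (QuadField (gCalHbar a b)), xx ∈ S → π (QuadField.y g) ∈ S →
      yy ∈ S) : IsInvolutionQuotient π τ := by
  have h := isQuadratic_quadField (g := gCalHbar a b)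
  have : CharZero (QuadField (gCalHbar a b)) :=
    charZero_of_injective_algebraMap (algebraMap k _).injective
  refine ⟨isQuotient_of_kummer π τ two_ne_zero (IsPrimitiveRoot.neg_one 0 (by norm_num)) ?_
    (by rw [hτx, map_neg, map_one, neg_one_mul]) hc fun S hS hxS => ?_, ?_, xx, ?_⟩
  · have : (τ : QuadField (gCalHbar a b) →ₐ[k] QuadField (gCalHbar a b)).comp π = π := by
      refine algHom_eq_of_gen isQuadratic_quadField.gen_set ?_
      rintro f (rfl | rfl)
      · exact hx
      · exact hy
    exact DFunLike.congr_fun this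
  · exact h.gen S hxS (hyS S hxS (hS _))
  · have : (τ : QuadField (gCalHbar a b) →ₐ[k] QuadField (gCalHbar a b)).comp
        (τ : QuadField (gCalHbar a b) →ₐ[k] QuadField (gCalHbar a b)) = AlgHom.id k _ := by
      refine algHom_eq_of_gen h.gen_set ?_
      rintro f (rfl | rfl)
      · simp [hτx]
      · rcases hτy with hτy | hτy <;> simp [hτy]
    exact DFunLike.congr_fun this
  · rw [hτx]
    intro h0
    have : 2 * xx = 0 := by linear_combination -h0
    exact h.x_ne_zero (by simpa using this)

theorem isInvolutionQuotient_mapHbar [IsDomain (QuadRing (gHbar a b))]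
    {π : QuadField (gHbar a b) →ₐ[k] QuadField (gCalHbar a b)}
    (hπx : π (QuadField.x _) = 1 - xx ^ 2) (hπy : π (QuadField.y _) = xx * yy)
    {σ : QuadField (gCalHbar a b) ≃ₐ[k] QuadField (gCalHbar a b)} (hσx : σ xx = -xx)
    (hσy : σ yy = -yy) : IsInvolutionQuotient π σ := by
  have h := isQuadratic_quadField (g := gCalHbar a b)
  refine isInvolutionQuotient_of_negX hσx (.inr hσy) ?_ ?_ (1 - QuadField.x _) ?_ ?_
  · rw [hπx, map_sub, map_one, map_pow, hσx, neg_sq]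
  · rw [hπy, map_mul, hσx, hσy, neg_mul_neg]
  · rw [map_sub, map_one, hπx, sub_sub_cancel]
  · intro S hxS hS
    have := S.div_mem hS hxS
    rwa [hπy, mul_div_cancel_left₀ _ h.x_ne_zero] at this

theorem isInvolutionQuotient_mapE [IsDomain (QuadRing (gE a b))]
    {q : QuadField (gE a b) →ₐ[k] QuadField (gCalHbar a b)}
    (hqx : q (QuadField.x _) = xx ^ 2) (hqy : q (QuadField.y _) = yy)
    {τ : QuadField (gCalHbar a b) ≃ₐ[k] QuadField (gCalHbar a b)} (hτx : τ xx = -xx)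
    (hτy : τ yy = yy) : IsInvolutionQuotient q τ := by
  refine isInvolutionQuotient_of_negX hτx (.inl hτy) ?_ ?_ (QuadField.x _) hqx.symm ?_
  · rw [hqx, map_pow, hτx, neg_sq]
  · rw [hqy, hτy]
  · intro S _ hS
    rwa [hqy] at hS

end QuadField

end Hyperelliptic

namespace FunctionField

/-! ### Principal divisors -/

section Principal

variable {K F L : Type*} [Field K] [Field F] [Field L] [Algebra K F] [Algebra K L]

theorem mem_principalDivisors_iff [DiscretePlaces K L] {D : Divisor K L} :
    D ∈ principalDivisors K L ↔ ∃ f : L, f ≠ 0 ∧ ∀ v : Place K L, D v = v.ord f := by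
  refine ⟨fun hD => ?_, fun hD => AddSubgroup.subset_closure hD⟩
  induction hD using AddSubgroup.closure_induction with
  | mem D hD => exact hD
  | zero => exact ⟨1, one_ne_zero, fun v => by rw [v.ord_one, Finsupp.zero_apply]⟩
  | add D D' _ _ h h' =>
    obtain ⟨f, hf, h⟩ := h
    obtain ⟨f', hf', h'⟩ := h'
    exact ⟨f * f', mul_ne_zero hf hf', fun v => by rw [Finsupp.add_apply, h, h', v.ord_mul hf hf']⟩
  | neg D _ h =>
    obtain ⟨f, hf, h⟩ := h
    exact ⟨f⁻¹, inv_ne_zero hf, fun v => by rw [Finsupp.neg_apply, h, v.ord_inv]⟩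

theorem IsInvolutionQuotient.pullback_mem_principalDivisors [CharZero K] [DiscretePlaces K F]
    [DiscretePlaces K L] [RationalPlaces K L] {φ : F →ₐ[K] L} {τ : L ≃ₐ[K] L}
    (h : IsInvolutionQuotient φ τ) {D : Divisor K F} (hD : D ∈ principalDivisors K F) :
    pullback φ D ∈ principalDivisors K L := by
  obtain ⟨f, hf, hD⟩ := mem_principalDivisors_iff.1 hD
  refine mem_principalDivisors_iff.2 ⟨φ f, by simpa using hf, fun v => ?_⟩
  rw [h.pullback_apply, hD, h.ord_map v hf, mul_comm]

theorem Place.aeval_sub_mem_nonunits (v : Place K L) {f : L} {c : K}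
    (h : f - algebraMap K L c ∈ v.1.nonunits) (p : K[X]) :
    aeval f p - algebraMap K L (p.eval c) ∈ v.1.nonunits := by
  obtain ⟨q, hq⟩ := X_sub_C_dvd_sub_C_eval (a := c) (p := p)
  have := congrArg (aeval f) hq
  rw [map_sub, map_mul, map_sub, aeval_C, aeval_C, aeval_X, mul_comm] at this
  rw [this]
  exact v.mul_mem_nonunits (v.aeval_mem (v.mem_of_sub_mem_nonunits h) q) h

theorem Place.aeval_mem_nonunits_iff (v : Place K L) {f : L} {c : K}
    (h : f - algebraMap K L c ∈ v.1.nonunits) (p : K[X]) :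
    aeval f p ∈ v.1.nonunits ↔ p.eval c = 0 := by
  have h1 := v.aeval_sub_mem_nonunits h p
  constructor
  · intro h2
    exact (v.eq_of_sub_mem_nonunits (c := 0) (by simpa using h2) h1).symm
  · intro h2
    simpa [h2] using h1

end Principal

/-! ### Places of the projective line -/

section Line

variable {K F : Type*} [Field K] [Field F] [Algebra K F] {u : F}

/-- A function field `K(u)` has just one place at which `u` vanishes, the local ring of `K[u]` at
the origin. -/
theorem Place.eq_of_generator [DiscretePlaces K F] (hu : IntermediateField.adjoin K {u} = ⊤)
    {v v' : Place K F} (h : u ∈ v.1.nonunits) (h' : u ∈ v'.1.nonunits) : v = v' := by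
  refine Place.ext_le fun f hf => ?_
  have hfu : f ∈ IntermediateField.adjoin K {u} := by rw [hu]; trivial
  obtain ⟨r, s, rfl⟩ := (IntermediateField.mem_adjoin_simple_iff K f).1 hfu
  by_cases h0 : aeval u s = 0
  · rw [h0, div_zero]; exact v'.1.zero_mem
  have hs0 : s ≠ 0 := by rintro rfl; simp at h0
  obtain ⟨c, r', s', hc0, hs'0, rfl, rfl, a, b, hab⟩ := exists_eq_mul_isCoprime r hs0
  rw [map_mul] at h0
  rw [map_mul, map_mul, mul_div_mul_left _ _ (left_ne_zero_of_mul h0)] at hf ⊢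
  have hu0 : ∀ {w : Place K F}, u ∈ w.1.nonunits → u - algebraMap K F 0 ∈ w.1.nonunits := by
    intro w hw
    simpa using hw
  have hs' : s'.eval 0 ≠ 0 := by
    intro hs
    have h1 := (v.aeval_mem_nonunits_iff (hu0 h) s').2 hs
    have h2 := v.mul_mem_nonunits hf h1
    rw [div_mul_cancel₀ _ (right_ne_zero_of_mul h0), v.aeval_mem_nonunits_iff (hu0 h)] at h2
    have h3 := congrArg (eval 0) hab
    simp [hs, h2] at h3
  rw [div_eq_mul_inv]
  exact v'.1.mul_mem _ _ (v'.aeval_mem (v'.mem_of_nonunit h') r') (v'.inv_mem_of_notMem_nonunits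
    fun h1 => hs' ((v'.aeval_mem_nonunits_iff (hu0 h') s').1 h1))

/-- The order of every function in `K(u)` at the zero of `u` is a multiple of the order of `u`. -/
theorem Place.ord_generator [DiscretePlaces K F] (hu : IntermediateField.adjoin K {u} = ⊤)
    (hu0 : u ≠ 0) {v : Place K F} (h : u ∈ v.1.nonunits) : v.ord u = 1 := by
  have hpos := (v.ord_pos_iff hu0).2 h
  have h' : u - algebraMap K F 0 ∈ v.1.nonunits := by simpa using h
  have key : ∀ p : K[X], aeval u p ≠ 0 → v.ord u ∣ v.ord (aeval u p) := by
    intro p hp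
    have hp0 : p ≠ 0 := by rintro rfl; simp at hp
    obtain ⟨q, hq, hqd⟩ := exists_eq_pow_rootMultiplicity_mul_and_not_dvd p hp0 0
    rw [hq, map_mul, map_pow, map_sub, aeval_X, aeval_C, map_zero, sub_zero] at hp ⊢
    rw [dvd_iff_isRoot, IsRoot.def, ← v.aeval_mem_nonunits_iff h'] at hqd
    rw [v.ord_mul (left_ne_zero_of_mul hp) (right_ne_zero_of_mul hp), v.ord_pow hu0,
      v.ord_eq_zero (v.aeval_mem (v.mem_of_nonunit h) q) hqd, add_zero]
    exact dvd_mul_left _ _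
  obtain ⟨f, hf0, hf1⟩ := v.exists_ord_eq_one
  have hfu : f ∈ IntermediateField.adjoin K {u} := by rw [hu]; trivial
  obtain ⟨r, s, rfl⟩ := (IntermediateField.mem_adjoin_simple_iff K f).1 hfu
  obtain ⟨hr, hs⟩ := div_ne_zero_iff.1 hf0
  rw [div_eq_mul_inv, v.ord_mul hr (inv_ne_zero hs), v.ord_inv] at hf1
  have h1 : v.ord u ∣ 1 := by
    rw [← hf1, ← sub_eq_add_neg]
    exact dvd_sub (key r hr) (key s hs)
  exact Int.eq_one_of_dvd_one hpos.le h1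

local notation "TT" => algebraMap K[X] (FractionRing K[X]) X

theorem adjoin_X_eq_top {u : FractionRing K[X]} (h : TT ∈ IntermediateField.adjoin K {u}) :
    IntermediateField.adjoin K {u} = ⊤ := by
  refine IntermediateField.mem_of_algebraMap_fractionRing _ fun p => ?_
  have h1 := (IsScalarTower.toAlgHom K K[X] (FractionRing K[X])).apply_eq_aeval p
  change algebraMap _ _ p = aeval (algebraMap K[X] (FractionRing K[X]) X) p at h1
  rw [h1]
  exact IntermediateField.aeval_mem _ h p

theorem adjoin_X_sub (c : K) : IntermediateField.adjoin K {TT - algebraMap K _ c} = ⊤ := by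
  apply adjoin_X_eq_top
  have := add_mem (IntermediateField.mem_adjoin_simple_self K (TT - algebraMap K _ c))
    (IntermediateField.algebraMap_mem _ c)
  rwa [sub_add_cancel] at this

theorem adjoin_X_inv : IntermediateField.adjoin K {(TT)⁻¹} = ⊤ := by
  apply adjoin_X_eq_top
  simpa using inv_mem (IntermediateField.mem_adjoin_simple_self K (TT)⁻¹)

theorem transcendental_X : Transcendental K TT := by
  rw [transcendental_iff_injective]
  intro p q hpq
  have h1 := (IsScalarTower.toAlgHom K K[X] (FractionRing K[X])).apply_eq_aeval
  change ∀ p, algebraMap _ _ p = aeval (algebraMap K[X] (FractionRing K[X]) X) p at h1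
  rw [← h1, ← h1] at hpq
  exact IsFractionRing.injective _ _ hpq

theorem X_sub_ne_zero (c : K) : TT - algebraMap K _ c ≠ 0 := by
  intro h
  refine transcendental_X (K := K) ?_
  rw [sub_eq_zero.1 h]
  exact isAlgebraic_algebraMap c

theorem algebraMap_X_ne_zero : TT ≠ 0 := by
  have := X_sub_ne_zero (K := K) 0
  rwa [map_zero, sub_zero] at this

theorem X_inv_ne_zero : (TT)⁻¹ ≠ 0 := inv_ne_zero algebraMap_X_ne_zero

instance finiteDimensional_fractionRing :
    FiniteDimensional (IntermediateField.adjoin K {TT}) (FractionRing K[X]) := by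
  refine FiniteDimensional.of_finrank_pos ?_
  rw [IntermediateField.finrank_eq_one_iff_eq_top.2
    (adjoin_X_eq_top (IntermediateField.mem_adjoin_simple_self K _))]
  exact one_pos

instance discretePlaces_fractionRing [CharZero K] : DiscretePlaces K (FractionRing K[X]) :=
  discretePlaces_of_finite transcendental_X

instance rationalPlaces_fractionRing [IsAlgClosed K] : RationalPlaces K (FractionRing K[X]) :=
  rationalPlaces_of_finite TT

/-- Any two points of the projective line are linearly equivalent. -/
theorem single_sub_single_mem_principalDivisors [CharZero K] [IsAlgClosed K]
    (u u' : Place K (FractionRing K[X])) :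
    Finsupp.single u 1 - Finsupp.single u' 1 ∈ principalDivisors K (FractionRing K[X]) := by
  classical
  -- the point at infinity; a point `c` is compared with it by means of the function `X - c`
  obtain ⟨w, hw⟩ := exists_place_of_transcendental (K := K) (x := (TT)⁻¹)
    fun h => transcendental_X (by simpa using h.inv)
  have key : ∀ u, Finsupp.single u 1 - Finsupp.single w 1 ∈
      principalDivisors K (FractionRing K[X]) := by
    intro u
    by_cases hu : TT ∈ u.1
    · obtain ⟨c, hc⟩ := RationalPlaces.exists_sub_mem u _ hu
      refine mem_principalDivisors_iff.2 ⟨_, X_sub_ne_zero c, fun v => ?_⟩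
      have hwT : TT ∉ w.1 := by
        have := (w.1.inv_mem_nonunits_iff).1 hw
        exact this.resolve_left (algebraMap_X_ne_zero)
      rw [Finsupp.sub_apply, Finsupp.single_apply, Finsupp.single_apply]
      by_cases hv : TT ∈ v.1
      · have hvw : w ≠ v := by rintro rfl; exact hwT hv
        rw [if_neg hvw]
        by_cases hvc : TT - algebraMap K _ c ∈ v.1.nonunits
        · rw [if_pos (Place.eq_of_generator (adjoin_X_sub c) hc hvc),
            v.ord_generator (adjoin_X_sub c) (X_sub_ne_zero c) hvc]
          rfl
        · rw [if_neg (by rintro rfl; exact hvc hc),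
            v.ord_eq_zero (sub_mem hv (v.algebraMap_mem c)) hvc]
          rfl
      · have hvi := v.inv_mem_nonunits hv
        rw [if_neg (by rintro rfl; exact hv hu),
          if_pos (Place.eq_of_generator adjoin_X_inv hw hvi)]
        have h1 := v.ord_generator adjoin_X_inv X_inv_ne_zero hvi
        rw [v.ord_inv] at h1
        have h2 : TT ≠ 0 := algebraMap_X_ne_zero
        rw [sub_eq_add_neg TT, v.ord_add_of_lt h2]
        · lia
        · by_cases hc0 : c = 0
          · left; rw [hc0, map_zero, neg_zero]
          · right; rw [v.ord_neg, v.ord_algebraMap hc0]; lia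
    · rw [Place.eq_of_generator adjoin_X_inv hw (u.inv_mem_nonunits hu), sub_self]
      exact zero_mem _
  have := sub_mem (key u) (key u')
  rwa [sub_sub_sub_cancel_right] at this

end Line

/-! ### Places of a quadratic function field -/

namespace IsQuadratic

variable {K L : Type*} [Field K] [Field L] [Algebra K L] [CharZero K] {g : K[X]} {x y : L}
  (h : IsQuadratic g x y) {ι : L ≃ₐ[K] L} (hιx : ι x = x) (hιy : ι y = -y)

include h hιx hιy

/-- The places with given abscissa `c` are exchanged by the hyperelliptic involution. -/
theorem eq_or_eq_transport {v v' : Place K L} {c : K} (hv : x - algebraMap K L c ∈ v.1.nonunits)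
    (hv' : x - algebraMap K L c ∈ v'.1.nonunits) : v' = v ∨ v' = v.transport ι := by
  have := h.discretePlaces
  obtain ⟨φ, hφ⟩ := h.exists_fractionRing_map
  have hq := h.isInvolutionQuotient hιx hιy hφ
  refine hq.eq_or_eq_transport (Place.eq_of_generator (adjoin_X_sub c) ?_ ?_) <;>
    rwa [hq.mem_nonunits_below, map_sub, hφ, AlgHom.commutes]

theorem eq_or_eq_transport_of_notMem {v v' : Place K L} (hv : x ∉ v.1) (hv' : x ∉ v'.1) :
    v' = v ∨ v' = v.transport ι := by
  have := h.discretePlaces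
  obtain ⟨φ, hφ⟩ := h.exists_fractionRing_map
  have hq := h.isInvolutionQuotient hιx hιy hφ
  refine hq.eq_or_eq_transport (Place.eq_of_generator adjoin_X_inv ?_ ?_)
  · rw [hq.mem_nonunits_below, map_inv₀, hφ]
    exact v'.inv_mem_nonunits hv'
  · rw [hq.mem_nonunits_below, map_inv₀, hφ]
    exact v.inv_mem_nonunits hv

variable [IsAlgClosed K]

/-- The hyperelliptic class: all divisors `v + ι v` are linearly equivalent. -/
theorem add_transport_sub_mem_principalDivisors (v v' : Place K L) :
    Finsupp.single v 1 + Finsupp.single (v.transport ι) 1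
      - (Finsupp.single v' 1 + Finsupp.single (v'.transport ι) 1) ∈ principalDivisors K L := by
  have := h.discretePlaces
  have := h.rationalPlaces
  obtain ⟨φ, hφ⟩ := h.exists_fractionRing_map
  have hq := h.isInvolutionQuotient hιx hιy hφ
  rw [← hq.pullback_single_below, ← hq.pullback_single_below, ← map_sub]
  exact hq.pullback_mem_principalDivisors (single_sub_single_mem_principalDivisors _ _)

/-- The function `x - c` is a local parameter on the line, and the order of its pull-back is the
ramification index. -/
theorem ord_sub {v : Place K L} {c : K} (hv : x - algebraMap K L c ∈ v.1.nonunits) :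
    (v.transport ι ≠ v → v.ord (x - algebraMap K L c) = 1) ∧
      (v.transport ι = v → v.ord (x - algebraMap K L c) = 2) := by
  have := h.discretePlaces
  have := h.rationalPlaces
  obtain ⟨φ, hφ⟩ := h.exists_fractionRing_map
  have hq := h.isInvolutionQuotient hιx hιy hφ
  have h1 : φ (algebraMap K[X] _ X - algebraMap K _ c) = x - algebraMap K L c := by
    rw [map_sub, hφ, AlgHom.commutes]
  have h2 := hq.ord_map v (X_sub_ne_zero c)
  rw [(hq.below v).ord_generator (adjoin_X_sub c) (X_sub_ne_zero c)
    (by rwa [hq.mem_nonunits_below, h1]), h1, mul_one] at h2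
  rw [h2]
  exact ⟨fun hne => by rw [hq.ramificationIndex_of_ne hne]; rfl,
    fun heq => by rw [hq.ramificationIndex_of_eq heq]; rfl⟩

theorem ord_of_notMem {v : Place K L} (hv : x ∉ v.1) :
    (v.transport ι ≠ v → v.ord x = -1) ∧ (v.transport ι = v → v.ord x = -2) := by
  have := h.discretePlaces
  have := h.rationalPlaces
  obtain ⟨φ, hφ⟩ := h.exists_fractionRing_map
  have hq := h.isInvolutionQuotient hιx hιy hφ
  have h1 : φ (algebraMap K[X] _ X)⁻¹ = x⁻¹ := by rw [map_inv₀, hφ]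
  have h2 := hq.ord_map v (X_inv_ne_zero (K := K))
  rw [(hq.below v).ord_generator adjoin_X_inv X_inv_ne_zero
    (by rw [hq.mem_nonunits_below, h1]; exact v.inv_mem_nonunits hv), h1, mul_one, v.ord_inv] at h2
  constructor
  · intro hne
    rw [hq.ramificationIndex_of_ne hne] at h2
    lia
  · intro heq
    rw [hq.ramificationIndex_of_eq heq] at h2
    lia

/-- If `g` has odd degree, the place at infinity is a branch point. -/
theorem transport_eq_of_notMem (hg : Odd g.natDegree) {v : Place K L} (hv : x ∉ v.1) :
    v.transport ι = v := by
  have := h.discretePlaces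
  by_contra hne
  have h1 := (h.ord_of_notMem hιx hιy hv).1 hne
  have hg0 : g ≠ 0 := by rintro rfl; simp at hg
  obtain ⟨-, h2⟩ := v.ord_aeval_of_notMem hv hg0
  rw [← h.sq, v.ord_pow h.y_ne_zero, h1] at h2
  obtain ⟨m, hm⟩ := hg
  lia

/-- The orders of the coordinate functions at the single place at infinity. -/
theorem ord_of_odd (hg : Odd g.natDegree) {v : Place K L} (hv : x ∉ v.1) :
    v.ord x = -2 ∧ v.ord y = -g.natDegree := by
  have := h.discretePlaces
  have h1 := (h.ord_of_notMem hιx hιy hv).2 (h.transport_eq_of_notMem hιx hιy hg hv)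
  have hg0 : g ≠ 0 := by rintro rfl; simp at hg
  obtain ⟨-, h2⟩ := v.ord_aeval_of_notMem hv hg0
  rw [← h.sq, v.ord_pow h.y_ne_zero, h1] at h2
  exact ⟨h1, by lia⟩

/-- The zeros of `y` are branch points. -/
theorem transport_eq_of_mem_nonunits (hg : Squarefree g) {v : Place K L} {c : K}
    (hv : x - algebraMap K L c ∈ v.1.nonunits) (hy : y ∈ v.1.nonunits) : v.transport ι = v := by
  have := h.discretePlaces
  by_contra hne
  have h1 := (h.ord_sub hιx hιy hv).1 hne
  have h2 : aeval x g ∈ v.1.nonunits := by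
    rw [← h.sq, pow_two]
    exact v.mul_mem_nonunits (v.mem_of_nonunit hy) hy
  rw [v.aeval_mem_nonunits_iff hv, ← IsRoot.def, ← dvd_iff_isRoot] at h2
  obtain ⟨q, rfl⟩ := h2
  have hq : aeval x q ∉ v.1.nonunits := by
    rw [v.aeval_mem_nonunits_iff hv, ← IsRoot.def, ← dvd_iff_isRoot]
    rintro ⟨r, rfl⟩
    exact not_isUnit_X_sub_C c (hg _ ⟨r, by ring⟩)
  have hq0 : aeval x q ≠ 0 := fun h0 => hq (by rw [h0]; exact zero_mem _)
  have hx0 : x - algebraMap K L c ≠ 0 := fun h0 => by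
    rw [h0] at h1
    have := v.ord_inv 0
    rw [inv_zero] at this
    lia
  have h3 := congrArg v.ord h.sq
  rw [map_mul, map_sub, aeval_X, aeval_C, v.ord_mul hx0 hq0, h1,
    v.ord_eq_zero (v.aeval_mem (v.mem_of_sub_mem_nonunits hv) q) hq, v.ord_pow h.y_ne_zero] at h3
  lia

omit [IsAlgClosed K] h hιx in
/-- Points with `y ≠ 0` are not branch points. -/
theorem transport_ne_of_notMem_nonunits {v : Place K L} {d : K}
    (hy : y - algebraMap K L d ∈ v.1.nonunits) (hd : d ≠ 0) : v.transport ι ≠ v := by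
  intro hv
  have h1 : y - algebraMap K L d ∈ (v.transport ι).1.nonunits := by rwa [hv]
  rw [Place.mem_nonunits_transport, map_sub, hιy, AlgEquiv.commutes] at h1
  refine v.algebraMap_notMem_nonunits (c := -(2 * d)) (by simpa using hd) ?_
  have := add_mem hy h1
  convert this using 1
  rw [map_neg, map_mul, map_ofNat]
  ring

end IsQuadratic

end FunctionField

/-! ### The function field of a Weierstrass curve -/

namespace WeierstrassFunctionField

section Lift

variable {k : Type*} [Field k] {W : WeierstrassCurve k} {M : Type*} [Field M] [Algebra k M]

theorem eval₂_polynomial {M : Type*} [CommRing M] [Algebra k M] (x y : M) :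
    eval₂ ((aeval x : k[X] →ₐ[k] M) : k[X] →+* M) y W.toAffine.polynomial =
      y ^ 2 + algebraMap k M W.a₁ * x * y + algebraMap k M W.a₃ * y
        - (x ^ 3 + algebraMap k M W.a₂ * x ^ 2 + algebraMap k M W.a₄ * x
          + algebraMap k M W.a₆) := by
  simp [WeierstrassCurve.Affine.polynomial, eval₂_sub, eval₂_add, eval₂_mul, eval₂_pow]
  ring

theorem aeval_x (p : k[X]) : aeval (x W) p = algebraMap W.toAffine.CoordinateRing
    W.toAffine.FunctionField (AdjoinRoot.of W.toAffine.polynomial p) :=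
  (((IsScalarTower.toAlgHom k W.toAffine.CoordinateRing W.toAffine.FunctionField).comp
    (IsScalarTower.toAlgHom k k[X] W.toAffine.CoordinateRing)).apply_eq_aeval p).symm

theorem equation : y W ^ 2 + algebraMap k _ W.a₁ * x W * y W + algebraMap k _ W.a₃ * y W =
    x W ^ 3 + algebraMap k _ W.a₂ * x W ^ 2 + algebraMap k _ W.a₄ * x W + algebraMap k _ W.a₆ := by
  rw [← sub_eq_zero, ← eval₂_polynomial]
  have h2 : ((aeval (x W) : k[X] →ₐ[k] W.toAffine.FunctionField) : k[X] →+* _) =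
      (algebraMap W.toAffine.CoordinateRing W.toAffine.FunctionField).comp
        (AdjoinRoot.of W.toAffine.polynomial) := RingHom.ext aeval_x
  have h3 : y W = algebraMap W.toAffine.CoordinateRing W.toAffine.FunctionField
    (AdjoinRoot.root W.toAffine.polynomial) := rfl
  rw [h2, h3, ← hom_eval₂, AdjoinRoot.eval₂_root, map_zero]

theorem of_injective : Function.Injective (AdjoinRoot.of W.toAffine.polynomial) := by
  apply AdjoinRoot.of.injective_of_degree_ne_zero
  rw [WeierstrassCurve.Affine.degree_polynomial]
  norm_num

theorem transcendental_x : Transcendental k (x W) := by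
  rw [transcendental_iff_injective]
  intro p q hpq
  rw [aeval_x, aeval_x] at hpq
  exact of_injective (IsFractionRing.injective _ _ hpq)

theorem eq_top_of_mem (S : IntermediateField k W.toAffine.FunctionField) (hx : x W ∈ S)
    (hy : y W ∈ S) : S = ⊤ := by
  refine S.mem_of_algebraMap_fractionRing fun r => ?_
  have hr : AdjoinRoot.root W.toAffine.polynomial ∈ S.toSubring.comap
      (algebraMap W.toAffine.CoordinateRing W.toAffine.FunctionField) := hy
  refine AdjoinRoot.mem_of_root_mem _ (fun p => ?_) hr r
  have := S.aeval_mem hx p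
  rwa [aeval_x] at this

/-- The map out of the function field of a Weierstrass curve given by a solution `(x', y')` of
the Weierstrass equation with `x'` transcendental. -/
theorem exists_lift {x' y' : M} (hx : Transcendental k x')
    (h : y' ^ 2 + algebraMap k _ W.a₁ * x' * y' + algebraMap k _ W.a₃ * y' =
      x' ^ 3 + algebraMap k _ W.a₂ * x' ^ 2 + algebraMap k _ W.a₄ * x' + algebraMap k _ W.a₆) :
    ∃ φ : W.toAffine.FunctionField →ₐ[k] M, φ (x W) = x' ∧ φ (y W) = y' := by
  have h0 : eval₂ ((aeval x' : k[X] →ₐ[k] M) : k[X] →+* M) y' W.toAffine.polynomial = 0 := by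
    rw [eval₂_polynomial, h, sub_self]
  have hinj : Function.Injective
      (AdjoinRoot.liftAlgHom W.toAffine.polynomial (aeval x') y' h0) := by
    refine AdjoinRoot.lift_injective WeierstrassCurve.Affine.monic_polynomial
      (AdjoinRoot.liftAlgHom W.toAffine.polynomial (aeval x') y' h0).toRingHom ?_
    intro p q hpq
    apply transcendental_iff_injective.1 hx
    simpa using hpq
  refine ⟨IsFractionRing.liftAlgHom hinj, ?_, ?_⟩
  · rw [IsFractionRing.liftAlgHom_apply, x, IsFractionRing.lift_algebraMap]
    simp [WeierstrassCurve.Affine.CoordinateRing.mk]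
  · rw [IsFractionRing.liftAlgHom_apply, y, IsFractionRing.lift_algebraMap]
    simp [WeierstrassCurve.Affine.CoordinateRing.mk]

theorem natDegree_twoTorsionPolynomial [CharZero k] :
    W.twoTorsionPolynomial.toPoly.natDegree = 3 :=
  Cubic.natDegree_of_a_ne_zero (by simp [WeierstrassCurve.twoTorsionPolynomial])

theorem odd_natDegree [CharZero k] : Odd W.twoTorsionPolynomial.toPoly.natDegree := by
  rw [natDegree_twoTorsionPolynomial]
  decide

/-- Completing the square in the Weierstrass equation. -/
theorem isQuadratic [CharZero k] : IsQuadratic W.twoTorsionPolynomial.toPoly (x W)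
    (2 * y W + algebraMap k _ W.a₁ * x W + algebraMap k _ W.a₃) := by
  refine IsQuadratic.of_odd_natDegree transcendental_x ?_ (fun S hx hY => ?_) odd_natDegree
  · simp only [Cubic.toPoly, WeierstrassCurve.twoTorsionPolynomial, WeierstrassCurve.b₂,
      WeierstrassCurve.b₄, WeierstrassCurve.b₆, map_add, map_mul, map_pow, aeval_C, aeval_X,
      map_ofNat]
    linear_combination 4 * equation (W := W)
  · refine eq_top_of_mem S hx ?_
    have : CharZero W.toAffine.FunctionField :=
      charZero_of_injective_algebraMap (algebraMap k _).injective
    have := S.div_mem (sub_mem (sub_mem hY (mul_mem (S.algebraMap_mem W.a₁) hx))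
      (S.algebraMap_mem W.a₃)) (ofNat_mem S 2)
    convert this using 1
    field_simp
    ring

end Lift

section Squarefree

variable {K : Type*} [Field K] [CharZero K] [IsAlgClosed K] {W : WeierstrassCurve K}
  (hΔ : W.Δ ≠ 0)

include hΔ

theorem squarefree_twoTorsionPolynomial : Squarefree W.twoTorsionPolynomial.toPoly := by
  apply Separable.squarefree
  rw [Polynomial.Separable, Polynomial.isCoprime_iff_aeval_ne_zero_of_isAlgClosed K K]
  intro c
  by_contra! h
  obtain ⟨h1, h2⟩ := h
  simp only [Cubic.toPoly, WeierstrassCurve.twoTorsionPolynomial, WeierstrassCurve.b₂,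
    WeierstrassCurve.b₄, WeierstrassCurve.b₆, coe_aeval_eq_eval, eval_add, eval_mul, eval_C,
    eval_pow, eval_X, derivative_add, derivative_mul, derivative_C, derivative_X_pow,
    derivative_X] at h1 h2
  norm_num at h1 h2
  have h3 : W.toAffine.Equation c (-(W.a₁ * c + W.a₃) / 2) := by
    rw [WeierstrassCurve.Affine.equation_iff]
    linear_combination (-1 / 4 : K) * h1
  have h4 := (WeierstrassCurve.Affine.equation_iff_nonsingular_of_Δ_ne_zero hΔ).1 h3
  rw [WeierstrassCurve.Affine.nonsingular_iff] at h4
  rcases h4.2 with h | h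
  · apply h
    linear_combination (-1 / 4 : K) * h2
  · apply h
    ring

end Squarefree

/-! ### Places and points of an elliptic curve -/

section Points

variable {K : Type*} [Field K] [CharZero K] [IsAlgClosed K] {W : WeierstrassCurve K}

local notation "MM" => W.toAffine.FunctionField

omit [IsAlgClosed K] in
theorem y_mem {v : Place K MM} (hv : x W ∈ v.1) : y W ∈ v.1 := by
  have : CharZero MM := charZero_of_injective_algebraMap (algebraMap K _).injective
  have h1 : 2 * y W + algebraMap K _ W.a₁ * x W + algebraMap K _ W.a₃ ∈ v.1 :=
    v.mem_of_pow_mem two_ne_zero (by rw [isQuadratic.sq]; exact v.aeval_mem hv _)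
  have h2 := v.1.mul_mem _ _ (sub_mem (sub_mem h1 (v.1.mul_mem _ _ (v.algebraMap_mem W.a₁) hv))
    (v.algebraMap_mem W.a₃)) (v.algebraMap_mem (2⁻¹ : K))
  convert h2 using 1
  rw [map_inv₀, map_ofNat]
  field_simp
  ring

/-- The values of the coordinate functions at a place where they are finite satisfy the equation of
the curve. -/
theorem exists_isPlaceAt_point (hΔ : W.Δ ≠ 0) (v : Place K MM) : ∃ P, IsPlaceAt v P := by
  have := (isQuadratic (W := W)).rationalPlaces
  by_cases hv : x W ∈ v.1
  · obtain ⟨c, hc⟩ := RationalPlaces.exists_sub_mem v _ hv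
    obtain ⟨d, hd⟩ := RationalPlaces.exists_sub_mem v _ (y_mem hv)
    have heq : W.toAffine.Equation c d := by
      rw [WeierstrassCurve.Affine.equation_iff, ← sub_eq_zero]
      -- the equation holds modulo `x - c` and `y - d`
      by_contra hne
      apply v.algebraMap_notMem_nonunits hne
      have hcv := v.algebraMap_mem c
      have hdv := v.algebraMap_mem d
      have m1 := v.mul_mem_nonunits (v.1.add_mem _ _ (v.1.add_mem _ _
        (v.1.add_mem _ _ (y_mem hv) hdv)
        (v.1.mul_mem _ _ (v.algebraMap_mem W.a₁) hv)) (v.algebraMap_mem W.a₃)) hd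
      have m2 := v.mul_mem_nonunits (sub_mem (v.1.mul_mem _ _ (v.algebraMap_mem W.a₁) hdv)
        (v.1.add_mem _ _ (v.1.add_mem _ _ (v.1.add_mem _ _ (v.1.add_mem _ _ (pow_mem hv 2)
        (v.1.mul_mem _ _ hv hcv)) (pow_mem hcv 2)) (v.1.mul_mem _ _ (v.algebraMap_mem W.a₂)
        (v.1.add_mem _ _ hv hcv))) (v.algebraMap_mem W.a₄))) hc
      have m3 := neg_mem (add_mem m1 m2)
      convert m3 using 1
      simp only [map_sub, map_add, map_mul, map_pow]
      linear_combination (1 : MM) * equation (W := W)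
    exact ⟨.some c d ((WeierstrassCurve.Affine.equation_iff_nonsingular_of_Δ_ne_zero hΔ).1 heq),
      hc, hd⟩
  · exact ⟨.zero, hv⟩

omit [CharZero K] [IsAlgClosed K] in
theorem IsPlaceAt.eq {v : Place K MM} {P Q : W.toAffine.Point} (hP : IsPlaceAt v P)
    (hQ : IsPlaceAt v Q) : P = Q := by
  rcases P with _ | ⟨x₁, y₁, h₁⟩ <;> rcases Q with _ | ⟨x₂, y₂, h₂⟩
  · rfl
  · exact absurd (v.mem_of_sub_mem_nonunits hQ.1) hP
  · exact absurd (v.mem_of_sub_mem_nonunits hP.1) hQ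
  · rw [WeierstrassCurve.Affine.Point.some.injEq]
    exact ⟨v.eq_of_sub_mem_nonunits hP.1 hQ.1, v.eq_of_sub_mem_nonunits hP.2 hQ.2⟩

omit [IsAlgClosed K] in
theorem apply_y {ι : W.toAffine.FunctionField ≃ₐ[K] W.toAffine.FunctionField}
    (hιx : ι (x W) = x W)
    (hιY : ι (2 * y W + algebraMap K _ W.a₁ * x W + algebraMap K _ W.a₃) =
      -(2 * y W + algebraMap K _ W.a₁ * x W + algebraMap K _ W.a₃)) :
    ι (y W) = -y W - algebraMap K _ W.a₁ * x W - algebraMap K _ W.a₃ := by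
  have : CharZero MM := charZero_of_injective_algebraMap (algebraMap K _).injective
  rw [map_add, map_add, map_mul, map_mul, AlgEquiv.commutes, AlgEquiv.commutes, hιx,
    map_ofNat] at hιY
  have h2 : (2 : MM) ≠ 0 := two_ne_zero
  apply mul_left_cancel₀ h2
  linear_combination hιY

omit [IsAlgClosed K] in
/-- The hyperelliptic involution induces negation on the points. -/
theorem IsPlaceAt.transport {ι : W.toAffine.FunctionField ≃ₐ[K] W.toAffine.FunctionField}
    (hιx : ι (x W) = x W)
    (hιY : ι (2 * y W + algebraMap K _ W.a₁ * x W + algebraMap K _ W.a₃) =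
      -(2 * y W + algebraMap K _ W.a₁ * x W + algebraMap K _ W.a₃))
    {v : Place K MM} {P : W.toAffine.Point} (hP : IsPlaceAt v P) :
    IsPlaceAt (v.transport ι) (-P) := by
  rcases P with _ | ⟨x₁, y₁, h₁⟩
  · change x W ∉ (v.transport ι).1
    rw [Place.mem_transport, hιx]
    exact hP
  · rw [WeierstrassCurve.Affine.Point.neg_some]
    constructor
    · rw [Place.mem_nonunits_transport, map_sub, hιx, AlgEquiv.commutes]
      exact hP.1
    · rw [Place.mem_nonunits_transport, map_sub, apply_y hιx hιY, AlgEquiv.commutes,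
        WeierstrassCurve.Affine.negY]
      have := neg_mem (add_mem hP.2 (v.mul_mem_nonunits (v.algebraMap_mem W.a₁) hP.1))
      convert this using 1
      simp only [map_sub, map_neg, map_mul]
      ring

theorem exists_isPlaceAt (P : W.toAffine.Point) : ∃ v, IsPlaceAt v P := by
  obtain ⟨ι, hιx, hιY⟩ := (isQuadratic (W := W)).exists_involution
  have := (isQuadratic (W := W)).rationalPlaces
  rcases P with _ | ⟨c, d, hcd⟩
  · obtain ⟨v, hv⟩ := exists_place_of_transcendental (K := K) (x := (x W)⁻¹)
      fun h => transcendental_x (W := W) (by simpa using h.inv)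
    exact ⟨v, ((v.1.inv_mem_nonunits_iff).1 hv).resolve_left isQuadratic.x_ne_zero⟩
  · obtain ⟨v, hv⟩ := exists_place_of_transcendental (K := K) (x := x W - algebraMap K _ c)
      fun h => transcendental_x (W := W) (by
        have := h.add (isAlgebraic_algebraMap c)
        rwa [sub_add_cancel] at this)
    have hxv := v.mem_of_sub_mem_nonunits hv
    obtain ⟨d', hd'⟩ := RationalPlaces.exists_sub_mem v _ (y_mem hxv)
    -- `y` takes at `v` one of the two values that are possible for `x = c`
    have hprod : (y W - algebraMap K _ d) * (y W - algebraMap K _ (W.toAffine.negY c d)) ∈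
        v.1.nonunits := by
      have heq := (WeierstrassCurve.Affine.equation_iff ..).1 hcd.1
      have heq' := congrArg (algebraMap K MM) heq
      simp only [map_add, map_mul, map_pow] at heq'
      have hcv := v.algebraMap_mem c
      have m := v.mul_mem_nonunits (sub_mem (v.1.add_mem _ _ (v.1.add_mem _ _
        (v.1.add_mem _ _ (v.1.add_mem _ _
        (pow_mem hxv 2) (v.1.mul_mem _ _ hxv hcv)) (pow_mem hcv 2)) (v.1.mul_mem _ _
        (v.algebraMap_mem W.a₂) (v.1.add_mem _ _ hxv hcv))) (v.algebraMap_mem W.a₄))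
        (v.1.mul_mem _ _ (v.algebraMap_mem W.a₁) (y_mem hxv))) hv
      convert m using 1
      simp only [WeierstrassCurve.Affine.negY, map_sub, map_neg, map_mul]
      linear_combination equation (W := W) - heq'
    rcases v.mem_nonunits_of_mul hprod with h1 | h1
    · exact ⟨v, hv, h1⟩
    · have h0 : IsPlaceAt v (-WeierstrassCurve.Affine.Point.some c d hcd) := by
        rw [WeierstrassCurve.Affine.Point.neg_some]
        exact ⟨hv, h1⟩
      have h2 := h0.transport hιx hιY
      rw [neg_neg] at h2
      exact ⟨_, h2⟩

/-- A place is determined by its point: two places with the same abscissa are exchanged by the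
involution, and the ordinate distinguishes them unless the point is a branch point. -/
theorem IsPlaceAt.place_eq (hΔ : W.Δ ≠ 0) {v v' : Place K MM} {P : W.toAffine.Point}
    (hv : IsPlaceAt v P) (hv' : IsPlaceAt v' P) : v = v' := by
  obtain ⟨ι, hιx, hιY⟩ := (isQuadratic (W := W)).exists_involution
  have h := isQuadratic (W := W)
  rcases P with _ | ⟨c, d, hcd⟩
  · rcases h.eq_or_eq_transport_of_notMem hιx hιY hv hv' with h1 | h1
    · exact h1.symm
    · rw [h1, h.transport_eq_of_notMem hιx hιY odd_natDegree hv]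
  · rcases h.eq_or_eq_transport hιx hιY hv.1 hv'.1 with h1 | h1
    · exact h1.symm
    · have h2 := IsPlaceAt.transport hιx hιY hv
      rw [← h1] at h2
      have h3 := h2.eq hv'
      rw [WeierstrassCurve.Affine.Point.neg_some, WeierstrassCurve.Affine.Point.some.injEq] at h3
      have h4 := h3.2
      rw [WeierstrassCurve.Affine.negY] at h4
      rw [h1, h.transport_eq_of_mem_nonunits hιx hιY (squarefree_twoTorsionPolynomial hΔ) hv.1]
      have m := add_mem (v.mul_mem_nonunits (v.algebraMap_mem 2) hv.2)
        (v.mul_mem_nonunits (v.algebraMap_mem W.a₁) hv.1)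
      convert m using 1
      have h5 := congrArg (algebraMap K MM) h4
      simp only [map_sub, map_neg, map_mul, map_ofNat] at h5 ⊢
      linear_combination -h5

/-- The places of the function field of an elliptic curve over an algebraically closed field are
its points. -/
theorem exists_equiv (hΔ : W.Δ ≠ 0) : ∃ pt : W.toAffine.Point ≃ Place K MM,
    ∀ P, IsPlaceAt (pt P) P := by
  choose f hf using exists_isPlaceAt (W := W)
  refine ⟨Equiv.ofBijective f ⟨fun P Q hPQ => ?_, fun v => ?_⟩, hf⟩
  · exact (hf P).eq (by rw [hPQ]; exact hf Q)
  · obtain ⟨P, hP⟩ := exists_isPlaceAt_point hΔ v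
    exact ⟨P, (hf P).place_eq hΔ hP⟩

end Points

end WeierstrassFunctionField

/-! ### The group law of an elliptic curve and linear equivalence -/

namespace WeierstrassFunctionField

section GroupLaw

variable {K : Type*} [Field K] [CharZero K] [IsAlgClosed K] {W : WeierstrassCurve K}

local notation "MM" => W.toAffine.FunctionField

omit [IsAlgClosed K] in
/-- The norm to `K(x)` of the equation of the line through two points. -/
theorem line_mul_apply {ι : W.toAffine.FunctionField ≃ₐ[K] W.toAffine.FunctionField}
    (hιx : ι (x W) = x W)
    (hιY : ι (2 * y W + algebraMap K _ W.a₁ * x W + algebraMap K _ W.a₃) =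
      -(2 * y W + algebraMap K _ W.a₁ * x W + algebraMap K _ W.a₃)) (x₁ y₁ m : K) :
    (y W - (algebraMap K _ m * (x W - algebraMap K _ x₁) + algebraMap K _ y₁)) *
      ι (y W - (algebraMap K _ m * (x W - algebraMap K _ x₁) + algebraMap K _ y₁)) =
    aeval (x W) (W.toAffine.addPolynomial x₁ y₁ m) := by
  rw [WeierstrassCurve.Affine.addPolynomial_eq]
  simp only [Cubic.toPoly, map_sub, map_add, map_mul, map_pow, map_neg, aeval_C, aeval_X, hιx,
    apply_y hιx hιY, AlgEquiv.commutes, map_one, map_ofNat]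
  linear_combination (-1 : MM) * equation (W := W)

/-- The divisor of a line `y = m x + n` that meets the curve in the points with abscissae
`x₁`, `x₂`, `x₃`. At every place the orders of `l` and of its conjugate add up to the order of the
norm, and they are equal at a fixed point of the involution, while at any other point of the line
the conjugate does not vanish. -/
theorem ord_line (hΔ : W.Δ ≠ 0)
    {ι : W.toAffine.FunctionField ≃ₐ[K] W.toAffine.FunctionField} (hιx : ι (x W) = x W)
    (hιY : ι (2 * y W + algebraMap K _ W.a₁ * x W + algebraMap K _ W.a₃) =
      -(2 * y W + algebraMap K _ W.a₁ * x W + algebraMap K _ W.a₃))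
    {pt : W.toAffine.Point ≃ Place K MM} (hpt : ∀ P, IsPlaceAt (pt P) P)
    {m n x₁ x₂ x₃ y₁ y₂ y₃ : K} (h₁ : W.toAffine.Nonsingular x₁ y₁)
    (h₂ : W.toAffine.Nonsingular x₂ y₂) (h₃ : W.toAffine.Nonsingular x₃ y₃)
    (hy₁ : y₁ = m * x₁ + n) (hy₂ : y₂ = m * x₂ + n) (hy₃ : y₃ = m * x₃ + n) {l : MM}
    (hl : l = y W - (algebraMap K _ m * x W + algebraMap K _ n))
    (hnorm : l * ι l = -((x W - algebraMap K _ x₁) * (x W - algebraMap K _ x₂) *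
      (x W - algebraMap K _ x₃))) :
    l ≠ 0 ∧ ∀ v : Place K MM,
      (Finsupp.single (pt (.some x₁ y₁ h₁)) 1 + Finsupp.single (pt (.some x₂ y₂ h₂)) 1 +
      Finsupp.single (pt (.some x₃ y₃ h₃)) 1 - (3 : ℤ) • Finsupp.single (pt 0) 1 :
        Divisor K MM) v = v.ord l := by
  classical
  have h := isQuadratic (W := W)
  have := h.discretePlaces
  have hsub (c : K) : x W - algebraMap K MM c ≠ 0 := fun h0 =>
    transcendental_x (W := W) (by rw [sub_eq_zero.1 h0]; exact isAlgebraic_algebraMap c)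
  have hl0 : l ≠ 0 := by
    rintro rfl
    rw [zero_mul, eq_comm, neg_eq_zero] at hnorm
    exact mul_ne_zero (mul_ne_zero (hsub _) (hsub _)) (hsub _) hnorm
  refine ⟨hl0, fun v => Eq.symm ?_⟩
  have hιl : ι l ≠ 0 := (map_ne_zero ι).2 hl0
  have hord : v.ord l + v.ord (ι l) = v.ord (x W - algebraMap K _ x₁) +
      v.ord (x W - algebraMap K _ x₂) + v.ord (x W - algebraMap K _ x₃) := by
    rw [← v.ord_mul hl0 hιl, hnorm, v.ord_neg, v.ord_mul (mul_ne_zero (hsub _) (hsub _)) (hsub _),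
      v.ord_mul (hsub _) (hsub _)]
  have hfix (hv : v.transport ι = v) : v.ord (ι l) = v.ord l := by
    rw [← Place.ord_transport hl0, hv]
  obtain ⟨S, rfl⟩ := pt.surjective v
  simp only [Finsupp.sub_apply, Finsupp.add_apply, Finsupp.smul_apply, Finsupp.single_apply,
    EmbeddingLike.apply_eq_iff_eq]
  -- at infinity, a fixed point of the involution, `x` has order `-2`
  rcases S with _ | ⟨c, d, hcd⟩
  · have hv : x W ∉ (pt WeierstrassCurve.Affine.Point.zero).1 := hpt .zero
    have hx := (h.ord_of_odd hιx hιY odd_natDegree hv).1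
    have hxc (c : K) :
        (pt WeierstrassCurve.Affine.Point.zero).ord (x W - algebraMap K _ c) = -2 := by
      rw [sub_eq_add_neg, ← map_neg, Place.ord_add_of_lt _ h.x_ne_zero, hx]
      rw [hx]
      by_cases hc : -c = 0
      · left
        rw [hc, map_zero]
      · right
        rw [Place.ord_algebraMap _ hc]
        norm_num
    rw [hfix (h.transport_eq_of_notMem hιx hιY odd_natDegree hv), hxc, hxc, hxc] at hord
    simp only [reduceCtorEq, if_false, WeierstrassCurve.Affine.Point.zero_def, if_true]
    norm_num
    omega
  · set v := pt (.some c d hcd)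
    obtain ⟨hvx, hvy⟩ := hpt (.some c d hcd)
    have hxv := v.mem_of_sub_mem_nonunits hvx
    have hyv := v.mem_of_sub_mem_nonunits hvy
    have hlv : l - algebraMap K _ (d - (m * c + n)) ∈ v.1.nonunits := by
      have := sub_mem hvy (v.mul_mem_nonunits (v.algebraMap_mem m) hvx)
      convert this using 1
      rw [hl]
      simp only [map_sub, map_add, map_mul]
      ring
    have h0 : ((0 : W.toAffine.Point) = .some c d hcd) = False := by
      simp [WeierstrassCurve.Affine.Point.zero_def]
    simp only [h0, if_false, WeierstrassCurve.Affine.Point.some.injEq, smul_zero, sub_zero]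
    by_cases hd : d = m * c + n
    · have key (x' y' : K) (hy' : y' = m * x' + n) : (x' = c ∧ y' = d) ↔ x' = c :=
        ⟨fun h => h.1, fun h => ⟨h, by rw [hy', hd, h]⟩⟩
      rw [if_congr (key _ _ hy₁) rfl rfl, if_congr (key _ _ hy₂) rfl rfl,
        if_congr (key _ _ hy₃) rfl rfl]
      have hne (x' : K) (hx' : x' ≠ c) : v.ord (x W - algebraMap K _ x') = 0 :=
        v.ord_eq_zero (sub_mem hxv (v.algebraMap_mem _)) fun h' =>
          hx' (v.eq_of_sub_mem_nonunits h' hvx)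
      -- for a point on the line, membership among the three points is a matter of the abscissa
      by_cases hfx : v.transport ι = v
      · have hval (x' : K) : v.ord (x W - algebraMap K _ x') = 2 * if x' = c then 1 else 0 := by
          split_ifs with hx'
          · rw [hx', (h.ord_sub hιx hιY hvx).2 hfx, mul_one]
          · rw [hne x' hx', mul_zero]
        rw [hfix hfx, hval, hval, hval] at hord
        omega
      · have hval (x' : K) : v.ord (x W - algebraMap K _ x') = if x' = c then 1 else 0 := by
          split_ifs with hx'
          · rw [hx', (h.ord_sub hιx hιY hvx).1 hfx]
          · rw [hne x' hx']
        -- the conjugate point is not on the line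
        have hιl0 : v.ord (ι l) = 0 := by
          rw [← Place.ord_transport hl0]
          have ht := (hpt (.some c d hcd)).transport hιx hιY
          rw [WeierstrassCurve.Affine.Point.neg_some] at ht
          have hxt := Place.mem_of_sub_mem_nonunits _ ht.1
          have hyt := Place.mem_of_sub_mem_nonunits _ ht.2
          have hdt : d ≠ W.toAffine.negY c d := fun hdt => hfx (by
            refine IsPlaceAt.place_eq hΔ (P := .some c d hcd) ?_ (hpt _)
            exact ⟨ht.1, by rw [hdt]; exact ht.2⟩)
          refine Place.ord_eq_zero _ ?_ fun hu => hdt ?_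
          · rw [hl]
            exact sub_mem hyt (add_mem (mul_mem (Place.algebraMap_mem _ _) hxt)
              (Place.algebraMap_mem _ _))
          · have h3 := sub_mem ht.2 hu
            refine (Place.eq_of_sub_mem_nonunits _ (f := y W) ?_ ht.2)
            have h4 := add_mem hu (Place.mul_mem_nonunits _ (Place.algebraMap_mem _ m) ht.1)
            convert h4 using 1
            rw [hl, hd]
            simp only [map_add, map_mul]
            ring
        rw [hιl0, hval, hval, hval] at hord
        omega
    · have key (x' y' : K) (hy' : y' = m * x' + n) : (x' = c ∧ y' = d) ↔ False :=
        ⟨fun h => hd (by rw [← h.1, ← h.2, hy']), False.elim⟩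
      rw [if_congr (key _ _ hy₁) rfl rfl, if_congr (key _ _ hy₂) rfl rfl,
        if_congr (key _ _ hy₃) rfl rfl, v.ord_eq_zero (v.mem_of_sub_mem_nonunits hlv)]
      · simp
      · intro hu
        apply hd
        rw [← sub_eq_zero]
        exact v.eq_of_sub_mem_nonunits hlv (by simpa using hu)

/-- The map from points to divisor classes is compatible with the group law: with
`R = -(P + Q)`, the divisors `P + Q + R - 3 O`, of a line, and `R + (-R) - 2 O` are principal. -/
theorem add_sub_mem_principalDivisors [DecidableEq K] (hΔ : W.Δ ≠ 0)
    {pt : W.toAffine.Point ≃ Place K MM}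
    (hpt : ∀ P, IsPlaceAt (pt P) P) (P Q : W.toAffine.Point) :
    Finsupp.single (pt P) 1 + Finsupp.single (pt Q) 1 - Finsupp.single (pt (P + Q)) 1
      - Finsupp.single (pt 0) 1 ∈ principalDivisors K MM := by
  have h := isQuadratic (W := W)
  have := h.discretePlaces
  obtain ⟨ι, hιx, hιY⟩ := h.exists_involution
  have htr (P : W.toAffine.Point) : (pt P).transport ι = pt (-P) :=
    ((hpt P).transport hιx hιY).place_eq hΔ (hpt _)
  have hneg (P : W.toAffine.Point) : Finsupp.single (pt P) 1 + Finsupp.single (pt (-P)) 1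
      - (2 : ℤ) • Finsupp.single (pt 0) 1 ∈ principalDivisors K MM := by
    have h1 := h.add_transport_sub_mem_principalDivisors hιx hιY (pt P) (pt 0)
    rwa [htr, htr, neg_zero, ← two_smul ℤ (Finsupp.single (pt 0) 1)] at h1
  rcases P with _ | ⟨x₁, y₁, h₁⟩
  · rw [← WeierstrassCurve.Affine.Point.zero_def, zero_add]
    convert zero_mem (principalDivisors K MM) using 1
    abel
  rcases Q with _ | ⟨x₂, y₂, h₂⟩
  · rw [← WeierstrassCurve.Affine.Point.zero_def, add_zero]
    convert zero_mem (principalDivisors K MM) using 1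
    abel
  -- opposite points lie on a vertical line
  by_cases hxy : x₁ = x₂ ∧ y₁ = W.toAffine.negY x₂ y₂
  · have h1 : WeierstrassCurve.Affine.Point.some x₂ y₂ h₂ =
        -WeierstrassCurve.Affine.Point.some x₁ y₁ h₁ := by
      rw [WeierstrassCurve.Affine.Point.neg_some, WeierstrassCurve.Affine.Point.some.injEq]
      refine ⟨hxy.1.symm, ?_⟩
      rw [hxy.1, hxy.2, WeierstrassCurve.Affine.negY_negY]
    rw [h1, add_neg_cancel]
    convert hneg (.some x₁ y₁ h₁) using 1
    rw [two_smul]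
    abel
  · set m := W.toAffine.slope x₁ x₂ y₁ y₂ with hm
    have h₃ := WeierstrassCurve.Affine.nonsingular_negAdd h₁ h₂ hxy
    have hadd : WeierstrassCurve.Affine.Point.some x₁ y₁ h₁ + .some x₂ y₂ h₂ =
        -.some _ _ h₃ := by
      rw [WeierstrassCurve.Affine.Point.add_some hxy, WeierstrassCurve.Affine.Point.neg_some]
      rfl
    have hline := ord_line hΔ hιx hιY hpt (m := m) (n := y₁ - m * x₁) h₁ h₂ h₃
      (by ring) ?_ ?_ rfl ?_
    · have h1 : Finsupp.single (pt (.some x₁ y₁ h₁)) 1 + Finsupp.single (pt (.some x₂ y₂ h₂)) 1 +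
          Finsupp.single (pt (.some _ _ h₃)) 1 - (3 : ℤ) • Finsupp.single (pt 0) 1 ∈
          principalDivisors K MM := by
        rw [mem_principalDivisors_iff]
        exact ⟨_, hline⟩
      convert sub_mem h1 (hneg (.some _ _ h₃)) using 1
      rw [hadd]
      module
    · by_cases hx : x₁ = x₂
      · have hy := WeierstrassCurve.Affine.Y_eq_of_Y_ne h₁.1 h₂.1 hx (fun h => hxy ⟨hx, h⟩)
        rw [hx, hy]
        ring
      · have := WeierstrassCurve.Affine.slope_of_X_ne (W := W.toAffine) (y₁ := y₁) (y₂ := y₂) hx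
        rw [← hm] at this
        have hs : x₁ - x₂ ≠ 0 := sub_ne_zero.2 hx
        rw [this]
        field_simp
        ring
    · rw [WeierstrassCurve.Affine.negAddY]
      ring
    · have hl : y W - (algebraMap K MM m * x W + algebraMap K MM (y₁ - m * x₁)) =
          y W - (algebraMap K MM m * (x W - algebraMap K MM x₁) + algebraMap K MM y₁) := by
        rw [map_sub, map_mul]
        ring
      rw [hl, line_mul_apply hιx hιY, WeierstrassCurve.Affine.addPolynomial_slope h₁.1 h₂.1 hxy]
      simp only [map_neg, map_mul, map_sub, aeval_X, aeval_C]

end GroupLaw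

end WeierstrassFunctionField

/-! ### The Weierstrass model of the genus one quotient -/

section WeierstrassModel

variable {k : Type*} [Field k] [CharZero k] {a b : k}

/-- For `x = 2r + s` with `s = 2w² + a₁w`, the product of the factor `x + a₂`, which
occurs because `a₆ = a₂ a₄`, and of the equation of the quartic model is the Weierstrass
equation. -/
theorem curveE_equation {L : Type*} [Field L] [Algebra k L] {w r : L}
    (hr : r ^ 2 = aeval w (gE a b)) {x y : L}
    (hx : x = 2 * r + 2 * w ^ 2 + algebraMap k L (curveE a b).a₁ * w)
    (hy : y = 2 * w * (x + algebraMap k L (curveE a b).a₂)) :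
    y ^ 2 + algebraMap k L (curveE a b).a₁ * x * y + algebraMap k L (curveE a b).a₃ * y =
      x ^ 3 + algebraMap k L (curveE a b).a₂ * x ^ 2 + algebraMap k L (curveE a b).a₄ * x
        + algebraMap k L (curveE a b).a₆ := by
  have h1 := congrArg (aeval w) (four_mul_gE a b)
  simp only [map_sub, map_add, map_mul, map_pow, aeval_C, aeval_X, ← hr, map_ofNat] at h1
  rw [a₆_curveE, map_mul, hy]
  subst hx
  linear_combination (2 * r + 2 * w ^ 2 + algebraMap k L (curveE a b).a₁ * w
    + algebraMap k L (curveE a b).a₂) * (-h1)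

theorem exists_equiv_curveE [IsDomain (QuadRing (gE a b))] :
    ∃ ψ : (curveE a b).toAffine.FunctionField ≃ₐ[k] QuadField (gE a b),
      ψ (WeierstrassFunctionField.x (curveE a b)) =
        2 * QuadField.y (gE a b) + 2 * QuadField.x (gE a b) ^ 2
          + algebraMap k _ (curveE a b).a₁ * QuadField.x (gE a b) ∧
      ψ (WeierstrassFunctionField.y (curveE a b)) =
        4 * QuadField.x (gE a b) * QuadField.y (gE a b) + 4 * QuadField.x (gE a b) ^ 3
          + algebraMap k _ (2 * (curveE a b).a₁) * QuadField.x (gE a b) ^ 2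
          + algebraMap k _ (2 * (curveE a b).a₂) * QuadField.x (gE a b) := by
  set w := QuadField.x (gE a b)
  set r := QuadField.y (gE a b)
  have h : IsQuadratic (gE a b) w r := isQuadratic_quadField
  have : CharZero (QuadField (gE a b)) :=
    charZero_of_injective_algebraMap (algebraMap k _).injective
  obtain ⟨ι, hιw, hιr⟩ := h.exists_involution
  -- the trace of `x` to `k(w)` is transcendental
  have hx : Transcendental k (2 * r + 2 * w ^ 2 + algebraMap k _ (curveE a b).a₁ * w) := by
    intro hx
    have h1 := (hx.add (hx.algHom (ι : QuadField (gE a b) →ₐ[k] QuadField (gE a b))))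
    set p : k[X] := C 4 * X ^ 2 + C (2 * (curveE a b).a₁) * X + C 0 with hp
    have hp2 : p.natDegree = 2 := natDegree_quadratic (by norm_num)
    have h2 : aeval w p = 2 * r + 2 * w ^ 2 + algebraMap k _ (curveE a b).a₁ * w
        + (ι : QuadField (gE a b) →ₐ[k] QuadField (gE a b))
          (2 * r + 2 * w ^ 2 + algebraMap k _ (curveE a b).a₁ * w) := by
      simp only [hp, AlgEquiv.coe_toAlgHom, map_add, map_mul, map_pow, aeval_C, aeval_X, hιw, hιr,
        AlgEquiv.commutes, map_ofNat, map_zero]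
      ring
    rw [← h2] at h1
    obtain ⟨P, hP0, hP⟩ := h1
    refine h.transc ⟨P.comp p, ?_, ?_⟩
    · rw [Ne, comp_eq_zero_iff]
      rintro (h3 | h3)
      · exact hP0 h3
      · rw [h3.2, natDegree_C] at hp2
        omega
    · rw [aeval_comp, hP]
  obtain ⟨ψ, hψx, hψy⟩ := WeierstrassFunctionField.exists_lift (W := curveE a b) hx
    (curveE_equation (w := w) (r := r) h.sq rfl rfl)
  have hx0 : 2 * r + 2 * w ^ 2 + algebraMap k _ (curveE a b).a₁ * w
      + algebraMap k _ (curveE a b).a₂ ≠ 0 := by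
    intro h0
    apply hx
    rw [eq_neg_of_add_eq_zero_left h0, ← map_neg]
    exact isAlgebraic_algebraMap _
  set x₀ := WeierstrassFunctionField.x (curveE a b)
  have hw' : ψ (WeierstrassFunctionField.y (curveE a b) /
      (2 * (x₀ + algebraMap k _ (curveE a b).a₂))) = w := by
    rw [map_div₀, map_mul, map_add, hψx, hψy, AlgHom.commutes, map_ofNat,
      mul_comm 2 w, mul_assoc, mul_div_cancel_right₀ _ (mul_ne_zero two_ne_zero hx0)]
  have hsurj : Function.Surjective ψ := by
    refine AlgHom.surjective_of_gen h.gen_set ?_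
    rintro f (rfl | rfl)
    · exact ⟨_, hw'⟩
    · set u := WeierstrassFunctionField.y (curveE a b) /
        (2 * (x₀ + algebraMap k _ (curveE a b).a₂))
      refine ⟨(x₀ - 2 * u ^ 2 - algebraMap k _ (curveE a b).a₁ * u) / 2, ?_⟩
      rw [map_div₀, map_sub, map_sub, map_mul, map_mul, map_pow, hw', hψx, AlgHom.commutes,
        map_ofNat]
      field_simp
      ring
  refine ⟨AlgEquiv.ofBijective ψ ⟨ψ.injective, hsurj⟩, hψx, ?_⟩
  change ψ (WeierstrassFunctionField.y (curveE a b)) = _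
  rw [hψy]
  simp only [map_mul, map_ofNat]
  ring

end WeierstrassModel

/-! ### Prym varieties of hyperelliptic double covers -/

namespace FunctionField

section Pullback

variable {K L : Type*} [Field K] [Field L] [Algebra K L]

theorem ramificationIndex_equiv [DiscretePlaces K L] (α : L ≃ₐ[K] L) (v : Place K L) :
    ramificationIndex (α : L →ₐ[K] L) v = 1 := by
  obtain ⟨p, -, hp⟩ := v.exists_ord_eq_one
  have h1 : 1 ∈ {n : ℕ | 0 < n ∧ ∃ f : L, v.ord ((α : L →ₐ[K] L) f) = n} :=
    ⟨one_pos, α.symm p, by simpa using hp⟩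
  exact le_antisymm (Nat.sInf_le h1) (Nat.sInf_mem ⟨1, h1⟩).1

theorem pullback_single_of_involutive [DiscretePlaces K L] {σ : L ≃ₐ[K] L}
    (hσ : ∀ f, σ (σ f) = f) (v : Place K L) (n : ℤ) :
    pullback (σ : L →ₐ[K] L) (Finsupp.single v n) = Finsupp.single (v.transport σ) n := by
  have key (w : Place K L) :
      w.1.comap ((σ : L →ₐ[K] L) : L →+* L) = v.1 ↔ w = v.transport σ := by
    constructor
    · intro hw
      apply Subtype.ext
      ext f
      have := congrArg (fun O : ValuationSubring L => σ f ∈ O) hw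
      simp only [ValuationSubring.mem_comap] at this
      rw [Place.mem_transport, ← this]
      change f ∈ w.1 ↔ σ (σ f) ∈ w.1
      rw [hσ]
    · rintro rfl
      ext f
      change σ (σ f) ∈ v.1 ↔ f ∈ v.1
      rw [hσ]
  have : Unique {w : Place K L // w.1.comap ((σ : L →ₐ[K] L) : L →+* L) = v.1} :=
    { default := ⟨v.transport σ, (key _).2 rfl⟩
      uniq := fun w => Subtype.ext ((key _).1 w.2) }
  rw [pullback, Finsupp.liftAddHom_apply_single, zmultiplesHom_apply, finsum_unique,
    ramificationIndex_equiv]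
  have h1 (w : {w : Place K L // w.1.comap ((σ : L →ₐ[K] L) : L →+* L) = v.1}) :
    w.1 = v.transport σ := (key _).1 w.2
  rw [h1]
  simp

end Pullback

section Prym

variable {K L : Type*} [Field K] [CharZero K] [IsAlgClosed K] [Field L] [Algebra K L]
  {W : WeierstrassCurve K} (hΔ : W.Δ ≠ 0) {pt : W.toAffine.Point ≃ Place K W.toAffine.FunctionField}
  (hpt : ∀ P, WeierstrassFunctionField.IsPlaceAt (pt P) P)
  {φ : W.toAffine.FunctionField →ₐ[K] L} {τ : L ≃ₐ[K] L} (hφ : IsInvolutionQuotient φ τ)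
  [DiscretePlaces K L] [RationalPlaces K L]

/-- The homomorphism `P ↦ [φ^*(P) - φ^*(O)]` from the points of an elliptic curve to the divisor
class group of a double cover of it. -/
def classHom [DecidableEq K] (hΔ : W.Δ ≠ 0)
    (hpt : ∀ P, WeierstrassFunctionField.IsPlaceAt (pt P) P)
    (hφ : IsInvolutionQuotient φ τ) : W.toAffine.Point →+ Pic K L :=
  AddMonoidHom.mk' (fun P => QuotientAddGroup.mk' (principalDivisors K L)
      (pullback φ (Finsupp.single (pt P) 1 - Finsupp.single (pt 0) 1))) fun P Q => by
    have : DiscretePlaces K W.toAffine.FunctionField :=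
      (WeierstrassFunctionField.isQuadratic (W := W)).discretePlaces
    have h := hφ.pullback_mem_principalDivisors
      (WeierstrassFunctionField.add_sub_mem_principalDivisors hΔ hpt P Q)
    rw [← map_add, ← map_add, QuotientAddGroup.mk'_apply, QuotientAddGroup.mk'_apply,
      QuotientAddGroup.eq, ← map_neg, ← map_add]
    convert h using 2
    abel

/-- On an elliptic curve no function has a simple pole at the origin as its only pole. -/
theorem _root_.WeierstrassFunctionField.single_sub_single_notMem (hΔ : W.Δ ≠ 0)
    (hpt : ∀ P, WeierstrassFunctionField.IsPlaceAt (pt P) P) {P : W.toAffine.Point} (hP : P ≠ 0) :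
    Finsupp.single (pt P) 1 - Finsupp.single (pt 0) 1 ∉
      principalDivisors K W.toAffine.FunctionField := by
  classical
  have h := WeierstrassFunctionField.isQuadratic (W := W)
  have := h.discretePlaces
  have hsq := WeierstrassFunctionField.squarefree_twoTorsionPolynomial hΔ
  obtain ⟨ι, hιx, hιY⟩ := h.exists_involution
  rw [mem_principalDivisors_iff]
  rintro ⟨f, hf0, hf⟩
  have hv : WeierstrassFunctionField.x W ∉ (pt 0).1 := hpt 0
  have hpole : (pt 0).ord f = -1 := by
    rw [← hf]
    simp [hP]
  obtain ⟨p, q, hpq⟩ := h.exists_eq_of_forall_mem hsq (f := f) (fun v hxv => by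
    rw [← v.ord_nonneg_iff hf0, ← hf]
    have hne : pt 0 ≠ v := by
      rintro rfl
      exact hv hxv
    simp only [Finsupp.sub_apply, Finsupp.single_apply, if_neg hne]
    split_ifs <;> norm_num)
  obtain ⟨hx, hY⟩ := h.ord_of_odd hιx hιY WeierstrassFunctionField.odd_natDegree hv
  rw [WeierstrassFunctionField.natDegree_twoTorsionPolynomial] at hY
  -- the orders of the two summands of `f` have different parity, and are not `-1`
  by_cases hp : p = 0
  · by_cases hq : q = 0
    · apply hf0
      rw [hpq, hp, hq]
      simp
    · obtain ⟨h1, h2⟩ := (pt 0).ord_aeval_of_notMem hv hq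
      rw [hpq, hp, map_zero (aeval _), zero_add, (pt 0).ord_mul h1 h.y_ne_zero, h2, hx, hY] at hpole
      push_cast at hpole
      omega
  · obtain ⟨h1, h2⟩ := (pt 0).ord_aeval_of_notMem hv hp
    by_cases hq : q = 0
    · rw [hpq, hq, map_zero (aeval _), zero_mul, add_zero, h2, hx] at hpole
      omega
    · obtain ⟨h3, h4⟩ := (pt 0).ord_aeval_of_notMem hv hq
      have h5 := (pt 0).ord_mul h3 h.y_ne_zero
      rw [h4, hx, hY] at h5
      rw [hx] at h2
      rcases lt_or_ge ((pt 0).ord (aeval (WeierstrassFunctionField.x W) p))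
        ((pt 0).ord (aeval (WeierstrassFunctionField.x W) q *
          (2 * WeierstrassFunctionField.y W + algebraMap K _ W.a₁ * WeierstrassFunctionField.x W
            + algebraMap K _ W.a₃))) with hlt | hge
      · rw [hpq, (pt 0).ord_add_of_lt h1 (.inr hlt), h2] at hpole
        omega
      · rw [hpq, add_comm, (pt 0).ord_add_of_lt (mul_ne_zero h3 h.y_ne_zero) (.inr (by
          push_cast at h5
          omega)), h5] at hpole
        push_cast at hpole
        omega

include hφ in
/-- If the pull-back of a divisor under a ramified double cover is principal, so is the divisor:
a function whose divisor is a pull-back is an eigenfunction of the covering involution `τ`, and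
the eigenvalue is not `-1` because an anti-invariant function may have odd order at a branch
point. -/
theorem IsInvolutionQuotient.mem_principalDivisors_of_pullback
    [DiscretePlaces K W.toAffine.FunctionField]
    {t : L} (ht0 : t ≠ 0) (ht : τ t = -t) {v₁ : Place K L} (hv₁ : v₁.transport τ = v₁)
    (hodd : Odd (v₁.ord t)) {D : Divisor K W.toAffine.FunctionField}
    (hD : pullback φ D ∈ principalDivisors K L) :
    D ∈ principalDivisors K W.toAffine.FunctionField := by
  rw [mem_principalDivisors_iff] at hD ⊢
  obtain ⟨f, hf0, hf⟩ := hD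
  have hτf0 : τ f ≠ 0 := (map_ne_zero τ).2 hf0
  have hord (v : Place K L) : v.ord (τ f) = v.ord f := by
    rw [← Place.ord_transport hf0, ← hf, ← hf, hφ.pullback_apply, hφ.pullback_apply,
      hφ.below_transport, hφ.ramificationIndex_transport]
  -- `τ f` and `f` have the same divisor, so they differ by a constant, and the constant is `±1`
  obtain ⟨c, hc⟩ := exists_algebraMap_eq_of_forall_mem (K := K) (f := τ f / f) fun v =>
    (v.le_ord_div_iff hτf0 hf0).1 (hord v).ge
  rw [eq_div_iff hf0] at hc
  have hc2 : c ^ 2 = 1 := by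
    apply (algebraMap K L).injective
    apply mul_right_cancel₀ hf0
    have h1 := congrArg τ hc
    rw [map_mul, AlgEquiv.commutes, hφ.invol, ← hc] at h1
    rw [map_pow, map_one, one_mul, sq, mul_assoc, h1]
  rcases (sq_eq_sq_iff_eq_or_eq_neg.1 (hc2.trans (one_pow 2).symm)) with rfl | rfl
  · rw [map_one, one_mul] at hc
    obtain ⟨f', rfl⟩ := hφ.exists_map_eq hc.symm
    have hf0' : f' ≠ 0 := by
      rintro rfl
      exact hf0 (map_zero φ)
    refine ⟨f', hf0', fun u => ?_⟩
    obtain ⟨v, rfl⟩ := hφ.exists_below_eq u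
    have h1 := hf v
    rw [hφ.pullback_apply, hφ.ord_map v hf0', mul_comm] at h1
    refine mul_left_cancel₀ ?_ h1
    rcases hφ.ramificationIndex_eq v with h2 | h2 <;> rw [h2] <;> norm_num
  · exfalso
    obtain ⟨f', hf'⟩ := hφ.exists_map_eq (f := f * t) (by
      rw [map_mul, ht, ← hc, map_neg, map_one]
      ring)
    have hf0' : f' ≠ 0 := by
      rintro rfl
      rw [map_zero, eq_comm] at hf'
      exact mul_ne_zero hf0 ht0 hf'
    have h1 := hφ.even_ord_map hv₁ hf0'
    rw [hf', v₁.ord_mul hf0 ht0, ← hf, hφ.pullback_apply, hφ.ramificationIndex_of_eq hv₁,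
      Int.even_add] at h1
    exact Int.not_even_iff_odd.2 hodd (h1.1 (even_two.mul_left _))

/-- The map is injective if the double cover is ramified, as witnessed by an anti-invariant
function of odd order at a fixed point. -/
theorem classHom_injective [DecidableEq K] {t : L} (ht0 : t ≠ 0) (ht : τ t = -t)
    {v₁ : Place K L} (hv₁ : v₁.transport τ = v₁) (hodd : Odd (v₁.ord t)) :
    Function.Injective (classHom hΔ hpt hφ) := by
  have : DiscretePlaces K W.toAffine.FunctionField :=
    (WeierstrassFunctionField.isQuadratic (W := W)).discretePlaces
  rw [injective_iff_map_eq_zero]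
  intro P hP
  by_contra hP0
  refine WeierstrassFunctionField.single_sub_single_notMem hΔ hpt hP0
    (hφ.mem_principalDivisors_of_pullback ht0 ht hv₁ hodd ?_)
  exact (QuotientAddGroup.eq_zero_iff _).1 hP

variable {g : K[X]} {x y : L} (h : IsQuadratic g x y) {ι σ : L ≃ₐ[K] L} (hιx : ι x = x)
  (hιy : ι y = -y) (hσ : ∀ f, σ f = τ (ι f)) (hσσ : ∀ f, σ (σ f) = f)

include h hιx hιy hσ hσσ

/-- If the Galois group of the double cover of the projective line contains a further involution
`τ`, then modulo the hyperelliptic class `v - σ v` is the pull-back of the image of `v` in the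
quotient by `τ`, where `σ = τ ι`. -/
theorem mk_sub_pullback_single [DecidableEq K] (v v₀ : Place K L) (P : W.toAffine.Point)
    (hv : hφ.below v = pt P) (hv₀ : hφ.below v₀ = pt 0) :
    QuotientAddGroup.mk' (principalDivisors K L)
      ((AddMonoidHom.id (Divisor K L) - pullback (σ : L →ₐ[K] L))
        (Finsupp.single v 1 - Finsupp.single v₀ 1)) = classHom hΔ hpt hφ P := by
  have : DiscretePlaces K W.toAffine.FunctionField :=
    (WeierstrassFunctionField.isQuadratic (W := W)).discretePlaces
  have htr (v : Place K L) : v.transport σ = (v.transport τ).transport ι := by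
    apply Subtype.ext
    ext f
    change σ f ∈ v.1 ↔ τ (ι f) ∈ v.1
    rw [hσ]
  have h1 := h.add_transport_sub_mem_principalDivisors hιx hιy (v.transport τ)
    (v₀.transport τ)
  change _ = QuotientAddGroup.mk' (principalDivisors K L) _
  rw [← hv, ← hv₀, map_sub (pullback φ), hφ.pullback_single_below, hφ.pullback_single_below,
    QuotientAddGroup.mk'_apply, QuotientAddGroup.mk'_apply, QuotientAddGroup.eq]
  rw [← htr, ← htr] at h1
  convert h1 using 1
  rw [AddMonoidHom.sub_apply, AddMonoidHom.id_apply, map_sub,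
    pullback_single_of_involutive hσσ, pullback_single_of_involutive hσσ]
  abel

/-- The divisors `v - v₀` generate the divisors of degree zero, and every point of the elliptic
curve is the image of some `v`. -/
theorem range_classHom [DecidableEq K] : (classHom hΔ hpt hφ).range = prym σ := by
  classical
  have : DiscretePlaces K W.toAffine.FunctionField :=
    (WeierstrassFunctionField.isQuadratic (W := W)).discretePlaces
  obtain ⟨v₀, hv₀⟩ := hφ.exists_below_eq (pt 0)
  apply le_antisymm
  · rintro _ ⟨P, rfl⟩
    obtain ⟨v, hv⟩ := hφ.exists_below_eq (pt P)
    rw [← mk_sub_pullback_single hΔ hpt hφ h hιx hιy hσ hσσ v v₀ P hv hv₀]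
    refine AddSubgroup.mem_map_of_mem _ (AddSubgroup.mem_map_of_mem _ ?_)
    rw [AddMonoidHom.mem_ker, degree, map_sub, Finsupp.liftAddHom_apply_single,
      Finsupp.liftAddHom_apply_single]
    simp
  · -- every divisor differs from a multiple of `v₀` by a sum of divisors `v - v₀`
    have key (D : Divisor K L) : QuotientAddGroup.mk' (principalDivisors K L)
        ((AddMonoidHom.id (Divisor K L) - pullback (σ : L →ₐ[K] L))
          (D - degree K L D • Finsupp.single v₀ 1)) ∈ (classHom hΔ hpt hφ).range := by
      induction D using Finsupp.induction_linear with
      | zero =>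
        rw [map_zero, zero_smul, sub_zero, map_zero, map_zero]
        exact zero_mem _
      | add D E hD hE =>
        rw [map_add (degree K L), add_smul, add_sub_add_comm, map_add, map_add]
        exact add_mem hD hE
      | single v n =>
        obtain ⟨P, hP⟩ := pt.surjective (hφ.below v)
        have h1 : Finsupp.single v n - degree K L (Finsupp.single v n) • Finsupp.single v₀ 1 =
            n • (Finsupp.single v 1 - Finsupp.single v₀ 1) := by
          simp [degree, smul_sub]
        rw [h1, map_zsmul, map_zsmul,
          mk_sub_pullback_single hΔ hpt hφ h hιx hιy hσ hσσ v v₀ P hP.symm hv₀]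
        exact (classHom hΔ hpt hφ).range.zsmul_mem ⟨P, rfl⟩ n
    rintro _ ⟨_, ⟨D, hD, rfl⟩, rfl⟩
    have h1 := key D
    rwa [(AddMonoidHom.mem_ker).1 hD, zero_smul, sub_zero] at h1

end Prym

end FunctionField

/-! ### The Prym variety of the genus three curve -/

namespace QuadField

variable {K : Type*} [Field K] [CharZero K] [IsAlgClosed K] {A B : K}
  [IsDomain (QuadRing (gCalHbar A B))]

local notation "xx" => QuadField.x (gCalHbar A B)
local notation "yy" => QuadField.y (gCalHbar A B)

/-- The point `(0, d)` with `d² = f₄(1) = 1 - A - B ≠ 0` is a branch point of the quotient by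
`(w, r) ↦ (-w, r)`, and `w` has a simple zero there. -/
theorem exists_branchPlace (hAB : A + B ≠ 1)
    {τ : QuadField (gCalHbar A B) ≃ₐ[K] QuadField (gCalHbar A B)} (hτx : τ xx = -xx)
    (hτy : τ yy = yy) :
    ∃ v : Place K (QuadField (gCalHbar A B)), v.transport τ = v ∧ v.ord xx = 1 := by
  have h := isQuadratic_quadField (g := gCalHbar A B)
  have := h.discretePlaces
  have := h.rationalPlaces
  obtain ⟨ι, hιx, hιy⟩ := h.exists_involution
  obtain ⟨v, hv⟩ := exists_place_of_transcendental h.transc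
  have hv0 : xx - algebraMap K _ 0 ∈ v.1.nonunits := by rwa [map_zero, sub_zero]
  obtain ⟨d, hd⟩ := RationalPlaces.exists_sub_mem v yy
    (v.mem_of_pow_mem two_ne_zero (by rw [h.sq]; exact v.aeval_mem (v.mem_of_nonunit hv) _))
  have hd0 : d ≠ 0 := by
    rintro rfl
    rw [map_zero, sub_zero] at hd
    have h1 : aeval xx (gCalHbar A B) ∈ v.1.nonunits := by
      have h2 := v.mul_mem_nonunits (v.mem_of_nonunit hd) hd
      rwa [← pow_two yy, h.sq] at h2
    rw [v.aeval_mem_nonunits_iff hv0, gCalHbar, eval_comp] at h1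
    simp only [eval_sub, eval_one, eval_pow, eval_X, ne_eq, OfNat.ofNat_ne_zero,
      not_false_eq_true, zero_pow, sub_zero, eval_one_f4] at h1
    apply hAB
    linear_combination -h1
  have hne := IsQuadratic.transport_ne_of_notMem_nonunits hιy hd hd0
  refine ⟨v, ?_, ?_⟩
  · have hτv : xx - algebraMap K _ 0 ∈ (v.transport τ).1.nonunits := by
      rw [Place.mem_nonunits_transport, map_zero, sub_zero, hτx]
      exact neg_mem hv
    rcases h.eq_or_eq_transport hιx hιy hv0 hτv with h1 | h1
    · exact h1
    · exfalso
      have h2 : yy - algebraMap K _ d ∈ (v.transport τ).1.nonunits := by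
        rw [Place.mem_nonunits_transport, map_sub, hτy, AlgEquiv.commutes]
        exact hd
      rw [h1, Place.mem_nonunits_transport, map_sub, hιy, AlgEquiv.commutes] at h2
      have h3 := v.eq_of_sub_mem_nonunits (f := -yy) h2 (d := -d) (by
        have h5 := neg_mem hd
        rw [neg_sub] at h5
        rwa [map_neg, sub_neg_eq_add, neg_add_eq_sub])
      apply hd0
      have h4 : 2 * d = 0 := by linear_combination h3
      simpa using h4
  · have := (h.ord_sub hιx hιy hv0).1 hne
    rwa [map_zero, sub_zero] at this

end QuadField

/-- Over an algebraically closed field the points of the elliptic curve are identified with the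
Prym variety by `P ↦ [φ^*(P) - φ^*(O)]`. -/
theorem exists_prym_equiv {K : Type*} [Field K] [DecidableEq K] [CharZero K] [IsAlgClosed K]
    {A B : K} (hD : A * DeltaAB A B ≠ 0) (hAB : A + B ≠ 1) [IsDomain (QuadRing (gCalHbar A B))]
    {σ : QuadField (gCalHbar A B) ≃ₐ[K] QuadField (gCalHbar A B)}
    (hσx : σ (QuadField.x _) = -QuadField.x _) (hσy : σ (QuadField.y _) = -QuadField.y _) :
    ∃ (φ : (curveE A B).toAffine.FunctionField →ₐ[K] QuadField (gCalHbar A B))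
      (pt : (curveE A B).toAffine.Point ≃ Place K (curveE A B).toAffine.FunctionField)
      (e : (curveE A B).toAffine.Point ≃+ prym σ),
      (φ (WeierstrassFunctionField.x (curveE A B)) =
          2 * QuadField.y (gCalHbar A B) + 2 * QuadField.x (gCalHbar A B) ^ 4
            + algebraMap K _ (curveE A B).a₁ * QuadField.x (gCalHbar A B) ^ 2 ∧
        φ (WeierstrassFunctionField.y (curveE A B)) =
          4 * QuadField.x (gCalHbar A B) ^ 2 * QuadField.y (gCalHbar A B)
            + 4 * QuadField.x (gCalHbar A B) ^ 6
            + algebraMap K _ (2 * (curveE A B).a₁) * QuadField.x (gCalHbar A B) ^ 4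
            + algebraMap K _ (2 * (curveE A B).a₂) * QuadField.x (gCalHbar A B) ^ 2) ∧
      (∀ P, WeierstrassFunctionField.IsPlaceAt (pt P) P) ∧
      ∀ P, (e P : Pic K (QuadField (gCalHbar A B))) =
        QuotientAddGroup.mk (pullback φ (Finsupp.single (pt P) 1 - Finsupp.single (pt 0) 1)) := by
  have h := isQuadratic_quadField (g := gCalHbar A B)
  have := h.discretePlaces
  have := h.rationalPlaces
  have : IsDomain (QuadRing (gE A B)) := QuadField.isDomain_of_not_isSquare (not_isSquare_gE hD)
  have hΔ := Δ_curveE_ne_zero hD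
  obtain ⟨ι, hιx, hιy⟩ := h.exists_involution
  obtain ⟨τ, hτx, hτy⟩ := QuadField.exists_negX (a := A) (b := B) (.inl rfl)
  obtain ⟨q, hqx, hqy⟩ := QuadField.exists_mapE (a := A) (b := B)
  obtain ⟨ψ, hψx, hψy⟩ := exists_equiv_curveE (a := A) (b := B)
  obtain ⟨pt, hpt⟩ := WeierstrassFunctionField.exists_equiv hΔ
  have hq := QuadField.isInvolutionQuotient_mapE hqx hqy hτx hτy
  have hφ : IsInvolutionQuotient (q.comp (ψ : (curveE A B).toAffine.FunctionField →ₐ[K]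
      QuadField (gE A B))) τ := by
    refine ⟨⟨q.injective.comp ψ.injective, fun f => ?_⟩, hq.invol, hq.nontriv⟩
    rw [← hq.quot.2 f]
    constructor
    · rintro ⟨m, rfl⟩
      exact ⟨ψ m, rfl⟩
    · rintro ⟨m, rfl⟩
      exact ⟨ψ.symm m, congrArg q (ψ.apply_symm_apply m)⟩
  -- the three involutions form a Klein four-group
  have hσ : ∀ f, σ f = τ (ι f) := by
    have : (σ : QuadField (gCalHbar A B) →ₐ[K] QuadField (gCalHbar A B)) =
        (τ : QuadField (gCalHbar A B) →ₐ[K] QuadField (gCalHbar A B)).comp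
          (ι : QuadField (gCalHbar A B) →ₐ[K] QuadField (gCalHbar A B)) := by
      refine algHom_eq_of_gen h.gen_set ?_
      rintro f (rfl | rfl)
      · simp [hσx, hιx, hτx]
      · simp [hσy, hιy, hτy]
    exact DFunLike.congr_fun this
  have hσσ : ∀ f, σ (σ f) = f := by
    have : (σ : QuadField (gCalHbar A B) →ₐ[K] QuadField (gCalHbar A B)).comp
        (σ : QuadField (gCalHbar A B) →ₐ[K] QuadField (gCalHbar A B)) = AlgHom.id K _ := by
      refine algHom_eq_of_gen h.gen_set ?_
      rintro f (rfl | rfl)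
      · simp [hσx]
      · simp [hσy]
    exact DFunLike.congr_fun this
  obtain ⟨v₁, hv₁, hv₁'⟩ := QuadField.exists_branchPlace hAB hτx hτy
  have hinj := classHom_injective hΔ hpt hφ h.x_ne_zero hτx hv₁ (by rw [hv₁']; exact odd_one)
  have hrange := range_classHom hΔ hpt hφ h hιx hιy hσ hσσ
  refine ⟨_, pt, (AddMonoidHom.ofInjective hinj).trans (AddEquiv.addSubgroupCongr hrange),
    ⟨?_, ?_⟩, hpt, fun P => rfl⟩
  · simp only [AlgHom.comp_apply, AlgEquiv.coe_toAlgHom, hψx, map_add, map_mul, map_pow, hqx, hqy,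
      AlgHom.commutes, map_ofNat]
    ring
  · simp only [AlgHom.comp_apply, AlgEquiv.coe_toAlgHom, hψy, map_add, map_mul, map_pow, hqx, hqy,
      AlgHom.commutes, map_ofNat]
    ring

/-! ### The diagram of curves and the invariants -/

/-- The square of curves formed by the double covers and the quotients of degree five commutes. -/
theorem CalHField.comp_eq {k : Type*} [Field k] {a b : k} [IsDomain (HRing a b)]
    [IsDomain (CalHRing a b)] [IsDomain (QuadRing (gHbar a b))]
    [IsDomain (QuadRing (gCalHbar a b))] {p : QuadField (gHbar a b) →ₐ[k] HField a b}
    {p' : QuadField (gCalHbar a b) →ₐ[k] CalHField a b}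
    {π' : QuadField (gHbar a b) →ₐ[k] QuadField (gCalHbar a b)}
    (hpx : p (QuadField.x _) = HField.x a b * HField.z a b) {s : HField a b}
    (hpy : p (QuadField.y _) = s)
    (hp'x : p' (QuadField.x _) = CalHField.w a b)
    (hp'y : p' (QuadField.y _) = ofHField a b s / CalHField.w a b)
    (hπ'x : π' (QuadField.x _) = 1 - QuadField.x _ ^ 2)
    (hπ'y : π' (QuadField.y _) = QuadField.x _ * QuadField.y _) :
    p'.comp π' = (ofHField a b).comp p := by
  refine algHom_eq_of_gen isQuadratic_quadField.gen_set ?_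
  rintro f (rfl | rfl)
  · rw [AlgHom.comp_apply, AlgHom.comp_apply, hπ'x, hpx, map_sub, map_one, map_pow, hp'x,
      w_sq, map_mul, ofHField_x, ofHField_z, sub_sub_cancel]
  · rw [AlgHom.comp_apply, AlgHom.comp_apply, hπ'y, map_mul, hp'x, hp'y, hpy,
      mul_div_cancel₀ _ w_ne_zero]

theorem j_curveE {k : Type*} [Field k] [CharZero k] {a b : k} (hD : a * DeltaAB a b ≠ 0)
    [(curveE a b).IsElliptic] : (curveE a b).j =
      -(16 * (64 * a ^ 2 + 4 * a ^ 2 * b + 16 * a * b ^ 2 + a ^ 2 * b ^ 2 + 2 * a * b ^ 3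
        + b ^ 4) ^ 3) / (a ^ 5 * DeltaAB a b) := by
  have ha : a ≠ 0 := left_ne_zero_of_mul hD
  have hDelta : DeltaAB a b ≠ 0 := right_ne_zero_of_mul hD
  rw [WeierstrassCurve.j, Units.val_inv_eq_inv_val, WeierstrassCurve.coe_Δ', Δ_curveE, c₄_curveE]
  generalize 64 * a ^ 2 + 4 * a ^ 2 * b + 16 * a * b ^ 2 + a ^ 2 * b ^ 2 + 2 * a * b ^ 3
    + b ^ 4 = c
  generalize DeltaAB a b = D at hDelta
  field_simp
  ring

theorem genus_gHbar {k : Type*} [Field k] [CharZero k] {a b : k} (hD : a * DeltaAB a b ≠ 0)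
    (hab : a + b ≠ 1) [IsDomain (QuadRing (gHbar a b))] : genus k (QuadField (gHbar a b)) = 2 :=
  isQuadratic_quadField.genus_eq (squarefree_gHbar hD hab)
    (by rw [natDegree_gHbar]) (by rw [natDegree_gHbar]; norm_num)

theorem genus_gCalHbar {k : Type*} [Field k] [CharZero k] {a b : k} (hD : a * DeltaAB a b ≠ 0)
    (hab : a + b ≠ 1) [IsDomain (QuadRing (gCalHbar a b))] :
    genus k (QuadField (gCalHbar a b)) = 3 :=
  isQuadratic_quadField.genus_eq (squarefree_gCalHbar hD hab)
    (by rw [natDegree_gCalHbar]; norm_num) (by rw [natDegree_gCalHbar])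

theorem genus_gE {k : Type*} [Field k] [CharZero k] {a b : k} (hD : a * DeltaAB a b ≠ 0)
    [IsDomain (QuadRing (gE a b))] : genus k (QuadField (gE a b)) = 1 :=
  isQuadratic_quadField.genus_eq (squarefree_gE hD)
    (by rw [natDegree_gE]; norm_num) (by rw [natDegree_gE])

end

set_option maxHeartbeats 400000 in
theorem mainTheorem11 {k : Type*} [Field k] [CharZero k] {ζ : k} (hζ : IsPrimitiveRoot ζ 5)
    (a b : k) (hD : a * DeltaAB a b ≠ 0)
    {K : Type*} [Field K] [DecidableEq K] [Algebra k K] [IsAlgClosed K] :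
    -- the curves are integral, and their quotients have the stated equations
    (∃ (_ : IsDomain (HRing a b)) (_ : IsDomain (CalHRing a b))
        (_ : IsDomain (QuadRing (gHbar a b))) (_ : IsDomain (QuadRing (gCalHbar a b)))
        (_ : IsDomain (QuadRing (gE a b)))
        -- the automorphisms of order five
        (α : HField a b ≃ₐ[k] HField a b) (α' : CalHField a b ≃ₐ[k] CalHField a b)
        -- the involution of the genus three curve whose quotient has genus one
        (τ : QuadField (gCalHbar a b) ≃ₐ[k] QuadField (gCalHbar a b))
        -- the covering involution of the genus three curve over the genus two curve
        (σ : QuadField (gCalHbar a b) ≃ₐ[k] QuadField (gCalHbar a b))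
        -- the maps of the diagram
        (π : HField a b →ₐ[k] CalHField a b)
        (p : QuadField (gHbar a b) →ₐ[k] HField a b)
        (p' : QuadField (gCalHbar a b) →ₐ[k] CalHField a b)
        (π' : QuadField (gHbar a b) →ₐ[k] QuadField (gCalHbar a b))
        (q : QuadField (gE a b) →ₐ[k] QuadField (gCalHbar a b)),
      (α (HField.x a b) = algebraMap k _ ζ * HField.x a b ∧
        α (HField.z a b) = algebraMap k _ ζ⁻¹ * HField.z a b) ∧
      (α' (CalHField.x a b) = algebraMap k _ ζ * CalHField.x a b ∧
        α' (CalHField.z a b) = algebraMap k _ ζ⁻¹ * CalHField.z a b ∧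
        α' (CalHField.w a b) = CalHField.w a b) ∧
      (τ (QuadField.x (gCalHbar a b)) = -QuadField.x (gCalHbar a b) ∧
        τ (QuadField.y (gCalHbar a b)) = QuadField.y (gCalHbar a b)) ∧
      (σ (QuadField.x (gCalHbar a b)) = -QuadField.x (gCalHbar a b) ∧
        σ (QuadField.y (gCalHbar a b)) = -QuadField.y (gCalHbar a b)) ∧
      (π (HField.x a b) = CalHField.x a b ∧ π (HField.z a b) = CalHField.z a b) ∧
      (p (QuadField.x (gHbar a b)) = HField.x a b * HField.z a b ∧
        p (QuadField.y (gHbar a b)) = HField.x a b ^ 5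
          - (algebraMap k _ (b + 2) * (HField.x a b * HField.z a b) ^ 2
            + algebraMap k _ (a - b) * (HField.x a b * HField.z a b) - algebraMap k _ a) / 2) ∧
      (π' (QuadField.x (gHbar a b)) = 1 - QuadField.x (gCalHbar a b) ^ 2 ∧
        π' (QuadField.y (gHbar a b)) =
          QuadField.x (gCalHbar a b) * QuadField.y (gCalHbar a b)) ∧
      (p' (QuadField.x (gCalHbar a b)) = CalHField.w a b ∧
        p' (QuadField.y (gCalHbar a b)) =
          π (p (QuadField.y (gHbar a b))) / CalHField.w a b) ∧
      (q (QuadField.x (gE a b)) = QuadField.x (gCalHbar a b) ^ 2 ∧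
        q (QuadField.y (gE a b)) = QuadField.y (gCalHbar a b)) ∧
      p'.comp π' = π.comp p ∧
      FunctionField.IsQuotient α p ∧
      FunctionField.IsQuotient α' p' ∧
      FunctionField.IsQuotient σ π' ∧
      FunctionField.IsQuotient τ q ∧
      -- the genera
      (a + b ≠ 1 → FunctionField.genus k (QuadField (gHbar a b)) = 2) ∧
      (a + b ≠ 1 → FunctionField.genus k (QuadField (gCalHbar a b)) = 3) ∧
      FunctionField.genus k (QuadField (gE a b)) = 1) ∧
    -- the Weierstrass model of the genus one quotient
    ((curveE a b).Δ = -(a ^ 5 * DeltaAB a b) / 2 ^ 4 ∧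
      (∃ _ : (curveE a b).IsElliptic,
        (curveE a b).j =
          -(16 * (64 * a ^ 2 + 4 * a ^ 2 * b + 16 * a * b ^ 2 + a ^ 2 * b ^ 2 + 2 * a * b ^ 3
            + b ^ 4) ^ 3) / (a ^ 5 * DeltaAB a b)) ∧
      ∃ ψ : (curveE a b).toAffine.FunctionField ≃ₐ[k] QuadField (gE a b),
        ψ (WeierstrassFunctionField.x (curveE a b)) =
          2 * QuadField.y (gE a b) + 2 * QuadField.x (gE a b) ^ 2
            + algebraMap k _ (curveE a b).a₁ * QuadField.x (gE a b) ∧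
        ψ (WeierstrassFunctionField.y (curveE a b)) =
          4 * QuadField.x (gE a b) * QuadField.y (gE a b) + 4 * QuadField.x (gE a b) ^ 3
            + algebraMap k _ (2 * (curveE a b).a₁) * QuadField.x (gE a b) ^ 2
            + algebraMap k _ (2 * (curveE a b).a₂) * QuadField.x (gE a b)) ∧
    -- over an algebraically closed field `K ⊇ k`, pull-back of divisor classes along the map from
    -- the genus three curve to the elliptic curve is an isomorphism onto the Prym variety
    (a + b ≠ 1 → ∀ A B : K, A = algebraMap k K a → B = algebraMap k K b →
      ∃ (_ : IsDomain (QuadRing (gHbar A B))) (_ : IsDomain (QuadRing (gCalHbar A B)))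
        (π' : QuadField (gHbar A B) →ₐ[K] QuadField (gCalHbar A B))
        (σ : QuadField (gCalHbar A B) ≃ₐ[K] QuadField (gCalHbar A B))
        (φ : (curveE A B).toAffine.FunctionField →ₐ[K] QuadField (gCalHbar A B))
        (pt : (curveE A B).toAffine.Point ≃
          FunctionField.Place K (curveE A B).toAffine.FunctionField)
        (e : (curveE A B).toAffine.Point ≃+ FunctionField.prym σ),
        (π' (QuadField.x (gHbar A B)) = 1 - QuadField.x (gCalHbar A B) ^ 2 ∧
          π' (QuadField.y (gHbar A B)) =
            QuadField.x (gCalHbar A B) * QuadField.y (gCalHbar A B)) ∧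
        (σ (QuadField.x (gCalHbar A B)) = -QuadField.x (gCalHbar A B) ∧
          σ (QuadField.y (gCalHbar A B)) = -QuadField.y (gCalHbar A B)) ∧
        FunctionField.IsQuotient σ π' ∧
        (φ (WeierstrassFunctionField.x (curveE A B)) =
            2 * QuadField.y (gCalHbar A B) + 2 * QuadField.x (gCalHbar A B) ^ 4
              + algebraMap K _ (curveE A B).a₁ * QuadField.x (gCalHbar A B) ^ 2 ∧
          φ (WeierstrassFunctionField.y (curveE A B)) =
            4 * QuadField.x (gCalHbar A B) ^ 2 * QuadField.y (gCalHbar A B)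
              + 4 * QuadField.x (gCalHbar A B) ^ 6
              + algebraMap K _ (2 * (curveE A B).a₁) * QuadField.x (gCalHbar A B) ^ 4
              + algebraMap K _ (2 * (curveE A B).a₂) * QuadField.x (gCalHbar A B) ^ 2) ∧
        (∀ P, WeierstrassFunctionField.IsPlaceAt (pt P) P) ∧
        ∀ P, (e P : FunctionField.Pic K (QuadField (gCalHbar A B))) =
          QuotientAddGroup.mk (FunctionField.pullback φ
            (Finsupp.single (pt P) 1 - Finsupp.single (pt 0) 1))) := by
  refine ⟨?_, ⟨Δ_curveE a b, ?_, ?_⟩, ?_⟩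
  · have := isDomain_HRing hD
    have := isDomain_CalHRing hζ hD
    have : IsDomain (QuadRing (gHbar a b)) := QuadField.isDomain_of_not_isSquare not_isSquare_gHbar
    have : IsDomain (QuadRing (gCalHbar a b)) :=
      QuadField.isDomain_of_not_isSquare (not_isSquare_gCalHbar hD)
    have : IsDomain (QuadRing (gE a b)) := QuadField.isDomain_of_not_isSquare (not_isSquare_gE hD)
    obtain ⟨α, hαx, hαz⟩ := HField.exists_scale (a := a) (b := b) hζ.pow_eq_one
    obtain ⟨α', hα'x, hα'z, hα'w⟩ := CalHField.exists_scale (a := a) (b := b) hζ.pow_eq_one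
    obtain ⟨τ, hτx, hτy⟩ := QuadField.exists_negX (a := a) (b := b) (.inl rfl)
    obtain ⟨σ, hσx, hσy⟩ := QuadField.exists_negX (a := a) (b := b) (.inr rfl)
    obtain ⟨p, hpx, hpy⟩ := HField.exists_quotientMap (a := a) (b := b)
    obtain ⟨p', hp'x, hp'y⟩ := CalHField.exists_quotientMap (a := a) (b := b)
    obtain ⟨π', hπ'x, hπ'y⟩ := QuadField.exists_mapHbar (a := a) (b := b)
    obtain ⟨q, hqx, hqy⟩ := QuadField.exists_mapE (a := a) (b := b)
    refine ⟨‹_›, ‹_›, ‹_›, ‹_›, ‹_›, α, α', τ, σ, CalHField.ofHField a b, p, p', π', q,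
      ⟨hαx, hαz⟩, ⟨hα'x, hα'z, hα'w⟩, ⟨hτx, hτy⟩, ⟨hσx, hσy⟩,
      ⟨CalHField.ofHField_x, CalHField.ofHField_z⟩, ⟨hpx, ?_⟩, ⟨hπ'x, hπ'y⟩, ⟨hp'x, ?_⟩,
      ⟨hqx, hqy⟩, ?_, HField.isQuotient hζ hαx hαz hpx hpy,
      CalHField.isQuotient hζ hα'x hα'w hp'x hp'y,
      (QuadField.isInvolutionQuotient_mapHbar hπ'x hπ'y hσx hσy).quot,
      (QuadField.isInvolutionQuotient_mapE hqx hqy hτx hτy).quot, fun hab => genus_gHbar hD hab,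
      fun hab => genus_gCalHbar hD hab, genus_gE hD⟩
    · rw [hpy, HField.aeval_sumPoly]
    · rw [hp'y, hpy]
    · exact CalHField.comp_eq hpx hpy hp'x hp'y hπ'x hπ'y
  · have hell : (curveE a b).IsElliptic := ⟨(Δ_curveE_ne_zero hD).isUnit⟩
    exact ⟨hell, j_curveE hD⟩
  · have : IsDomain (QuadRing (gE a b)) := QuadField.isDomain_of_not_isSquare (not_isSquare_gE hD)
    exact exists_equiv_curveE
  · rintro hab A B rfl rfl
    have : CharZero K := charZero_of_injective_algebraMap (algebraMap k K).injective
    have hD' : algebraMap k K a * DeltaAB (algebraMap k K a) (algebraMap k K b) ≠ 0 := by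
      rw [← map_DeltaAB, ← map_mul]
      exact (_root_.map_ne_zero _).2 hD
    have hab' : algebraMap k K a + algebraMap k K b ≠ 1 := by
      rw [← map_add, ← map_one (algebraMap k K)]
      exact (algebraMap k K).injective.ne hab
    have hd : IsDomain (QuadRing (gHbar (algebraMap k K a) (algebraMap k K b))) :=
      QuadField.isDomain_of_not_isSquare not_isSquare_gHbar
    have hd' : IsDomain (QuadRing (gCalHbar (algebraMap k K a) (algebraMap k K b))) :=
      QuadField.isDomain_of_not_isSquare (not_isSquare_gCalHbar hD')
    obtain ⟨σ, hσx, hσy⟩ := QuadField.exists_negX (a := algebraMap k K a) (b := algebraMap k K b)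
      (.inr rfl)
    obtain ⟨π', hπ'x, hπ'y⟩ := QuadField.exists_mapHbar (a := algebraMap k K a)
      (b := algebraMap k K b)
    obtain ⟨φ, pt, e, hφ, hpt, he⟩ := exists_prym_equiv hD' hab' hσx hσy
    exact ⟨hd, hd', π', σ, φ, pt, e, ⟨hπ'x, hπ'y⟩, ⟨hσx, hσy⟩,
      (QuadField.isInvolutionQuotient_mapHbar hπ'x hπ'y hσx hσy).quot, hφ, hpt, he⟩
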